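/- Let $\delta>-1$. Let $BI_1,BI_2,\dots$ be independent continuous-time birth processes with immigration, i.e. Markov chains on $\mathbb N$ whose only transitions are $j\to j+1$, at rate $j+\delta$, with $BI_1(0)=2$ and $BI_i(0)=1$ for $i\ge2$. Let $\tau^{(i)}_1<\tau^{(i)}_2<\cdots$ be the jump times of $BI_i$. Define $T^A_1=0$ and, for $n\ge1$, $$T^A_{n+1}=\min\{T^A_i+\tau^{(i)}_k:\ k\ge1,\ 1\le i\le n,\ T^A_i+\tau^{(i)}_k>T^A_n\},$$ and define $T^B_0=T^B_1=0$ and, for $n\ge1$, $$T^B_{n+1}=\min\{T^B_{i-1}+\tau^{(i)}_k:\ k\ge1,\ 1\le i\le n+1,\ T^B_{i-1}+\tau^{(i)}_k>T^B_n\}.$$ The linear preferential attachment graphs $G(n)$, $n\ge 1$, start from $G(1)$, a single node $v_1$ with a self loop; $G(n+1)$ arises from $G(n)$ by adding a node $v_{n+1}$ and one edge. Write $D_i(n)$ for the degree of $v_i$ in $G(n)$ (a self loop counts twice), and $D_i(n)=0$ for $i>n$. In Model A, given $G(n)$, $v_{n+1}$ is joined to $v_j$, $1\le j\le n$, with probability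 $\frac{D_j(n)+\delta}{\sum_{i\le n}(D_i(n)+\delta)}$. In Model B, given $G(n)$, $v_{n+1}$ is joined to $v_j$, $1\le j\le n$, with probability $\frac{D_j(n)+\delta}{\sum_{i\le n}(D_i(n)+\delta)+1+\delta}$, and is given a self loop with probability $\frac{1+\delta}{\sum_{i\le n}(D_i(n)+\delta)+1+\delta}$. Then there are random variables $W_A$, $W_B$ and $\sigma_1,\sigma_2,\dots$, on the probability space of the $BI_i$, such that $$\frac{n}{e^{(2+\delta)T^A_n}}\to W_A\sim\mathrm{Exp}(1),\qquad \frac{n}{e^{(2+\delta)T^B_n}}\to W_B\sim\mathrm{Gamma}\Big(\tfrac{3+2\delta}{2+\delta},1\Big)\qquad\text{a.s.},$$ and the following hold. (i) For each $i\ge1$, almost surely as $n\to\infty$, $$\frac{BI_i(T^A_n-T^A_i)}{e^{T^A_n}}\to\sigma_ie^{-T^A_i},\qquad \frac{BI_i(T^B_n-T^B_{i-1})}{e^{T^B_n}}\to\sigma_ie^{-T^B_{i-1}}.$$ The $\sigma_i$ are independent, $\sigma_1\sim\mathrm{Gamma}(2+\delta,1)$, and $\sigma_i\sim\mathrm{Gamma}(1+\delta,1)$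 for $i\ge2$. For each $i\ge1$, $\sigma_i$ is independent of $e^{-T^A_i}$, and $\sigma_i$ is independent of $e^{-T^B_{i-1}}$. (ii) The maxima $\max_{i\ge1}\sigma_ie^{-T^A_i}$ and $\max_{i\ge1}\sigma_ie^{-T^B_{i-1}}$ are almost surely attained. On the probability space of the $BI_i$ there are graph processes of Model A and of Model B whose degrees are, almost surely for all $1\le i\le n$, $D^A_i(n)=BI_i(T^A_n-T^A_i)$ and $D^B_i(n)=BI_i(T^B_n-T^B_{i-1})$ respectively, and for these, in probability, $$\max_{i\ge1}\frac{D^A_i(n)}{n^{1/(2+\delta)}}\to W_A^{-1/(2+\delta)}\max_{i\ge1}\sigma_ie^{-T^A_i},\qquad \max_{i\ge1}\frac{D^B_i(n)}{n^{1/(2+\delta)}}\to W_B^{-1/(2+\delta)}\max_{i\ge1}\sigma_ie^{-T^B_{i-1}}.$$ Moreover, for every graph process of Model A (respectively Model B), on any probability space, $\max_{i}D_i(n)/n^{1/(2+\delta)}$ converges in probability to a random variable with the law of the corresponding limit above. -/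

import Mathlib

open MeasureTheory ProbabilityTheory Filter Topology

namespace PrefAttach

/-! ### The preferential attachment graphs

The graph `G(n)` has nodes `v_1, ..., v_n` and `n` edges. The `m`-th edge is born together with `v_m`
and joins `v_m` to `v_(a m)`, where `a m ≤ m`; it is a self loop if `a m = m`, and `a 1 = 1`.
So the growing graph is recorded by the sequence `a` of attachment targets, whose
first `n` terms determine `G(n)` and are determined by it. -/

/-- The degree of node `v_i` in `G(n)`: the number of edge endpoints at `v_i`, so that a self loop
counts twice. It is `0` for `i > n` (as `a m ≤ m`). -/
def degree (a : ℕ → ℕ) (i n : ℕ) : ℕ :=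
  ∑ m ∈ Finset.Icc 1 n, ((if m = i then 1 else 0) + (if a m = i then 1 else 0))

/-- The maximal degree in `G(n)`. -/
def maxDegree (a : ℕ → ℕ) (n : ℕ) : ℕ :=
  (Finset.Icc 1 n).sup fun i => degree a i n

/-- The total weight `∑ (D_i(n) + δ)` over the nodes of `G(n)`. -/
noncomputable def totalWeight (δ : ℝ) (a : ℕ → ℕ) (n : ℕ) : ℝ :=
  ∑ i ∈ Finset.Icc 1 n, ((degree a i n : ℝ) + δ)

/-- The event that `G(n)` is the graph given by the targets `a 1, ..., a n`. -/
def history {Ω : Type*} (J : ℕ → Ω → ℕ) (a : ℕ → ℕ) (n : ℕ) : Set Ω :=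
  {ω | ∀ m, 1 ≤ m → m ≤ n → J m ω = a m}

/-- Model A (linear preferential attachment): `G(1)` is one node with a self loop and, given `G(n)`,
the new node `v_(n+1)` is joined to `v_j`, `1 ≤ j ≤ n`, with probability
`(D_j(n) + δ) / ∑_{i ≤ n} (D_i(n) + δ)`. -/
structure IsModelA {Ω : Type*} [MeasurableSpace Ω] (P : Measure Ω) (δ : ℝ)
    (J : ℕ → Ω → ℕ) : Prop where
  measurable : ∀ n, 1 ≤ n → Measurable (J n)
  init : ∀ᵐ ω ∂P, J 1 ω = 1
  step : ∀ n, 1 ≤ n → ∀ a : ℕ → ℕ, P (history J a n) ≠ 0 → ∀ j, 1 ≤ j → j ≤ n →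
    (P[|history J a n]).real {ω | J (n + 1) ω = j} =
      ((degree a j n : ℝ) + δ) / totalWeight δ a n

/-- Model B (linear preferential attachment): `G(1)` is one node with a self loop and, given `G(n)`,
the new node `v_(n+1)` is joined to `v_j`, `1 ≤ j ≤ n`, with probability
`(D_j(n) + δ) / (∑_{i ≤ n} (D_i(n) + δ) + 1 + δ)`, and is given a self loop with probability
`(1 + δ) / (∑_{i ≤ n} (D_i(n) + δ) + 1 + δ)`. -/
structure IsModelB {Ω : Type*} [MeasurableSpace Ω] (P : Measure Ω) (δ : ℝ)
    (J : ℕ → Ω → ℕ) : Prop where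
  measurable : ∀ n, 1 ≤ n → Measurable (J n)
  init : ∀ᵐ ω ∂P, J 1 ω = 1
  step : ∀ n, 1 ≤ n → ∀ a : ℕ → ℕ, P (history J a n) ≠ 0 → ∀ j, 1 ≤ j → j ≤ n →
    (P[|history J a n]).real {ω | J (n + 1) ω = j} =
      ((degree a j n : ℝ) + δ) / (totalWeight δ a n + 1 + δ)
  loop : ∀ n, 1 ≤ n → ∀ a : ℕ → ℕ, P (history J a n) ≠ 0 →
    (P[|history J a n]).real {ω | J (n + 1) ω = n + 1} =
      (1 + δ) / (totalWeight δ a n + 1 + δ)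

/-! ### Birth processes with immigration -/

/-- The `k`-th jump time of a path `x` (on `[0, ∞)`) that starts at `x₀` and jumps by `+1`:
the first time at which the path has reached `x₀ + k`. -/
noncomputable def jumpTime (x₀ : ℕ) (x : ℝ → ℕ) (k : ℕ) : ℝ :=
  sInf {t : ℝ | 0 ≤ t ∧ x₀ + k ≤ x t}

/-- The time a path spends in the state `x₀ + k`. -/
noncomputable def holdingTime (x₀ : ℕ) (x : ℝ → ℕ) (k : ℕ) : ℝ :=
  jumpTime x₀ x (k + 1) - jumpTime x₀ x k

/-- `X` is a continuous time Markov chain on `ℕ` started at `x₀` whose only transitions are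
`j → j + 1`, with rate `q j`: almost all paths are right-continuous and nondecreasing, and the
successive holding times are independent, exponential with rates `q x₀, q (x₀ + 1), ...`
(a path that skipped a state, or got stuck, would have a holding time that is not positive). -/
structure IsBirthProcess {Ω : Type*} [MeasurableSpace Ω] (P : Measure Ω) (x₀ : ℕ) (q : ℕ → ℝ)
    (X : ℝ → Ω → ℕ) : Prop where
  measurable : ∀ t, 0 ≤ t → Measurable (X t)
  init : ∀ᵐ ω ∂P, X 0 ω = x₀
  mono : ∀ᵐ ω ∂P, MonotoneOn (fun t => X t ω) (Set.Ici 0)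
  rightCont : ∀ᵐ ω ∂P, ∀ t, 0 ≤ t → ContinuousWithinAt (fun s => X s ω) (Set.Ici t) t
  holding_law : ∀ k : ℕ,
    HasLaw (fun ω => holdingTime x₀ (fun t => X t ω) k) (expMeasure (q (x₀ + k))) P
  holding_indep : iIndepFun (fun (k : ℕ) ω => holdingTime x₀ (fun t => X t ω) k) P

/-- The initial values `BI_1(0) = 2` and `BI_i(0) = 1`, `i ≥ 2`. -/
def start (i : ℕ) : ℕ := if i = 1 then 2 else 1

/-- `BI_1, BI_2, ...` are independent birth-immigration processes, started at `2, 1, 1, ...`, with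
transition rates `q_{j,j+1} = j + δ`. Independence of the processes is stated through the holding
times (of all processes together), which determine the paths. The index `0` is not used. -/
structure IsBIFamily {Ω : Type*} [MeasurableSpace Ω] (P : Measure Ω) (δ : ℝ)
    (BI : ℕ → ℝ → Ω → ℕ) : Prop where
  process : ∀ i, 1 ≤ i → IsBirthProcess P (start i) (fun j => (j : ℝ) + δ) (BI i)
  indep : iIndepFun
    (fun (p : ℕ+ × ℕ) ω => holdingTime (start p.1) (fun t => BI p.1 t ω) p.2) P

/-! ### The embedding -/

/-- The branching times of Model A from the jump times `τ i k` of the processes: `T_1 = 0` and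
`T_{n+1} = min {T_i + τ i k : k ≥ 1, T_i + τ i k > T_n, 1 ≤ i ≤ n}`. (The value at `0` is not
used.) -/
noncomputable def branchTimeA (τ : ℕ → ℕ → ℝ) : ℕ → ℝ
  | 0 => 0
  | 1 => 0
  | n + 2 => sInf {s : ℝ | ∃ i k : ℕ, ∃ _ : 1 ≤ i ∧ i ≤ n + 1, 1 ≤ k ∧
      s = branchTimeA τ i + τ i k ∧ branchTimeA τ (n + 1) < s}
termination_by n => n
decreasing_by all_goals omega

/-- The branching times of Model B from the jump times `τ i k` of the processes: `T_0 = T_1 = 0` and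
`T_{n+1} = min {T_{i-1} + τ i k : k ≥ 1, T_{i-1} + τ i k > T_n, 1 ≤ i ≤ n + 1}`. -/
noncomputable def branchTimeB (τ : ℕ → ℕ → ℝ) : ℕ → ℝ
  | 0 => 0
  | 1 => 0
  | n + 2 => sInf {s : ℝ | ∃ i k : ℕ, ∃ _ : 1 ≤ i ∧ i ≤ n + 2, 1 ≤ k ∧
      s = branchTimeB τ (i - 1) + τ i k ∧ branchTimeB τ (n + 1) < s}
termination_by n => n
decreasing_by all_goals omega

/-- The random branching time `T^A_n`. -/
noncomputable def TA {Ω : Type*} (BI : ℕ → ℝ → Ω → ℕ) (n : ℕ) (ω : Ω) : ℝ :=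
  branchTimeA (fun i k => jumpTime (start i) (fun t => BI i t ω) k) n

/-- The random branching time `T^B_n`. -/
noncomputable def TB {Ω : Type*} (BI : ℕ → ℝ → Ω → ℕ) (n : ℕ) (ω : Ω) : ℝ :=
  branchTimeB (fun i k => jumpTime (start i) (fun t => BI i t ω) k) n

/-- The limit `W_A^{-1/(2+δ)} max_{i ≥ 1} σ_i e^{-T^A_i}`. -/
noncomputable def limitA {Ω : Type*} (δ : ℝ) (BI : ℕ → ℝ → Ω → ℕ) (σ : ℕ → Ω → ℝ) (W : Ω → ℝ)
    (ω : Ω) : ℝ :=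
  W ω ^ (-(1 / (2 + δ))) * ⨆ i : ℕ+, σ i ω * Real.exp (-TA BI i ω)

/-- The limit `W_B^{-1/(2+δ)} max_{i ≥ 1} σ_i e^{-T^B_{i-1}}`. -/
noncomputable def limitB {Ω : Type*} (δ : ℝ) (BI : ℕ → ℝ → Ω → ℕ) (σ : ℕ → Ω → ℝ) (W : Ω → ℝ)
    (ω : Ω) : ℝ :=
  W ω ^ (-(1 / (2 + δ))) * ⨆ i : ℕ+, σ i ω * Real.exp (-TB BI ((i : ℕ) - 1) ω)

/-- The normalized maximal degree `max_i D_i(n) / n^{1/(2+δ)}` of the graph process given by the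
random targets `J`. -/
noncomputable def normMaxDegree {Ω : Type*} (δ : ℝ) (J : ℕ → Ω → ℕ) (n : ℕ) (ω : Ω) : ℝ :=
  (maxDegree (fun m => J m ω) n : ℝ) / (n : ℝ) ^ (1 / (2 + δ))

end PrefAttach

open PrefAttach

namespace PrefAttach

/-! ### Exponential and gamma integrals -/

/-! Put `β = 1 + δ` and let row `i` hold the holding times of `BI_{i+1}`: independent exponentials
of rates `d i + k + β`, with `d 0 = 1` and `d i = 0` for `i ≥ 1`. The branching times are the
successive rings of the active rows, one more row being activated at each ring. Model A starts with
`N = 1` active row, Model B with `N = 2`, since there the node about to be born already competes,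
for its own self loop.

By lack of memory (`measure_wins`), row `j` wins a competition with probability proportional to its
rate. Whoever wins, the waiting time is exponential with the total rate, and the array seen
afterwards is independent of it and of the same kind, with one more win for row `j`. Iterating, the
winners follow the attachment rule (`measure_target`, `isModel_embedTarget`). Each ring raises the
total rate by `1 + β` (`1` for the winner, `β` for the new row), so the gaps are independent
exponentials whose rates form an arithmetic progression (`iIndepFun_gap`). Path by path,
`Regular.isLeast_elapsed` identifies the starting times of the competitions with the recursively
defined branching times, and `Regular.elapsed_mem` identifies wins with jumps of the processes.

All the limit laws come from one statement: if `E_l` are independent `Exp(a + l)` with partial sums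
`S_n`, then `n e^{-S_n}` converges almost surely to a positive `Gamma(a, 1)` variable
(`ae_tendsto_growthLimit`, `hasLaw_growthLimit`). Rows give `σ_i`; the gaps multiplied by `1 + β`
give `W_A` and `W_B`, with `a = (1 + N β) / (1 + β)`. Independence of `σ_i` from the starting time
of its row holds because that time depends only on earlier rows (`AgreeBelow.elapsed_eq`).

For the maximum, a martingale maximal inequality and Borel–Cantelli bound row `i`, uniformly in
time, by a power of `i` half as large as the decay `i^{-1/(1+β)}` of `e^{-T}` at its birth. Only
finitely many rows therefore matter (`tendsto_sup_mul`), and the normalized maximal degree of the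
embedded graph converges almost surely. Finally, a model determines the law of its sequence of
targets, so convergence and the law of the limit pass to every graph process
(`IsModel.exists_limit`). -/

lemma integral_gammaMeasure {a r : ℝ} (ha : 0 < a) (hr : 0 < r) (f : ℝ → ℂ) :
    ∫ x, f x ∂gammaMeasure a r = ∫ x in Set.Ioi 0, (gammaPDFReal a r x : ℂ) * f x := by
  have hm : Measurable (gammaPDF a r) := (measurable_gammaPDFReal a r).ennreal_ofReal
  rw [gammaMeasure, integral_withDensity_eq_integral_toReal_smul hm
    (Eventually.of_forall fun x => ENNReal.ofReal_lt_top), ← integral_Ici_eq_integral_Ioi,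
    ← setIntegral_eq_integral_of_forall_compl_eq_zero (s := Set.Ici 0)]
  · refine setIntegral_congr_fun measurableSet_Ici fun x _ => ?_
    simp only [gammaPDF, ENNReal.toReal_ofReal (gammaPDFReal_nonneg ha hr x), Complex.real_smul]
  · intro x hx
    simp [gammaPDF_of_neg (a := a) (r := r) (not_le.mp hx)]

/-- The complex parameter lets one formula serve twice: real `z` gives the means in the exponential
martingales, imaginary `z` the characteristic functions. -/
lemma integral_cexp_expMeasure {r : ℝ} (hr : 0 < r) {z : ℂ} (hz : -r < z.re) :
    ∫ x, Complex.exp (-z * x) ∂expMeasure r = r / (r + z) := by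
  rw [expMeasure, integral_gammaMeasure one_pos hr]
  have h : ∀ x ∈ Set.Ioi (0 : ℝ), (gammaPDFReal 1 r x : ℂ) * Complex.exp (-z * x) =
      r * Complex.exp (-(r + z) * x) := by
    intro x hx
    simp only [gammaPDFReal, if_pos (le_of_lt (Set.mem_Ioi.mp hx)), Real.rpow_one, Real.Gamma_one,
      div_one, sub_self, Real.rpow_zero, mul_one]
    push_cast
    rw [mul_assoc, ← Complex.exp_add]
    congr 2
    ring
  rw [setIntegral_congr_fun measurableSet_Ioi h, integral_const_mul,
    integral_exp_mul_complex_Ioi (by simp; linarith)]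
  simp [div_eq_mul_inv, neg_inv]

/-- Without integrability the Bochner integral would be `0`, but the formula for the complex
exponential gives a nonzero value. -/
lemma integrable_exp_expMeasure {r : ℝ} (hr : 0 < r) {s : ℝ} (hs : -r < s) :
    Integrable (fun x => Real.exp (-s * x)) (expMeasure r) := by
  by_contra h
  have h1 := integral_cexp_expMeasure hr (z := s) (by simpa using hs)
  have h2 : ¬ Integrable (fun x : ℝ => Complex.exp (-(s : ℂ) * x)) (expMeasure r) := by
    intro h3
    apply h
    refine (h3.re).congr (Eventually.of_forall fun x => ?_)
    simp [← Complex.ofReal_neg, ← Complex.ofReal_mul, Complex.exp_ofReal_re]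
  rw [integral_undef h2] at h1
  have h3 : (r : ℂ) + s ≠ 0 := by
    norm_cast
    linarith
  have h4 : (r : ℂ) ≠ 0 := by exact_mod_cast hr.ne'
  exact div_ne_zero h4 h3 h1.symm

lemma integral_exp_expMeasure {r : ℝ} (hr : 0 < r) {s : ℝ} (hs : -r < s) :
    ∫ x, Real.exp (-s * x) ∂expMeasure r = r / (r + s) := by
  have h1 := integral_cexp_expMeasure hr (z := s) (by simpa using hs)
  have : ∀ x : ℝ, Complex.exp (-(s : ℂ) * x) = ((Real.exp (-s * x) : ℝ) : ℂ) := fun x => by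
    push_cast; rfl
  simp_rw [this] at h1
  rw [integral_complex_ofReal] at h1
  exact_mod_cast h1

/-- At imaginary `z` this is the characteristic function of the logarithm of a gamma variable. -/
lemma integral_cpow_gammaMeasure {a : ℝ} (ha : 0 < a) {z : ℂ} (hz : -a < z.re) :
    ∫ x, (x : ℂ) ^ z ∂gammaMeasure a 1 = Complex.Gamma (a + z) / Complex.Gamma a := by
  rw [integral_gammaMeasure ha one_pos, Complex.Gamma_eq_integral (by simp; linarith),
    Complex.GammaIntegral, div_eq_inv_mul, ← integral_const_mul]
  refine setIntegral_congr_fun measurableSet_Ioi fun x hx => ?_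
  have hx' : (0 : ℝ) < x := hx
  have hx0 : (x : ℂ) ≠ 0 := by exact_mod_cast hx'.ne'
  simp only [gammaPDFReal, if_pos hx'.le, Real.one_rpow, one_mul]
  rw [add_sub_right_comm, Complex.cpow_add _ _ hx0]
  push_cast [Complex.ofReal_cpow hx'.le, Complex.Gamma_ofReal]
  ring

lemma expMeasure_Iic_zero (r : ℝ) : expMeasure r (Set.Iic 0) = 0 := by
  rw [expMeasure, gammaMeasure, withDensity_apply _ measurableSet_Iic,
    setLIntegral_congr Iio_ae_eq_Iic.symm, lintegral_gammaPDF_of_nonpos le_rfl]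

/-! ### Asymptotics of the normalizing products -/

/-- Quotient of Gauss's products (`Real.GammaSeq`) at `a + s` and at `a`: the factorials cancel and
the powers of `n` leave `n ^ s`. -/
lemma tendsto_rpow_mul_prod {a s : ℝ} (ha : 0 < a) (hs : -a < s) :
    Tendsto (fun n : ℕ => (n : ℝ) ^ s * ∏ j ∈ Finset.range (n + 1), (a + j) / (a + j + s)) atTop
      (𝓝 (Real.Gamma (a + s) / Real.Gamma a)) := by
  have h := (Real.GammaSeq_tendsto_Gamma (a + s)).div (Real.GammaSeq_tendsto_Gamma a)
    (Real.Gamma_pos_of_pos ha).ne'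
  refine h.congr' ?_
  filter_upwards [eventually_gt_atTop 0] with n hn
  have hn' : (0 : ℝ) < n := by exact_mod_cast hn
  have h1 : ∏ j ∈ Finset.range (n + 1), (a + j : ℝ) ≠ 0 :=
    Finset.prod_ne_zero_iff.mpr fun j _ => by positivity
  have h2 : ∏ j ∈ Finset.range (n + 1), (a + s + j : ℝ) ≠ 0 :=
    Finset.prod_ne_zero_iff.mpr fun j _ => by
      have : (0 : ℝ) ≤ j := by positivity
      linarith
  have h3 : (n.factorial : ℝ) ≠ 0 := by positivity
  simp only [Pi.div_apply, Real.GammaSeq, Finset.prod_div_distrib, Real.rpow_add hn']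
  have h4 : ∏ j ∈ Finset.range (n + 1), (a + j + s : ℝ) =
    ∏ j ∈ Finset.range (n + 1), (a + s + j : ℝ) := Finset.prod_congr rfl fun j _ => by ring
  rw [h4]
  field_simp

lemma tendsto_cpow_mul_prod {a : ℝ} {z : ℂ} (ha : 0 < a) (hz : -a < z.re) :
    Tendsto (fun n : ℕ => (n : ℂ) ^ z * ∏ j ∈ Finset.range (n + 1), ((a : ℂ) + j) / (a + j + z))
      atTop (𝓝 (Complex.Gamma (a + z) / Complex.Gamma a)) := by
  have h := (Complex.GammaSeq_tendsto_Gamma (a + z)).div (Complex.GammaSeq_tendsto_Gamma a)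
    (Complex.Gamma_ne_zero_of_re_pos (by simpa using ha))
  refine h.congr' ?_
  filter_upwards [eventually_gt_atTop 0] with n hn
  have hn' : (n : ℂ) ≠ 0 := by exact_mod_cast hn.ne'
  have h1 : ∏ j ∈ Finset.range (n + 1), ((a : ℂ) + j) ≠ 0 :=
    Finset.prod_ne_zero_iff.mpr fun j _ => by
      norm_cast
      positivity
  have h2 : ∏ j ∈ Finset.range (n + 1), ((a : ℂ) + z + j) ≠ 0 :=
    Finset.prod_ne_zero_iff.mpr fun j _ h => by
      have := congrArg Complex.re h
      simp at this
      have : (0 : ℝ) ≤ j := by positivity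
      linarith
  have h3 : (n.factorial : ℂ) ≠ 0 := by exact_mod_cast n.factorial_ne_zero
  have h5 : (n : ℂ) ^ (a : ℂ) ≠ 0 := by simp [Complex.cpow_eq_zero_iff, hn']
  simp only [Pi.div_apply, Complex.GammaSeq, Finset.prod_div_distrib, Complex.cpow_add _ _ hn']
  have h4 : ∏ j ∈ Finset.range (n + 1), ((a : ℂ) + j + z) =
    ∏ j ∈ Finset.range (n + 1), ((a : ℂ) + z + j) := Finset.prod_congr rfl fun j _ => by ring
  rw [h4]
  field_simp

/-! ### Products of independent variables of mean one -/

section ProductMartingale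

variable {Ω : Type*} [MeasurableSpace Ω] {μ : Measure Ω} [IsProbabilityMeasure μ]

lemma integrable_prod_range_of_iIndepFun {Y : ℕ → Ω → ℝ} (hm : ∀ l, Measurable (Y l))
    (hi : iIndepFun Y μ) (hint : ∀ l, Integrable (Y l) μ) (n : ℕ) :
    Integrable (∏ l ∈ Finset.range n, Y l) μ := by
  induction n with
  | zero => exact integrable_const (1 : ℝ)
  | succ n ih =>
    rw [Finset.prod_range_succ]
    exact (hi.indepFun_prod_range_succ hm n).integrable_mul ih (hint n)

lemma martingale_prod_of_iIndepFun {Y : ℕ → Ω → ℝ} (hm : ∀ l, Measurable (Y l))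
    (hi : iIndepFun Y μ) (hint : ∀ l, Integrable (Y l) μ) (hmean : ∀ l, ∫ ω, Y l ω ∂μ = 1) :
    Martingale (fun n => ∏ l ∈ Finset.range (n + 1), Y l)
      (Filtration.natural Y fun l => (hm l).stronglyMeasurable) μ := by
  set 𝓕 := Filtration.natural Y fun l => (hm l).stronglyMeasurable
  have hY : ∀ l n, l ≤ n → StronglyMeasurable[𝓕 n] (Y l) := fun l n hln =>
    (Filtration.stronglyAdapted_natural (fun l => (hm l).stronglyMeasurable) l).mono (𝓕.mono hln)
  have hadp : StronglyAdapted 𝓕 (fun n => ∏ l ∈ Finset.range (n + 1), Y l) := fun n =>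
    Finset.stronglyMeasurable_prod _ fun l hl => hY l n (Nat.lt_succ_iff.mp (Finset.mem_range.mp hl))
  have hI := fun n => integrable_prod_range_of_iIndepFun hm hi hint n
  refine martingale_nat hadp (fun n => hI _) fun n => ?_
  have h1 : μ[Y (n + 1) | 𝓕 n] =ᵐ[μ] fun _ => ∫ ω, Y (n + 1) ω ∂μ :=
    condExp_indep_eq (hm (n + 1)).comap_le (𝓕.le n)
      (comap_measurable (Y (n + 1))).stronglyMeasurable
      (hi.indep_comap_natural_of_lt (fun l => (hm l).stronglyMeasurable) n.lt_succ_self)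
  have h2 := condExp_mul_of_stronglyMeasurable_left (μ := μ) (hadp n) (g := Y (n + 1))
    (by simpa only [Finset.prod_range_succ] using hI (n + 2)) (hint (n + 1))
  have h3 : (∏ l ∈ Finset.range (n + 1 + 1), Y l) =
      (∏ l ∈ Finset.range (n + 1), Y l) * Y (n + 1) := Finset.prod_range_succ _ _
  simp only [h3]
  filter_upwards [h1, h2] with ω hω1 hω2
  rw [hω2, Pi.mul_apply, hω1, hmean, mul_one]

/-- The maximal inequality for the running maximum over all times. -/
lemma maximal_ineq_exists {f : ℕ → Ω → ℝ} {𝓕 : Filtration ℕ ‹MeasurableSpace Ω›}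
    (hf : Martingale f 𝓕 μ) (h0 : ∀ n ω, 0 ≤ f n ω) (h1 : ∀ n, ∫ ω, f n ω ∂μ = 1) {x : ℝ}
    (hx : 0 < x) : μ {ω | ∃ n, x ≤ f n ω} ≤ ENNReal.ofReal x⁻¹ := by
  set s : ℕ → Set Ω := fun n =>
    {ω | x ≤ (Finset.range (n + 1)).sup' Finset.nonempty_range_add_one fun k => f k ω}
  have hs : {ω | ∃ n, x ≤ f n ω} ⊆ ⋃ n, s n := by
    rintro ω ⟨n, hn⟩
    exact Set.mem_iUnion.mpr ⟨n, hn.trans (Finset.le_sup' (fun k => f k ω) (by simp))⟩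
  have hmono : Monotone s := fun m n hmn ω hω =>
    le_trans (show x ≤ _ from hω) (Finset.sup'_mono _ (by gcongr) _)
  refine (measure_mono hs).trans ?_
  rw [hmono.measure_iUnion]
  refine iSup_le fun n => ?_
  have h := maximal_ineq (ε := x.toNNReal) hf.submartingale (fun n ω => h0 n ω) n
  have h2 : ∫ ω in s n, f n ω ∂μ ≤ 1 := by
    rw [← h1 n]
    exact setIntegral_le_integral (hf.integrable n) (Eventually.of_forall (h0 n))
  have hx' : ((x.toNNReal : NNReal) : ℝ) = x := Real.coe_toNNReal x hx.le
  rw [hx'] at h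
  have h3 : (x.toNNReal : ENNReal) * μ (s n) ≤ 1 :=
    h.trans ((ENNReal.ofReal_le_ofReal h2).trans ENNReal.ofReal_one.le)
  rw [ENNReal.ofReal_inv_of_pos hx]
  exact ENNReal.le_inv_iff_mul_le.mpr (by rwa [mul_comm] at h3)

end ProductMartingale

/-! ### The limit of a pure birth process with linear rates -/

/-- The limit of `n e^{-S_n}`, `S_n` being the partial sums of `h`. -/
noncomputable def growthLimit (h : ℕ → ℝ) : ℝ :=
  limsup (fun n : ℕ => (n : ℝ) * Real.exp (-∑ l ∈ Finset.range n, h l)) atTop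

lemma measurable_growthLimit : Measurable growthLimit :=
  Measurable.limsup fun n => by fun_prop

section Growth

variable {Ω : Type*} [MeasurableSpace Ω] {μ : Measure Ω} [IsProbabilityMeasure μ] {a : ℝ}
  {E : ℕ → Ω → ℝ}

/-- A product of independent factors `e^{-s E_l}`, each divided by its mean `(a + l) / (a + l + s)`.
Negative `s` is allowed because it is what later keeps the limit away from `0`. -/
lemma martingale_exp_sum (ha : 0 < a) (hm : ∀ l, Measurable (E l)) (hi : iIndepFun E μ)
    (hl : ∀ l : ℕ, HasLaw (E l) (expMeasure (a + l)) μ) {s : ℝ} (hs : -a < s) :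
    ∃ 𝓕 : Filtration ℕ ‹MeasurableSpace Ω›, Martingale (fun n ω =>
      Real.exp (-s * ∑ l ∈ Finset.range (n + 1), E l ω) /
        ∏ l ∈ Finset.range (n + 1), (a + l) / (a + l + s)) 𝓕 μ ∧
      ∀ n, ∫ ω, Real.exp (-s * ∑ l ∈ Finset.range (n + 1), E l ω) /
        ∏ l ∈ Finset.range (n + 1), (a + l) / (a + l + s) ∂μ = 1 := by
  have hal : ∀ l : ℕ, 0 < a + l := fun l => by positivity
  have hals : ∀ l : ℕ, 0 < a + l + s := fun l => by
    have : (0 : ℝ) ≤ l := by positivity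
    linarith
  set g : ℕ → ℝ → ℝ := fun l x => Real.exp (-s * x) / ((a + l) / (a + l + s)) with hg
  have hgm : ∀ l, Measurable (g l) := fun l => by simp only [hg]; fun_prop
  set Y : ℕ → Ω → ℝ := fun l => g l ∘ E l with hY
  have hYm : ∀ l, Measurable (Y l) := fun l => (hgm l).comp (hm l)
  have hYi : iIndepFun Y μ := hi.comp g hgm
  have hint : ∀ l, Integrable (Y l) μ := fun l => by
    have := integrable_exp_expMeasure (hal l) (s := s) (by linarith [hals l])
    rw [← (hl l).map_eq] at this
    exact ((integrable_map_measure this.1 (hm l).aemeasurable).mp this).div_const _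
  have hmean : ∀ l, ∫ ω, Y l ω ∂μ = 1 := fun l => by
    have h := integral_exp_expMeasure (hal l) (s := s) (by linarith [hals l])
    rw [← (hl l).map_eq, integral_map (hm l).aemeasurable (by fun_prop)] at h
    simp only [hY, hg, Function.comp_apply]
    rw [integral_div, h, div_self (div_pos (hal l) (hals l)).ne']
  have hprod : ∀ n : ℕ, (∏ l ∈ Finset.range (n + 1), Y l) = fun ω =>
      Real.exp (-s * ∑ l ∈ Finset.range (n + 1), E l ω) /
        ∏ l ∈ Finset.range (n + 1), (a + l) / (a + l + s) := fun n => by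
    ext ω
    simp only [Finset.prod_apply, hY, hg, Function.comp_apply, Finset.prod_div_distrib,
      Finset.mul_sum, Real.exp_sum]
  have hM := martingale_prod_of_iIndepFun hYm hYi hint hmean
  simp only [hprod] at hM
  refine ⟨_, hM, fun n => ?_⟩
  -- The mean of a martingale is constant, so it is read off at time `0`, where a single factor is
  -- present.
  have h := hM.setIntegral_eq (Nat.zero_le n) MeasurableSet.univ
  simp only [setIntegral_univ] at h
  rw [← h]
  have h0 := congrArg (fun f : Ω → ℝ => ∫ ω, f ω ∂μ) (hprod 0)
  rw [← h0]
  simpa using hmean 0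

lemma ae_exists_tendsto_rpow_mul_exp (ha : 0 < a) (hm : ∀ l, Measurable (E l)) (hi : iIndepFun E μ)
    (hl : ∀ l : ℕ, HasLaw (E l) (expMeasure (a + l)) μ) {s : ℝ} (hs : -a < s) :
    ∀ᵐ ω ∂μ, ∃ y, Tendsto (fun n : ℕ => (n : ℝ) ^ s *
      Real.exp (-s * ∑ l ∈ Finset.range (n + 1), E l ω)) atTop (𝓝 y) := by
  obtain ⟨𝓕, hM, hone⟩ := martingale_exp_sum ha hm hi hl hs
  have hpos : ∀ n : ℕ, 0 < ∏ l ∈ Finset.range (n + 1), (a + l) / (a + l + s) := fun n =>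
    Finset.prod_pos fun l _ => by
      have : (0 : ℝ) ≤ l := by positivity
      exact div_pos (by linarith) (by linarith)
  have hb : ∀ n, eLpNorm (fun ω => Real.exp (-s * ∑ l ∈ Finset.range (n + 1), E l ω) /
        ∏ l ∈ Finset.range (n + 1), (a + l) / (a + l + s)) 1 μ ≤ (1 : NNReal) := fun n => by
    rw [eLpNorm_one_eq_lintegral_enorm, ← ofReal_integral_norm_eq_lintegral_enorm (hM.integrable n)]
    have : ∀ ω, ‖Real.exp (-s * ∑ l ∈ Finset.range (n + 1), E l ω) /
        ∏ l ∈ Finset.range (n + 1), (a + l) / (a + l + s)‖ =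
        Real.exp (-s * ∑ l ∈ Finset.range (n + 1), E l ω) /
        ∏ l ∈ Finset.range (n + 1), (a + l) / (a + l + s) := fun ω =>
      Real.norm_of_nonneg (div_nonneg (Real.exp_nonneg _) (hpos n).le)
    simp only [this, hone n]
    simp
  filter_upwards [hM.submartingale.ae_tendsto_limitProcess hb] with ω hω
  refine ⟨_, ((tendsto_rpow_mul_prod ha hs).mul hω).congr fun n => ?_⟩
  have := (hpos n).ne'
  field_simp

/-- The constant is chosen before `E`, so that all rows with the same `a` share it, and `s` is free,
so that the tail can be made summable over the rows. -/
lemma measure_exists_le_mul_exp (ha : 0 < a) {s : ℝ} (hs : 0 < s) :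
    ∃ C : ℝ, 0 < C ∧ ∀ E : ℕ → Ω → ℝ, (∀ l, Measurable (E l)) → iIndepFun E μ →
      (∀ l : ℕ, HasLaw (E l) (expMeasure (a + l)) μ) → ∀ x : ℝ, 0 < x →
      μ {ω | ∃ n : ℕ, x ≤ n * Real.exp (-∑ l ∈ Finset.range (n + 1), E l ω)} ≤
        ENNReal.ofReal (C * x ^ (-s)) := by
  have hpos : ∀ n : ℕ, 0 < ∏ l ∈ Finset.range (n + 1), (a + l) / (a + l + s) := fun n =>
    Finset.prod_pos fun l _ => by positivity
  obtain ⟨C, hC⟩ := (tendsto_rpow_mul_prod ha (s := s) (by linarith)).bddAbove_range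
  have hC' : ∀ n : ℕ, (n : ℝ) ^ s * ∏ l ∈ Finset.range (n + 1), (a + l) / (a + l + s) ≤ max C 1 :=
    fun n => (hC ⟨n, rfl⟩).trans (le_max_left _ _)
  have hC0 : 0 < max C 1 := lt_max_of_lt_right one_pos
  refine ⟨max C 1, hC0, fun E hm hi hl x hx => ?_⟩
  obtain ⟨𝓕, hM, hone⟩ := martingale_exp_sum ha hm hi hl (s := s) (by linarith)
  -- On the event, `x ^ s ≤ n ^ s e^{-s S}`, and `n ^ s` times the normalizing product is at most
  -- `max C 1`; hence the martingale reaches the level `x ^ s / max C 1`.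
  have hxs : 0 < x ^ s / max C 1 := div_pos (Real.rpow_pos_of_pos hx s) hC0
  refine (measure_mono ?_).trans ((maximal_ineq_exists hM
    (fun n ω => div_nonneg (Real.exp_nonneg _) (hpos n).le) hone hxs).trans_eq ?_)
  · rintro ω ⟨n, hn⟩
    refine ⟨n, ?_⟩
    rw [div_le_div_iff₀ hC0 (hpos n)]
    have h1 := Real.rpow_le_rpow hx.le hn hs.le
    rw [Real.mul_rpow (by positivity) (Real.exp_nonneg _), ← Real.exp_mul] at h1
    calc _ ≤ ((n : ℝ) ^ s * Real.exp (-(∑ l ∈ Finset.range (n + 1), E l ω) * s)) * _ := by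
          gcongr
      _ = Real.exp (-s * ∑ l ∈ Finset.range (n + 1), E l ω) *
          ((n : ℝ) ^ s * ∏ l ∈ Finset.range (n + 1), (a + l) / (a + l + s)) := by
          rw [show -(∑ l ∈ Finset.range (n + 1), E l ω) * s =
            -s * ∑ l ∈ Finset.range (n + 1), E l ω by ring]
          ring
      _ ≤ _ := by
          gcongr
          exact hC' n
  · rw [inv_div, Real.rpow_neg hx.le, div_eq_mul_inv]

/-- The limit is positive and is a limit. -/
lemma ae_tendsto_growthLimit (ha : 0 < a) (hm : ∀ l, Measurable (E l)) (hi : iIndepFun E μ)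
    (hl : ∀ l : ℕ, HasLaw (E l) (expMeasure (a + l)) μ) :
    ∀ᵐ ω ∂μ, 0 < growthLimit (fun l => E l ω) ∧ Tendsto (fun n : ℕ => (n : ℝ) *
      Real.exp (-∑ l ∈ Finset.range n, E l ω)) atTop (𝓝 (growthLimit fun l => E l ω)) := by
  -- The exponent `1` provides the limit `y`. The exponent `-(a / 2)` shows that a negative power of
  -- the same sequence also has a finite limit, which is incompatible with `y = 0`.
  filter_upwards [ae_exists_tendsto_rpow_mul_exp ha hm hi hl (s := 1) (by linarith),
    ae_exists_tendsto_rpow_mul_exp ha hm hi hl (s := -(a / 2)) (by linarith)] with ω ⟨y, hy⟩ ⟨z, hz⟩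
  simp only [Real.rpow_one, neg_mul, one_mul, neg_neg] at hy hz
  have hratio : Tendsto (fun n : ℕ => ((n + 1 : ℕ) : ℝ) / n) atTop (𝓝 1) := by
    have := tendsto_natCast_div_add_atTop (1 : ℝ)
    simpa using this.inv₀ one_ne_zero
  have hy1 : Tendsto (fun n : ℕ => (n : ℝ) * Real.exp (-∑ l ∈ Finset.range n, E l ω)) atTop
      (𝓝 y) := by
    rw [← tendsto_add_atTop_iff_nat 1]
    refine (by simpa using hratio.mul hy : Tendsto _ _ (𝓝 y)).congr' ?_
    filter_upwards [eventually_gt_atTop 0] with n hn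
    have : (n : ℝ) ≠ 0 := by exact_mod_cast hn.ne'
    field_simp
    push_cast
    ring
  have hy0 : 0 ≤ y := ge_of_tendsto' hy fun n => by positivity
  have hne : y ≠ 0 := by
    rintro rfl
    have h1 := (hy.rpow_const (p := a / 2) (Or.inr (by linarith))).mul hz
    rw [Real.zero_rpow (by linarith), zero_mul] at h1
    refine one_ne_zero (tendsto_nhds_unique (tendsto_const_nhds.congr' ?_) h1)
    filter_upwards [eventually_gt_atTop 0] with n hn
    have hn' : (0 : ℝ) < n := by exact_mod_cast hn
    rw [Real.mul_rpow hn'.le (Real.exp_nonneg _), ← Real.exp_mul, mul_mul_mul_comm,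
      ← Real.rpow_add hn', ← Real.exp_add, add_neg_cancel, Real.rpow_zero, one_mul,
      eq_comm, Real.exp_eq_one_iff]
    ring
  have hlim : growthLimit (fun l => E l ω) = y := hy1.limsup_eq
  rw [hlim]
  exact ⟨lt_of_le_of_ne hy0 hne.symm, hy1⟩

omit [IsProbabilityMeasure μ] in
lemma integral_cexp_neg_mul_sum (ha : 0 < a) (hm : ∀ l, Measurable (E l)) (hi : iIndepFun E μ)
    (hl : ∀ l : ℕ, HasLaw (E l) (expMeasure (a + l)) μ) {z : ℂ} (hz : -a < z.re) (n : ℕ) :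
    ∫ ω, Complex.exp (-z * ∑ l ∈ Finset.range n, E l ω) ∂μ =
      ∏ l ∈ Finset.range n, ((a : ℂ) + l) / (a + l + z) := by
  have h := (hi.precomp (g := ((↑) : Fin n → ℕ)) Fin.val_injective).integral_fun_prod_comp
    (f := fun _ x => Complex.exp (-z * (x : ℝ))) (fun i => (hm i).aemeasurable)
    (fun i => by fun_prop)
  have h1 : ∀ ω, ∏ i : Fin n, Complex.exp (-z * (E i ω : ℝ)) =
      Complex.exp (-z * ∑ l ∈ Finset.range n, E l ω) := fun ω => by
    push_cast
    rw [Finset.mul_sum, Complex.exp_sum,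
      Finset.prod_range (fun l => Complex.exp (-z * (E l ω : ℝ)))]
  simp only [h1] at h
  rw [h, Finset.prod_range (fun l => ((a : ℂ) + l) / (a + l + z))]
  refine Finset.prod_congr rfl fun i _ => ?_
  have hl0 : (0 : ℝ) ≤ ((i : ℕ) : ℝ) := by positivity
  have h2 := integral_cexp_expMeasure (r := a + (i : ℕ)) (by linarith) (z := z) (by linarith)
  rw [← (hl i).map_eq, integral_map (hm i).aemeasurable (by fun_prop)] at h2
  simpa using h2

/-- The characteristic function of the logarithm of the limit is the limit of `n^{it} ∏ (a + l) / (a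
+ l + it)`, that is `Γ(a + it) / Γ(a)`, as for a gamma variable. The integrands have modulus one, so
dominated convergence applies with the constant `1`; passing to logarithms loses nothing because
both laws live on the positive half-line. -/
theorem hasLaw_growthLimit (ha : 0 < a) (hm : ∀ l, Measurable (E l)) (hi : iIndepFun E μ)
    (hl : ∀ l : ℕ, HasLaw (E l) (expMeasure (a + l)) μ) :
    HasLaw (fun ω => growthLimit fun l => E l ω) (gammaMeasure a 1) μ := by
  have hZm : Measurable (fun ω => growthLimit fun l => E l ω) :=
    measurable_growthLimit.comp (measurable_pi_lambda _ hm)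
  have hpg := isProbabilityMeasure_gammaMeasure ha one_pos
  have hlim := ae_tendsto_growthLimit ha hm hi hl
  refine ⟨hZm.aemeasurable, ?_⟩
  set Z := fun ω => growthLimit fun l => E l ω with hZ
  have hg0 : ∀ᵐ x ∂gammaMeasure a 1, 0 < x := by
    rw [ae_iff]
    simp only [not_lt]
    change gammaMeasure a 1 (Set.Iic 0) = 0
    rw [gammaMeasure, withDensity_apply _ measurableSet_Iic,
      setLIntegral_congr Iio_ae_eq_Iic.symm, lintegral_gammaPDF_of_nonpos le_rfl]
  have hlog : (μ.map Z).map Real.log = (gammaMeasure a 1).map Real.log := by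
    have : IsProbabilityMeasure (μ.map Z) := Measure.isProbabilityMeasure_map hZm.aemeasurable
    have h1 : IsProbabilityMeasure ((μ.map Z).map Real.log) :=
      Measure.isProbabilityMeasure_map Real.measurable_log.aemeasurable
    have h2 : IsProbabilityMeasure ((gammaMeasure a 1).map Real.log) :=
      Measure.isProbabilityMeasure_map Real.measurable_log.aemeasurable
    refine Measure.ext_of_charFun (funext fun t => ?_)
    rw [charFun_apply_real, charFun_apply_real,
      integral_map Real.measurable_log.aemeasurable (by fun_prop),
      integral_map Real.measurable_log.aemeasurable (by fun_prop),
      integral_map hZm.aemeasurable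
        (Measurable.aestronglyMeasurable (by fun_prop))]
    have hcp : ∀ x : ℝ, 0 < x → Complex.exp (t * Real.log x * Complex.I) =
        (x : ℂ) ^ (t * Complex.I) := fun x hx => by
      rw [Complex.cpow_def_of_ne_zero (by exact_mod_cast hx.ne'), Complex.ofReal_log hx.le]
      congr 1
      ring
    have hre : (t * Complex.I : ℂ).re = 0 := by simp
    rw [integral_congr_ae (hg0.mono fun x hx => hcp x hx),
      integral_cpow_gammaMeasure ha (by rw [hre]; linarith)]
    refine tendsto_nhds_unique ?_ (tendsto_cpow_mul_prod ha (by rw [hre]; linarith))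
    have hint := fun n => integral_cexp_neg_mul_sum ha hm hi hl (z := t * Complex.I)
      (by rw [hre]; linarith) (n + 1)
    simp_rw [← hint, ← integral_const_mul]
    refine tendsto_integral_filter_of_dominated_convergence (fun _ => (1 : ℝ))
      (Eventually.of_forall fun n => Measurable.aestronglyMeasurable (by fun_prop)) ?_
      (integrable_const _) ?_
    · filter_upwards [eventually_gt_atTop 0] with n hn
      refine Eventually.of_forall fun ω => ?_
      rw [norm_mul, Complex.norm_natCast_cpow_of_pos hn, Complex.norm_exp]
      simp
    · filter_upwards [hlim] with ω hω
      have h1 : Tendsto (fun n : ℕ => (n : ℝ) * Real.exp (-∑ l ∈ Finset.range (n + 1), E l ω)) atTop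
          (𝓝 (Z ω)) := by
        have h2 := (tendsto_natCast_div_add_atTop (1 : ℝ)).mul
          (hω.2.comp (tendsto_add_atTop_nat 1))
        rw [one_mul] at h2
        refine h2.congr fun n => ?_
        have : (n : ℝ) + 1 ≠ 0 := by positivity
        simp only [Function.comp_apply, Nat.cast_add, Nat.cast_one]
        field_simp
      have h3 : Tendsto (fun n : ℕ => Complex.exp (t * Real.log ((n : ℝ) *
          Real.exp (-∑ l ∈ Finset.range (n + 1), E l ω)) * Complex.I)) atTop
          (𝓝 (Complex.exp (t * Real.log (Z ω) * Complex.I))) := by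
        have h4 := (Complex.continuous_ofReal.tendsto _).comp (h1.log hω.1.ne')
        exact (Complex.continuous_exp.tendsto _).comp ((h4.const_mul _).mul_const _)
      refine h3.congr' ?_
      filter_upwards [eventually_gt_atTop 0] with n hn
      have hn' : (0 : ℝ) < n := by exact_mod_cast hn
      rw [Real.log_mul hn'.ne' (Real.exp_ne_zero _), Real.log_exp,
        Complex.cpow_def_of_ne_zero (by exact_mod_cast hn.ne'), ← Complex.exp_add,
        ← Complex.ofReal_natCast, ← Complex.ofReal_log hn'.le]
      congr 1
      push_cast
      ring
  have hexp := congrArg (Measure.map Real.exp) hlog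
  rw [Measure.map_map Real.measurable_exp Real.measurable_log,
    Measure.map_map Real.measurable_exp Real.measurable_log] at hexp
  have hid : ∀ x : ℝ, 0 < x → (Real.exp ∘ Real.log) x = id x := fun x hx => Real.exp_log hx
  rw [Measure.map_congr (hg0.mono fun x hx => hid x hx), Measure.map_id] at hexp
  rw [← hexp, Measure.map_map (Real.measurable_exp.comp Real.measurable_log) hZm]
  exact Measure.map_congr (hlim.mono fun ω hω => (hid (Z ω) hω.1).symm)

end Growth

/-! ### Memorylessness -/

lemma lintegral_expMeasure (r : ℝ) (g : ℝ → ENNReal) :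
    ∫⁻ x, g x ∂expMeasure r = ∫⁻ x in Set.Ioi 0, ENNReal.ofReal (r * Real.exp (-(r * x))) * g x := by
  have hm : Measurable (gammaPDF 1 r) := (measurable_gammaPDFReal 1 r).ennreal_ofReal
  rw [expMeasure, gammaMeasure, lintegral_withDensity_eq_lintegral_mul_non_measurable _ hm
    (Eventually.of_forall fun x => ENNReal.ofReal_lt_top),
    setLIntegral_congr Ioi_ae_eq_Ici, ← lintegral_indicator measurableSet_Ici]
  refine lintegral_congr fun x => ?_
  by_cases hx : 0 ≤ x
  · rw [Set.indicator_of_mem (Set.mem_Ici.mpr hx), Pi.mul_apply]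
    congr 1
    exact exponentialPDF_of_nonneg hx
  · rw [Set.indicator_of_notMem (by simpa using hx), Pi.mul_apply, gammaPDF_of_neg (not_le.mp hx),
      zero_mul]

/-- The weight `e^{-s x}` is the probability that competitors of total rate `s` are silent up to
`x`. It turns the density of `Exp(w)` into that of `Exp(w + s)` times the winning probability `w /
(w + s)`. -/
lemma lintegral_exp_mul_expMeasure {w s : ℝ} (hw : 0 < w) (hs : 0 ≤ s) (g : ℝ → ENNReal) :
    ∫⁻ x, ENNReal.ofReal (Real.exp (-(s * x))) * g x ∂expMeasure w =
      ENNReal.ofReal (w / (w + s)) * ∫⁻ x, g x ∂expMeasure (w + s) := by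
  rw [lintegral_expMeasure, lintegral_expMeasure, ← lintegral_const_mul' _ _ ENNReal.ofReal_ne_top]
  refine lintegral_congr fun x => ?_
  rw [← mul_assoc, ← mul_assoc, ← ENNReal.ofReal_mul (by positivity),
    ← ENNReal.ofReal_mul (by positivity)]
  congr 2
  rw [mul_assoc, ← Real.exp_add]
  have : w + s ≠ 0 := by positivity
  field_simp
  ring_nf

lemma expMeasure_shift (r : ℝ) {x : ℝ} (hx : 0 ≤ x) {B : Set ℝ} (hB : MeasurableSet B) :
    expMeasure r {y | x < y ∧ y - x ∈ B} = ENNReal.ofReal (Real.exp (-(r * x))) * expMeasure r B := by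
  have hS : MeasurableSet {y : ℝ | x < y ∧ y - x ∈ B} :=
    measurableSet_Ioi.inter ((measurable_id.sub_const x) hB)
  rw [← lintegral_indicator_one hS, ← lintegral_indicator_one hB, lintegral_expMeasure,
    lintegral_expMeasure, ← lintegral_indicator measurableSet_Ioi,
    ← lintegral_indicator measurableSet_Ioi, ← lintegral_add_right_eq_self _ x,
    ← lintegral_const_mul' _ _ ENNReal.ofReal_ne_top]
  refine lintegral_congr fun y => ?_
  by_cases hy : 0 < y
  · have hyx : 0 < y + x := by linarith
    rw [Set.indicator_of_mem (Set.mem_Ioi.mpr hyx), Set.indicator_of_mem (Set.mem_Ioi.mpr hy)]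
    by_cases hyB : y ∈ B
    · rw [Set.indicator_of_mem hyB, Set.indicator_of_mem (by simpa [hy] using hyB)]
      simp only [Pi.one_apply, mul_one]
      rw [← ENNReal.ofReal_mul (Real.exp_nonneg _)]
      congr 1
      rw [mul_left_comm, ← Real.exp_add]
      ring_nf
    · rw [Set.indicator_of_notMem hyB, Set.indicator_of_notMem (by simp [hyB])]
      simp
  · have h1 : y + x ∉ {z : ℝ | x < z ∧ z - x ∈ B} := by simp [hy]
    have h2 : {z : ℝ | x < z ∧ z - x ∈ B}.indicator (1 : ℝ → ENNReal) (y + x) = 0 :=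
      Set.indicator_of_notMem h1 _
    have h3 : y ∉ Set.Ioi (0 : ℝ) := hy
    rw [Set.indicator_of_notMem h3, mul_zero]
    by_cases hyx : y + x ∈ Set.Ioi (0 : ℝ)
    · rw [Set.indicator_of_mem hyx, h2, mul_zero]
    · rw [Set.indicator_of_notMem hyx]

/-- Joint lack of memory: each clock of `A` that survives `x` restarts at the cost of a factor
`e^{-q x}`. After division by the total mass, it suffices to compare boxes. -/
lemma infinitePi_expMeasure_shift {ι : Type*} [DecidableEq ι] (q : ι → ℝ)
    [∀ i, IsProbabilityMeasure (expMeasure (q i))] (A : Finset ι) {x : ℝ} (hx : 0 ≤ x) :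
    ((Measure.infinitePi fun i => expMeasure (q i)).restrict {K | ∀ i ∈ A, x < K i}).map
        (fun K i => if i ∈ A then K i - x else K i) =
      ENNReal.ofReal (Real.exp (-((∑ i ∈ A, q i) * x))) •
        Measure.infinitePi fun i => expMeasure (q i) := by
  set c := ENNReal.ofReal (Real.exp (-((∑ i ∈ A, q i) * x))) with hc
  have hc0 : c ≠ 0 := by simp [hc, Real.exp_pos]
  have hct : c ≠ ⊤ := ENNReal.ofReal_ne_top
  have hcprod : c = ∏ i ∈ A, ENNReal.ofReal (Real.exp (-(q i * x))) := by
    rw [hc, Finset.sum_mul, ← Finset.sum_neg_distrib, Real.exp_sum,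
      ENNReal.ofReal_prod_of_nonneg fun i _ => Real.exp_nonneg _]
  have hmeas : Measurable (fun (K : ι → ℝ) i => if i ∈ A then K i - x else K i) :=
    measurable_pi_lambda _ fun i => by
      by_cases hi : i ∈ A <;> simp only [hi, if_true, if_false] <;> fun_prop
  set ρ := ((Measure.infinitePi fun i => expMeasure (q i)).restrict {K | ∀ i ∈ A, x < K i}).map
        (fun K i => if i ∈ A then K i - x else K i) with hρ
  suffices h : c⁻¹ • ρ = Measure.infinitePi fun i => expMeasure (q i) by
    rw [← h, smul_smul, ENNReal.mul_inv_cancel hc0 hct, one_smul]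
  refine Measure.eq_infinitePi _ fun s t ht => ?_
  have hbox : MeasurableSet (Set.pi (s : Set ι) t) :=
    MeasurableSet.pi s.countable_toSet fun i _ => ht i
  rw [Measure.smul_apply, hρ, Measure.map_apply hmeas hbox,
    Measure.restrict_apply (hmeas hbox)]
  have hu : ∀ i, MeasurableSet (if i ∈ s then t i else Set.univ) := fun i => by
    split_ifs
    exacts [ht i, MeasurableSet.univ]
  -- Coordinates in `A` but outside `s` are constrained only by survival, hence `Set.univ`.
  set t' : ι → Set ℝ := fun i => if i ∈ A then {y | x < y ∧ y - x ∈ (if i ∈ s then t i else Set.univ)}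
    else t i with ht'
  have hset : (fun (K : ι → ℝ) i => if i ∈ A then K i - x else K i) ⁻¹' Set.pi (s : Set ι) t ∩
      {K | ∀ i ∈ A, x < K i} = Set.pi ((s ∪ A : Finset ι) : Set ι) t' := by
    ext K
    simp only [Set.mem_inter_iff, Set.mem_preimage, Set.mem_pi, Set.mem_ofPred_eq, ht',
      Finset.coe_union, Set.mem_union, Finset.mem_coe]
    constructor
    · rintro ⟨h1, h2⟩ i hi
      by_cases hiA : i ∈ A
      · simp only [hiA, if_true, Set.mem_ofPred_eq]
        refine ⟨h2 i hiA, ?_⟩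
        by_cases his : i ∈ s
        · simpa [his, hiA] using h1 i his
        · simp [his]
      · simpa [hiA] using h1 i (hi.resolve_right hiA)
    · intro h
      refine ⟨fun i hi => ?_, fun i hi => ?_⟩
      · have := h i (Or.inl hi)
        by_cases hiA : i ∈ A
        · simpa [hiA, hi] using (by simpa [hiA, hi] using this : x < K i ∧ K i - x ∈ t i).2
        · simpa [hiA] using this
      · have := h i (Or.inr hi)
        simp only [hi, if_true, Set.mem_ofPred_eq] at this
        exact this.1
  have hm' : ∀ i, MeasurableSet (t' i) := fun i => by
    by_cases hiA : i ∈ A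
    · simp only [ht', hiA, if_true]
      exact measurableSet_Ioi.inter ((measurable_id.sub_const x) (hu i))
    · simpa [ht', hiA] using ht i
  rw [hset, Measure.infinitePi_pi _ fun i _ => hm' i]
  have hval : ∀ i ∈ s ∪ A, expMeasure (q i) (t' i) =
      (if i ∈ A then ENNReal.ofReal (Real.exp (-(q i * x))) else 1) *
        (if i ∈ s then expMeasure (q i) (t i) else 1) := by
    intro i hi
    by_cases hiA : i ∈ A
    · simp only [ht', hiA, if_true]
      rw [expMeasure_shift (q i) hx (hu i)]
      by_cases his : i ∈ s <;> simp [his]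
    · have his : i ∈ s := (Finset.mem_union.mp hi).resolve_right hiA
      simp [ht', hiA, his]
  rw [Finset.prod_congr rfl hval, Finset.prod_mul_distrib, Finset.prod_ite_mem,
    Finset.prod_ite_mem, Finset.inter_eq_right.mpr Finset.subset_union_right,
    Finset.inter_eq_right.mpr Finset.subset_union_left, ← hcprod, smul_eq_mul, ← mul_assoc,
    ENNReal.inv_mul_cancel hc0 hct, one_mul]

/-! ### Competing clocks

Row `i` of an array of clocks holds the successive holding times of the `i`-th process. -/

/-- Arrays of holding times. -/
abbrev Clocks := ℕ × ℕ → ℝ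

/-- Row `j` is the first of the rows `0, ..., N - 1` to ring. -/
def Wins (N j : ℕ) (H : Clocks) : Prop := j < N ∧ ∀ i < N, i ≠ j → H (j, 0) < H (i, 0)

/-- The array seen from the moment at which row `j` rings, the rows `0, ..., N - 1` being active. -/
def advance (N j : ℕ) (H : Clocks) : Clocks := fun p =>
  if p.1 = j then H (j, p.2 + 1) else if p.1 < N ∧ p.2 = 0 then H p - H (j, 0) else H p

/-- The clocks with independent exponential entries, the rate of the `k`-th clock of row `i` being
`d i + k + β`. -/
noncomputable def clockMeasure (β : ℝ) [Fact (0 < β)] (d : ℕ → ℕ) : Measure Clocks :=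
  have : ∀ p : ℕ × ℕ, IsProbabilityMeasure (expMeasure ((d p.1 : ℝ) + p.2 + β)) := fun p =>
    isProbabilityMeasure_expMeasure (by have := Fact.out (p := 0 < β); positivity)
  Measure.infinitePi fun p : ℕ × ℕ => expMeasure ((d p.1 : ℝ) + p.2 + β)

/-- Row `j` has rung once more. -/
def bump (d : ℕ → ℕ) (j : ℕ) : ℕ → ℕ := Function.update d j (d j + 1)

/-- The total rate of the rows `0, ..., N - 1`. -/
noncomputable def totalRate (β : ℝ) (N : ℕ) (d : ℕ → ℕ) : ℝ := ∑ i ∈ Finset.range N, ((d i : ℝ) + β)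

variable {β : ℝ} [hβ : Fact (0 < β)] {d : ℕ → ℕ} {N j : ℕ}

lemma rate_pos (d : ℕ → ℕ) (p : ℕ × ℕ) : 0 < (d p.1 : ℝ) + p.2 + β := by
  have := hβ.out
  positivity

instance (d : ℕ → ℕ) (p : ℕ × ℕ) : IsProbabilityMeasure (expMeasure ((d p.1 : ℝ) + p.2 + β)) :=
  isProbabilityMeasure_expMeasure (rate_pos d p)

lemma clockMeasure_eq (β : ℝ) [Fact (0 < β)] (d : ℕ → ℕ) : clockMeasure β d =
    Measure.infinitePi fun p : ℕ × ℕ => expMeasure ((d p.1 : ℝ) + p.2 + β) := rfl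

instance (d : ℕ → ℕ) : IsProbabilityMeasure (clockMeasure β d) := by
  rw [clockMeasure_eq]
  infer_instance

lemma measurable_advance (N j : ℕ) : Measurable (advance N j) :=
  measurable_pi_lambda _ fun p => by
    unfold advance
    split_ifs <;> fun_prop

lemma measurableSet_wins (N j : ℕ) : MeasurableSet {H | Wins N j H} := by
  unfold Wins
  measurability

/-- The row `j` without its first entry. -/
def dropFirst (j : ℕ) (p : ℕ × ℕ) : ℕ × ℕ := if p.1 = j then (j, p.2 + 1) else p

lemma dropFirst_injective (j : ℕ) : Function.Injective (dropFirst j) := by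
  rintro ⟨a, b⟩ ⟨a', b'⟩ h
  simp only [dropFirst] at h
  split_ifs at h <;> simp_all

lemma dropFirst_ne (j : ℕ) (p : ℕ × ℕ) : dropFirst j p ≠ (j, 0) := by
  obtain ⟨a, b⟩ := p
  simp only [dropFirst]
  split_ifs <;> simp_all

/-- The remaining entries have indices different from `(j, 0)`, hence the independence; moving row
`j` up by one entry raises its rates by one, which is what `bump` records. -/
lemma map_first_rest (d : ℕ → ℕ) (j : ℕ) :
    (clockMeasure β d).map (fun H => (H (j, 0), fun p => H (dropFirst j p))) =
      (expMeasure ((d j : ℝ) + β)).prod (clockMeasure β (bump d j)) := by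
  have hind : iIndepFun (fun (p : ℕ × ℕ) (H : Clocks) => H p) (clockMeasure β d) := by
    rw [clockMeasure_eq]
    exact iIndepFun_infinitePi (X := fun _ x => x) (fun _ => measurable_id)
  have hI : IndepFun (fun H : Clocks => H (j, 0)) (fun H p => H (dropFirst j p))
      (clockMeasure β d) := by
    have h := indep_iSup_of_disjoint (m := fun p : ℕ × ℕ =>
      MeasurableSpace.comap (fun H : Clocks => H p) inferInstance)
      (fun p => (measurable_pi_apply p).comap_le) hind (S := {(j, 0)}) (T := {(j, 0)}ᶜ)
      disjoint_compl_right
    rw [iSup_singleton] at h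
    refine indep_of_indep_of_le_right h ?_
    rw [MeasurableSpace.pi, MeasurableSpace.comap_iSup]
    refine iSup_le fun p => ?_
    rw [MeasurableSpace.comap_comp]
    exact le_iSup₂_of_le (dropFirst j p) (dropFirst_ne j p) le_rfl
  rw [hI.map_prod_eq_prod_map_map (measurable_pi_apply _).aemeasurable
    (measurable_pi_lambda _ fun p => measurable_pi_apply _).aemeasurable]
  have h1 : (clockMeasure β d).map (fun H => H (j, 0)) = expMeasure ((d j : ℝ) + β) := by
    rw [clockMeasure_eq, Measure.infinitePi_map_eval]
    simp
  have h2 : (clockMeasure β d).map (fun H p => H (dropFirst j p)) = clockMeasure β (bump d j) := by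
    rw [clockMeasure_eq, Measure.map_infinitePi_infinitePi_of_inj (dropFirst_injective j),
      clockMeasure_eq]
    congr 1
    ext1 p
    congr 1
    obtain ⟨a, b⟩ := p
    by_cases h : a = j
    · subst h
      simp [dropFirst, bump]
      ring
    · simp [dropFirst, bump, h]
  rw [h1, h2]

/-- Competing exponential clocks: the winner, the winning time and the array seen from the winning
time are independent. -/
theorem measure_wins (d : ℕ → ℕ) {N j : ℕ} (hj : j < N) {C : Set (ℝ × Clocks)}
    (hC : MeasurableSet C) :
    clockMeasure β d {H | Wins N j H ∧ (H (j, 0), advance N j H) ∈ C} =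
      ENNReal.ofReal (((d j : ℝ) + β) / totalRate β N d) *
        ((expMeasure (totalRate β N d)).prod (clockMeasure β (bump d j))) C := by
  classical
  -- The current clocks of the active competitors of row `j`.
  set A : Finset (ℕ × ℕ) := ((Finset.range N).erase j).image fun i => (i, 0) with hA
  have hmemA : ∀ p : ℕ × ℕ, p ∈ A ↔ p.1 ≠ j ∧ p.1 < N ∧ p.2 = 0 := by
    rintro ⟨a, b⟩
    simp only [hA, Finset.mem_image, Finset.mem_erase, Finset.mem_range, Prod.mk.injEq]
    constructor
    · rintro ⟨i, ⟨h1, h2⟩, rfl, rfl⟩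
      exact ⟨h1, h2, rfl⟩
    · rintro ⟨h1, h2, rfl⟩
      exact ⟨a, ⟨h1, h2⟩, rfl, rfl⟩
  set w : ℝ := (d j : ℝ) + β with hw
  have hβ0 := hβ.out
  have hw0 : 0 < w := by positivity
  set s : ℝ := ∑ p ∈ A, ((bump d j p.1 : ℝ) + p.2 + β) with hs
  have hs' : s = ∑ i ∈ (Finset.range N).erase j, ((d i : ℝ) + β) := by
    rw [hs, hA, Finset.sum_image fun a _ b _ h => by simpa using h]
    refine Finset.sum_congr rfl fun i hi => ?_
    simp [bump, (Finset.mem_erase.mp hi).1]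
  have hs0 : 0 ≤ s := by
    rw [hs']
    positivity
  have htot : totalRate β N d = w + s := by
    rw [hs', totalRate, ← Finset.add_sum_erase _ _ (Finset.mem_range.mpr hj)]
  set sub : ℝ → Clocks → Clocks := fun x K p => if p ∈ A then K p - x else K p with hsub
  have hsubm : Measurable fun z : ℝ × Clocks => sub z.1 z.2 := by
    refine measurable_pi_lambda _ fun p => ?_
    simp only [hsub]
    by_cases hp : p ∈ A <;> simp only [hp, if_true, if_false] <;> fun_prop
  -- The event in terms of the ring time `z.1` of row `j` and the array `z.2` without that entry:
  -- the competitors outlive `z.1`, and subtracting `z.1` from them produces `advance`.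
  set C' : Set (ℝ × Clocks) := {z | (∀ p ∈ A, z.1 < z.2 p) ∧ (z.1, sub z.1 z.2) ∈ C} with hC'
  have hC'm : MeasurableSet C' := by
    have : {z : ℝ × Clocks | ∀ p ∈ A, z.1 < z.2 p} = ⋂ p ∈ A, {z | z.1 < z.2 p} := by
      ext z
      simp
    have h : MeasurableSet {z : ℝ × Clocks | ∀ p ∈ A, z.1 < z.2 p} := by
      rw [this]
      exact Finset.measurableSet_biInter _ fun p _ =>
        measurableSet_lt measurable_fst ((measurable_pi_apply p).comp measurable_snd)
    exact h.inter ((measurable_fst.prodMk hsubm) hC)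
  have hset : {H | Wins N j H ∧ (H (j, 0), advance N j H) ∈ C} =
      (fun H : Clocks => (H (j, 0), fun p => H (dropFirst j p))) ⁻¹' C' := by
    ext H
    have h1 : sub (H (j, 0)) (fun p => H (dropFirst j p)) = advance N j H := by
      ext p
      by_cases hp : p.1 = j
      · simp [hsub, advance, hmemA, dropFirst, hp]
      · simp [hsub, advance, hmemA, dropFirst, hp]
    have h2 : (∀ p ∈ A, H (j, 0) < H (dropFirst j p)) ↔ Wins N j H := by
      simp only [hmemA, Wins]
      constructor
      · intro h
        refine ⟨hj, fun i hi hij => ?_⟩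
        simpa [dropFirst, hij] using h (i, 0) ⟨hij, hi, rfl⟩
      · rintro ⟨-, h⟩ ⟨a, b⟩ ⟨h1, h2, rfl : b = 0⟩
        simpa [dropFirst, h1] using h a h2 h1
    simp only [Set.mem_ofPred_eq, Set.mem_preimage, hC', h1, h2]
  rw [hset, ← Measure.map_apply (by fun_prop) hC'm, map_first_rest, Measure.prod_apply hC'm, htot,
    Measure.prod_apply hC, ← lintegral_exp_mul_expMeasure hw0 hs0]
  have hpos : ∀ᵐ x ∂expMeasure w, 0 < x := by
    rw [ae_iff]
    simp only [not_lt]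
    exact expMeasure_Iic_zero w
  -- For a fixed ring time `x`, lack of memory of the competitors gives the weight `e^{-s x}` and
  -- restores the clock measure.
  refine lintegral_congr_ae (hpos.mono fun x hx => ?_)
  have hshift := infinitePi_expMeasure_shift (fun p : ℕ × ℕ => (bump d j p.1 : ℝ) + p.2 + β)
    A hx.le
  have hslice : MeasurableSet (Prod.mk x ⁻¹' C) := measurable_prodMk_left hC
  have hsubx : Measurable (sub x) := hsubm.comp measurable_prodMk_left
  have hval := congrArg (fun ρ : Measure Clocks => ρ (Prod.mk x ⁻¹' C)) hshift
  rw [Measure.map_apply hsubx hslice, Measure.restrict_apply (hsubx hslice), Measure.smul_apply,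
    smul_eq_mul, ← hs, ← clockMeasure_eq] at hval
  simp only
  rw [← hval]
  congr 1
  ext K
  simp only [hC', Set.mem_preimage, Set.mem_ofPred_eq, Set.mem_inter_iff]
  tauto

/-! ### The chain of competitions -/

lemma Wins.unique {N i j : ℕ} {H : Clocks} (hi : Wins N i H) (hj : Wins N j H) : i = j := by
  by_contra h
  exact lt_asymm (hi.2 j hj.1 (Ne.symm h)) (hj.2 i hi.1 h)

open Classical in
/-- The row that wins the competition of the rows `0, ..., N - 1`. -/
noncomputable def winner (N : ℕ) (H : Clocks) : ℕ :=
  if h : ∃ j, Wins N j H then Nat.find h else 0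

lemma Wins.winner_eq {N j : ℕ} {H : Clocks} (h : Wins N j H) : winner N H = j := by
  classical
  have h' : ∃ j, Wins N j H := ⟨j, h⟩
  rw [winner, dif_pos h']
  exact (Nat.find_spec h').unique h

lemma wins_winner {N : ℕ} {H : Clocks} (h : ∃ j, Wins N j H) : Wins N (winner N H) H := by
  obtain ⟨j, hj⟩ := h
  rwa [hj.winner_eq]

lemma measurable_winner (N : ℕ) : Measurable (winner N) := by
  refine measurable_to_countable' fun j => ?_
  have : winner N ⁻¹' {j} = {H | Wins N j H} ∪ ({H | j = 0} ∩ (⋃ i, {H | Wins N i H})ᶜ) := by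
    ext H
    simp only [Set.mem_preimage, Set.mem_singleton_iff, Set.mem_union, Set.mem_ofPred_eq,
      Set.mem_inter_iff, Set.mem_compl_iff, Set.mem_iUnion]
    by_cases h : ∃ i, Wins N i H
    · simp only [h, not_true_eq_false, and_false, or_false]
      exact ⟨fun hj => hj ▸ wins_winner h, fun hj => hj.winner_eq⟩
    · have h0 : winner N H = 0 := by simp [winner, h]
      have h1 : ¬ Wins N j H := fun hj => h ⟨j, hj⟩
      simp only [h0, h, h1, not_false_eq_true, and_true, false_or]
      exact eq_comm
  rw [this]
  exact (measurableSet_wins N j).union (MeasurableSet.const _ |>.inter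
    (MeasurableSet.iUnion fun i => measurableSet_wins N i).compl)

/-- The array seen after the competition of the rows `0, ..., N - 1`. -/
noncomputable def nextClocks (N : ℕ) (H : Clocks) : Clocks := advance N (winner N H) H

/-- The winning time of the competition of the rows `0, ..., N - 1`. -/
noncomputable def firstGap (N : ℕ) (H : Clocks) : ℝ := H (winner N H, 0)

lemma measurable_nextClocks (N : ℕ) : Measurable (nextClocks N) :=
  (measurable_from_prod_countable_right (f := fun z : ℕ × Clocks => advance N z.1 z.2)
    fun j => measurable_advance N j).comp ((measurable_winner N).prodMk measurable_id)

lemma measurable_firstGap (N : ℕ) : Measurable (firstGap N) :=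
  (measurable_from_prod_countable_right (f := fun z : ℕ × Clocks => z.2 (z.1, 0))
    fun j => measurable_pi_apply (j, 0)).comp ((measurable_winner N).prodMk measurable_id)

/-- The array seen after `r` competitions; one more row takes part in each of them. -/
noncomputable def chain : ℕ → ℕ → Clocks → Clocks
  | _, 0, H => H
  | N, r + 1, H => chain (N + 1) r (nextClocks N H)

/-- The winner of competition `r`. -/
noncomputable def target (N r : ℕ) (H : Clocks) : ℕ := winner (N + r) (chain N r H)

/-- The duration of competition `r`. -/
noncomputable def gap (N r : ℕ) (H : Clocks) : ℝ := firstGap (N + r) (chain N r H)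

lemma chain_zero (N : ℕ) (H : Clocks) : chain N 0 H = H := rfl

lemma chain_succ_left (N r : ℕ) (H : Clocks) :
    chain N (r + 1) H = chain (N + 1) r (nextClocks N H) := rfl

lemma chain_succ (N r : ℕ) (H : Clocks) :
    chain N (r + 1) H = nextClocks (N + r) (chain N r H) := by
  induction r generalizing N H with
  | zero => rfl
  | succ r ih =>
    rw [chain_succ_left, ih, ← chain_succ_left]
    congr 1
    omega

lemma target_succ_left (N r : ℕ) (H : Clocks) :
    target N (r + 1) H = target (N + 1) r (nextClocks N H) := by
  rw [target, target, chain_succ_left]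
  congr 1
  omega

lemma gap_succ_left (N r : ℕ) (H : Clocks) :
    gap N (r + 1) H = gap (N + 1) r (nextClocks N H) := by
  rw [gap, gap, chain_succ_left]
  congr 1
  omega

lemma measurable_chain (N r : ℕ) : Measurable (chain N r) := by
  induction r generalizing N with
  | zero => exact measurable_id
  | succ r ih => exact (ih (N + 1)).comp (measurable_nextClocks N)

lemma measurable_target (N r : ℕ) : Measurable (target N r) :=
  (measurable_winner _).comp (measurable_chain N r)

lemma measurable_gap (N r : ℕ) : Measurable (gap N r) :=
  (measurable_firstGap _).comp (measurable_chain N r)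

variable {β : ℝ} [hβ : Fact (0 < β)]

lemma totalRate_pos {N : ℕ} (hN : 0 < N) (d : ℕ → ℕ) : 0 < totalRate β N d := by
  have := hβ.out
  exact Finset.sum_pos (fun i _ => by positivity) ⟨0, Finset.mem_range.mpr hN⟩

lemma sum_rate_div {N : ℕ} (hN : 0 < N) (d : ℕ → ℕ) :
    ∑ j ∈ Finset.range N, ENNReal.ofReal (((d j : ℝ) + β) / totalRate β N d) = 1 := by
  have h0 := hβ.out
  have h := totalRate_pos (β := β) hN d
  rw [← ENNReal.ofReal_sum_of_nonneg fun i _ => by positivity, ← Finset.sum_div]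
  change ENNReal.ofReal (totalRate β N d / totalRate β N d) = 1
  rw [div_self h.ne', ENNReal.ofReal_one]

omit hβ in
-- The winner gains `1` and the joining row, still without wins, brings `β`. The increase does not
-- depend on the winner, which is the reason why the durations are independent.
lemma totalRate_bump {N j : ℕ} {d : ℕ → ℕ} (hj : j < N) (hd : ∀ i, N ≤ i → d i = 0) :
    totalRate β (N + 1) (bump d j) = totalRate β N d + (1 + β) := by
  have hN : bump d j N = 0 := by
    rw [bump, Function.update_of_ne (by omega), hd N le_rfl]
  have hjm := Finset.mem_range.mpr hj
  rw [totalRate, Finset.sum_range_succ, hN, totalRate,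
    ← Finset.add_sum_erase _ _ hjm, ← Finset.add_sum_erase _ (fun i => (d i : ℝ) + β) hjm]
  have : ∑ i ∈ (Finset.range N).erase j, ((bump d j i : ℝ) + β) =
      ∑ i ∈ (Finset.range N).erase j, ((d i : ℝ) + β) :=
    Finset.sum_congr rfl fun i hi => by simp [bump, (Finset.mem_erase.mp hi).1]
  rw [this]
  simp [bump]
  ring

lemma pairwise_disjoint_wins (N : ℕ) (s : Set ℕ) :
    s.PairwiseDisjoint fun j => {H : Clocks | Wins N j H} := fun _ _ _ _ hij =>
  Set.disjoint_left.mpr fun _ hi hj => hij (Wins.unique hi hj)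

/-- The winning probabilities add up to one, so ties are negligible. -/
lemma ae_exists_wins {N : ℕ} (hN : 0 < N) (d : ℕ → ℕ) :
    ∀ᵐ H ∂clockMeasure β d, ∃ j, Wins N j H := by
  have hU : clockMeasure β d (⋃ j ∈ Finset.range N, {H | Wins N j H}) = 1 := by
    rw [measure_biUnion_finset (pairwise_disjoint_wins N _) fun j _ => measurableSet_wins N j,
      ← sum_rate_div (β := β) hN d]
    refine Finset.sum_congr rfl fun j hj => ?_
    have := measure_wins (β := β) d (Finset.mem_range.mp hj) MeasurableSet.univ
    have hp := isProbabilityMeasure_expMeasure (totalRate_pos (β := β) hN d)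
    simpa using this
  have hae := (prob_compl_eq_zero_iff (Finset.measurableSet_biUnion _ fun j _ =>
    measurableSet_wins N j)).mpr hU
  have h2 : ∀ᵐ H ∂clockMeasure β d, H ∈ ⋃ j ∈ Finset.range N, {H | Wins N j H} := hae
  filter_upwards [h2] with H hH
  simp only [Set.mem_iUnion] at hH
  obtain ⟨j, -, hj⟩ := hH
  exact ⟨j, hj⟩

/-- The law of the first competition. -/
lemma measure_firstGap_nextClocks {N : ℕ} (hN : 0 < N) (d : ℕ → ℕ) {C : Set (ℝ × Clocks)}
    (hC : MeasurableSet C) :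
    clockMeasure β d {H | (firstGap N H, nextClocks N H) ∈ C} =
      ∑ j ∈ Finset.range N, ENNReal.ofReal (((d j : ℝ) + β) / totalRate β N d) *
        ((expMeasure (totalRate β N d)).prod (clockMeasure β (bump d j))) C := by
  have hm : ∀ j, MeasurableSet {H : Clocks | Wins N j H ∧ (H (j, 0), advance N j H) ∈ C} :=
    fun j => (measurableSet_wins N j).inter
      (((measurable_pi_apply (j, 0)).prodMk (measurable_advance N j)) hC)
  have hU : clockMeasure β d {H | (firstGap N H, nextClocks N H) ∈ C} = clockMeasure β d
      (⋃ j ∈ Finset.range N, {H | Wins N j H ∧ (H (j, 0), advance N j H) ∈ C}) := by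
    refine measure_congr ?_
    filter_upwards [ae_exists_wins (β := β) hN d] with H hH
    obtain ⟨j, hj⟩ := hH
    refine propext ?_
    change (firstGap N H, nextClocks N H) ∈ C ↔ H ∈ ⋃ j ∈ Finset.range N, _
    simp only [Set.mem_iUnion, Set.mem_ofPred_eq, Finset.mem_range, exists_prop, firstGap,
      nextClocks, hj.winner_eq]
    constructor
    · exact fun h => ⟨j, hj.1, hj, h⟩
    · rintro ⟨i, -, hi, h⟩
      rwa [hi.unique hj] at h
  rw [hU, measure_biUnion_finset _ fun j _ => hm j]
  · exact Finset.sum_congr rfl fun j hj => measure_wins d (Finset.mem_range.mp hj) hC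
  · exact fun i hi j hj hij => (pairwise_disjoint_wins N _ hi hj hij).mono
      (fun _ h => h.1) fun _ h => h.1

/-- A property that holds almost surely for clocks holds for all arrays of the chain. -/
lemma ae_chain {p : Clocks → Prop} (hp : MeasurableSet {H | p H})
    (h : ∀ d : ℕ → ℕ, ∀ᵐ H ∂clockMeasure β d, p H) {N : ℕ} (hN : 0 < N) (r : ℕ) (d : ℕ → ℕ) :
    ∀ᵐ H ∂clockMeasure β d, p (chain N r H) := by
  induction r generalizing N d with
  | zero => exact h d
  | succ r ih =>
    have hS : MeasurableSet {K | ¬ p (chain (N + 1) r K)} := (measurable_chain (N + 1) r) hp.compl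
    have h1 := measure_firstGap_nextClocks (β := β) hN d (MeasurableSet.univ.prod hS)
    rw [ae_iff]
    have h2 : {H | ¬ p (chain N (r + 1) H)} = {H | (firstGap N H, nextClocks N H) ∈
        (Set.univ : Set ℝ) ×ˢ {K | ¬ p (chain (N + 1) r K)}} := by
      ext H
      simp [chain_succ_left]
    rw [h2, h1]
    refine Finset.sum_eq_zero fun j _ => ?_
    have h3 := ae_iff.mp (ih N.succ_pos (bump d j))
    rw [Measure.prod_prod, h3, mul_zero, mul_zero]

/-- The durations of the competitions are independent exponential variables. -/
lemma measure_gap {N : ℕ} (hN : 0 < N) {d : ℕ → ℕ} (hd : ∀ i, N ≤ i → d i = 0) (r : ℕ)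
    {B : ℕ → Set ℝ} (hB : ∀ m, MeasurableSet (B m)) :
    clockMeasure β d {H | ∀ m < r, gap N m H ∈ B m} =
      ∏ m ∈ Finset.range r, expMeasure (totalRate β N d + m * (1 + β)) (B m) := by
  induction r generalizing N d B with
  | zero => simp
  | succ r ih =>
    have hS : MeasurableSet {K | ∀ m < r, gap (N + 1) m K ∈ B (m + 1)} := by
      have : {K | ∀ m < r, gap (N + 1) m K ∈ B (m + 1)} =
          ⋂ m ∈ Finset.range r, gap (N + 1) m ⁻¹' B (m + 1) := by
        ext
        simp
      rw [this]
      exact Finset.measurableSet_biInter _ fun m _ => measurable_gap _ _ (hB _)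
    have h1 := measure_firstGap_nextClocks (β := β) hN d ((hB 0).prod hS)
    have h2 : {H | ∀ m < r + 1, gap N m H ∈ B m} = {H | (firstGap N H, nextClocks N H) ∈
        B 0 ×ˢ {K | ∀ m < r, gap (N + 1) m K ∈ B (m + 1)}} := by
      ext H
      simp only [Set.mem_ofPred_eq, Set.mem_prod, Nat.forall_lt_succ_left, gap_succ_left]
      rfl
    rw [h2, h1, Finset.prod_range_succ']
    -- The winner `j` enters only through its probability, since the next total rate is the same for
    -- all winners; the sum over `j` then disappears.
    have h3 : ∀ j ∈ Finset.range N, ENNReal.ofReal (((d j : ℝ) + β) / totalRate β N d) *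
        ((expMeasure (totalRate β N d)).prod (clockMeasure β (bump d j)))
          (B 0 ×ˢ {K | ∀ m < r, gap (N + 1) m K ∈ B (m + 1)}) =
        ENNReal.ofReal (((d j : ℝ) + β) / totalRate β N d) * ((∏ m ∈ Finset.range r,
          expMeasure (totalRate β N d + (m + 1 : ℕ) * (1 + β)) (B (m + 1))) *
          expMeasure (totalRate β N d + (0 : ℕ) * (1 + β)) (B 0)) := by
      intro j hj
      have hj' := Finset.mem_range.mp hj
      have hd' : ∀ i, N + 1 ≤ i → bump d j i = 0 := fun i hi => by
        rw [bump, Function.update_of_ne (by omega), hd i (by omega)]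
      rw [Measure.prod_prod, ih N.succ_pos hd' fun m => hB (m + 1), totalRate_bump hj' hd,
        mul_comm (expMeasure _ _)]
      simp only [Nat.cast_zero, zero_mul, add_zero, Nat.cast_add, Nat.cast_one]
      congr 2
      refine Finset.prod_congr rfl fun m _ => ?_
      congr 2
      ring
    rw [Finset.sum_congr rfl h3, ← Finset.sum_mul, sum_rate_div hN, one_mul]

lemma iIndepFun_gap {N : ℕ} (hN : 0 < N) {d : ℕ → ℕ} (hd : ∀ i, N ≤ i → d i = 0) :
    (∀ m : ℕ, HasLaw (gap N m) (expMeasure (totalRate β N d + m * (1 + β))) (clockMeasure β d)) ∧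
      iIndepFun (gap N) (clockMeasure β d) := by
  have hpos : ∀ m : ℕ, 0 < totalRate β N d + m * (1 + β) := fun m => by
    have := hβ.out
    have := totalRate_pos (β := β) hN d
    positivity
  have hprob := fun m => isProbabilityMeasure_expMeasure (hpos m)
  have hmap : (clockMeasure β d).map (fun H m => gap N m H) =
      Measure.infinitePi fun m : ℕ => expMeasure (totalRate β N d + m * (1 + β)) := by
    refine Measure.eq_infinitePi _ fun s t ht => ?_
    classical
    obtain ⟨r, hr⟩ : ∃ r, s ⊆ Finset.range r :=
      ⟨s.sup id + 1, fun m hm => Finset.mem_range.mpr (Nat.lt_succ_of_le (Finset.le_sup (f := id) hm))⟩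
    have hB : ∀ m, MeasurableSet (if m ∈ s then t m else Set.univ) := fun m => by
      split_ifs
      exacts [ht m, MeasurableSet.univ]
    rw [Measure.map_apply (measurable_pi_lambda _ fun m => measurable_gap N m)
      (MeasurableSet.pi s.countable_toSet fun i _ => ht i)]
    have hset : (fun H m => gap N m H) ⁻¹' Set.pi (s : Set ℕ) t =
        {H | ∀ m < r, gap N m H ∈ (if m ∈ s then t m else Set.univ)} := by
      ext H
      simp only [Set.mem_preimage, Set.mem_pi, Finset.mem_coe, Set.mem_ofPred_eq]
      constructor
      · intro h m _
        by_cases hm : m ∈ s <;> simp [hm, h m]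
      · intro h m hm
        simpa [hm] using h m (Finset.mem_range.mp (hr hm))
    rw [hset, measure_gap hN hd r hB, ← Finset.prod_subset hr]
    · exact Finset.prod_congr rfl fun m hm => by simp [hm]
    · intro m _ hm
      simp [hm]
  have hlaw : ∀ m : ℕ, HasLaw (gap N m) (expMeasure (totalRate β N d + m * (1 + β)))
      (clockMeasure β d) := fun m => by
    refine ⟨(measurable_gap N m).aemeasurable, ?_⟩
    have := congrArg (Measure.map fun x : ℕ → ℝ => x m) hmap
    rwa [Measure.map_map (measurable_pi_apply m)
      (measurable_pi_lambda _ fun m => measurable_gap N m), Measure.infinitePi_map_eval] at this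
  refine ⟨hlaw, (iIndepFun_iff_map_fun_eq_infinitePi_map fun m => measurable_gap N m).mpr ?_⟩
  simp only [fun m => (hlaw m).map_eq]
  exact hmap

/-- The law of the winners of the competitions. -/
lemma measure_target {N : ℕ} (hN : 0 < N) {d : ℕ → ℕ} (hd : ∀ i, N ≤ i → d i = 0) (r : ℕ)
    {w : ℕ → ℕ} (hw : ∀ m < r, w m < N + m) :
    clockMeasure β d {H | ∀ m < r, target N m H = w m} =
      ∏ m ∈ Finset.range r, ENNReal.ofReal
        (((d (w m) : ℝ) + ((Finset.range m).filter fun l => w l = w m).card + β) /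
          (totalRate β N d + m * (1 + β))) := by
  induction r generalizing N d w with
  | zero => simp
  | succ r ih =>
    have hS : MeasurableSet {K | ∀ m < r, target (N + 1) m K = w (m + 1)} := by
      have : {K | ∀ m < r, target (N + 1) m K = w (m + 1)} =
          ⋂ m ∈ Finset.range r, target (N + 1) m ⁻¹' {w (m + 1)} := by
        ext
        simp
      rw [this]
      exact Finset.measurableSet_biInter _ fun m _ => measurable_target _ _ (measurableSet_singleton _)
    have hj : w 0 < N := by simpa using hw 0 r.succ_pos
    have h1 := measure_wins (β := β) d hj (MeasurableSet.univ.prod hS)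
    have h2 : clockMeasure β d {H | ∀ m < r + 1, target N m H = w m} = clockMeasure β d
        {H | Wins N (w 0) H ∧ (H (w 0, 0), advance N (w 0) H) ∈
        (Set.univ : Set ℝ) ×ˢ {K | ∀ m < r, target (N + 1) m K = w (m + 1)}} := by
      refine measure_congr ?_
      filter_upwards [ae_exists_wins (β := β) hN d] with H hH
      refine propext ?_
      change (∀ m < r + 1, target N m H = w m) ↔ _ ∧ _
      simp only [Set.mem_prod, Set.mem_univ, true_and, Set.mem_ofPred_eq, Nat.forall_lt_succ_left,
        target_succ_left]
      have h0 : target N 0 H = winner N H := rfl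
      rw [h0, nextClocks]
      constructor
      · rintro ⟨h3, h4⟩
        exact ⟨h3 ▸ wins_winner hH, h3 ▸ h4⟩
      · rintro ⟨h3, h4⟩
        rw [h3.winner_eq]
        exact ⟨rfl, h4⟩
    have hd' : ∀ i, N + 1 ≤ i → bump d (w 0) i = 0 := fun i hi => by
      rw [bump, Function.update_of_ne (by omega), hd i (by omega)]
    have hprob := isProbabilityMeasure_expMeasure (totalRate_pos (β := β) hN d)
    rw [h2, h1, Measure.prod_prod, measure_univ, one_mul,
      ih N.succ_pos hd' (w := fun m => w (m + 1)) fun m hm => by have := hw (m + 1) (by omega); omega,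
      totalRate_bump hj hd, Finset.prod_range_succ', mul_comm]
    congr 1
    · refine Finset.prod_congr rfl fun m _ => ?_
      congr 2
      -- The win of row `w 0` in the first competition is counted by the filter on one side and
      -- absorbed into `bump` on the other.
      · have : ((Finset.range (m + 1)).filter fun l => w l = w (m + 1)).card =
            (if w 0 = w (m + 1) then 1 else 0) +
              ((Finset.range m).filter fun l => w (l + 1) = w (m + 1)).card := by
          simp only [Finset.card_filter, Finset.sum_range_succ']
          rw [add_comm]
        rw [this, bump]
        by_cases h : w (m + 1) = w 0
        · simp [h]
          ring
        · simp [h, Ne.symm h]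
      · push_cast
        ring
    · simp

/-! ### The embedding, path by path -/

/-- The time of the `k`-th ring of row `i`, counted from the activation of the row. -/
noncomputable def ringTime (H : Clocks) (i k : ℕ) : ℝ := ∑ l ∈ Finset.range k, H (i, l)

/-- The time at which competition `r` begins. -/
noncomputable def elapsed (N : ℕ) (H : Clocks) (r : ℕ) : ℝ := ∑ m ∈ Finset.range r, gap N m H

/-- The number of wins of row `i` in the first `r` competitions. -/
noncomputable def wins (N : ℕ) (H : Clocks) (i r : ℕ) : ℕ :=
  ((Finset.range r).filter fun m => target N m H = i).card

/-- All clocks of the chain are positive, and all competitions have a winner. -/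
def Regular (N : ℕ) (H : Clocks) : Prop :=
  ∀ r, (∀ p, 0 < chain N r H p) ∧ ∃ j, Wins (N + r) j (chain N r H)

lemma ringTime_succ (H : Clocks) (i k : ℕ) : ringTime H i (k + 1) = ringTime H i k + H (i, k) :=
  Finset.sum_range_succ _ _

lemma elapsed_succ (N : ℕ) (H : Clocks) (r : ℕ) :
    elapsed N H (r + 1) = elapsed N H r + gap N r H := Finset.sum_range_succ _ _

lemma wins_succ (N : ℕ) (H : Clocks) (i r : ℕ) :
    wins N H i (r + 1) = wins N H i r + if target N r H = i then 1 else 0 := by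
  rw [wins, wins, Finset.range_add_one, Finset.filter_insert]
  split_ifs
  · rw [Finset.card_insert_of_notMem (by simp)]
  · rfl

section

variable {N : ℕ} {H : Clocks} (h : Regular N H)
include h

lemma Regular.pos (p : ℕ × ℕ) : 0 < H p := (h 0).1 p

lemma Regular.wins_target (r : ℕ) : Wins (N + r) (target N r H) (chain N r H) :=
  wins_winner (h r).2

lemma Regular.gap_pos (r : ℕ) : 0 < gap N r H := (h r).1 _

lemma Regular.ringTime_strictMono (i : ℕ) : StrictMono (ringTime H i) :=
  strictMono_nat_of_lt_succ fun k => by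
    rw [ringTime_succ]
    linarith [h.pos (i, k)]

lemma Regular.elapsed_strictMono : StrictMono (elapsed N H) :=
  strictMono_nat_of_lt_succ fun r => by
    rw [elapsed_succ]
    linarith [h.gap_pos r]

lemma Regular.chain_inactive {r i : ℕ} (hi : N + r ≤ i) (k : ℕ) :
    chain N r H (i, k) = H (i, k) ∧ wins N H i r = 0 := by
  induction r with
  | zero => exact ⟨rfl, by simp [wins]⟩
  | succ r ih =>
    obtain ⟨h1, h2⟩ := ih (by omega)
    have hw := (h.wins_target r).1
    have hne : i ≠ target N r H := by omega
    have hlt : ¬ i < N + r := by omega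
    constructor
    · rw [chain_succ, nextClocks]
      have hne' : ¬ i = winner (N + r) (chain N r H) := hne
      simp only [advance]
      rw [if_neg hne', if_neg (by tauto), h1]
    · rw [wins_succ, h2, if_neg (Ne.symm hne)]

/-- The rings after the beginning of competition `r`, and the last one before. -/
lemma Regular.ring_chain {r i : ℕ} (hi : i < N + r) :
    (∀ k, elapsed N H r + ringTime (chain N r H) i (k + 1) =
      elapsed N H (i + 1 - N) + ringTime H i (wins N H i r + (k + 1))) ∧
    elapsed N H (i + 1 - N) + ringTime H i (wins N H i r) ≤ elapsed N H r := by
  induction r with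
  | zero =>
    have h1 : i + 1 - N = 0 := by omega
    simp [h1, elapsed, wins, chain_zero, ringTime]
  | succ r ih =>
    have hg : gap N r H = chain N r H (target N r H, 0) := rfl
    have hw := (h.wins_target r).1
    by_cases hir : i < N + r
    · obtain ⟨h1, h2⟩ := ih hir
      by_cases hij : target N r H = i
      -- The winner has used up its current clock, which is the gap, and its other entries move up
      -- by one.
      · have hsum : ∀ k, ringTime (chain N (r + 1) H) i k + gap N r H =
            ringTime (chain N r H) i (k + 1) := fun k => by
          rw [ringTime, ringTime, Finset.sum_range_succ', hg, hij]
          congr 1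
          refine Finset.sum_congr rfl fun l _ => ?_
          rw [chain_succ, nextClocks]
          have : winner (N + r) (chain N r H) = i := hij
          simp [advance, this]
        rw [wins_succ, if_pos hij, elapsed_succ]
        constructor
        · intro k
          have h3 := h1 (k + 1)
          rw [← hsum] at h3
          rw [add_assoc (wins N H i r), add_comm 1 (k + 1), ← h3]
          ring
        · have h3 := h1 0
          have h4 : ringTime (chain N r H) i (0 + 1) = gap N r H := by
            rw [ringTime_succ, hg, hij]
            simp [ringTime]
          rw [h4, zero_add] at h3
          exact h3.ge
      -- A loser's current clock is shortened by the gap and nothing else in its row changes.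
      · have hsum : ∀ k, ringTime (chain N (r + 1) H) i (k + 1) + gap N r H =
            ringTime (chain N r H) i (k + 1) := fun k => by
          rw [ringTime, ringTime, Finset.sum_range_succ', Finset.sum_range_succ', hg, add_assoc]
          have hw' : ¬ i = winner (N + r) (chain N r H) := fun h' => hij h'.symm
          congr 1
          · refine Finset.sum_congr rfl fun l _ => ?_
            rw [chain_succ, nextClocks]
            simp [advance, hw']
          · rw [chain_succ, nextClocks]
            simp only [advance, hw', hir, if_false, and_self, if_true, target]
            ring
        rw [wins_succ, if_neg hij, elapsed_succ, add_zero]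
        constructor
        · intro k
          rw [← h1 k, ← hsum k]
          ring
        · linarith [h.gap_pos r]
    -- The remaining row is the one activated at the end of competition `r`: its clocks are
    -- untouched and it has no wins.
    · have hieq : i = N + r := by omega
      have h0 := fun k => h.chain_inactive (show N + r ≤ i by omega) k
      have h3 : i + 1 - N = r + 1 := by omega
      have hne : ¬ i = winner (N + r) (chain N r H) := fun h' => by
        have : i = target N r H := h'
        omega
      have hsum : ∀ k, ringTime (chain N (r + 1) H) i k = ringTime H i k := fun k => by
        refine Finset.sum_congr rfl fun l _ => ?_
        rw [chain_succ, nextClocks]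
        simp only [advance]
        rw [if_neg hne, if_neg (by tauto), (h0 l).1]
      have hne' : ¬ target N r H = i := fun h' => hne h'.symm
      rw [wins_succ, if_neg hne', (h0 0).2, h3]
      exact ⟨fun k => by rw [hsum, Nat.zero_add (k + 1)], by simp [ringTime]⟩

/-- This ties degrees to states: when competition `r` begins, the process of row `i` has jumped
exactly as often as the row has won. -/
lemma Regular.elapsed_mem {r i : ℕ} (hi : i < N + r) :
    elapsed N H (i + 1 - N) + ringTime H i (wins N H i r) ≤ elapsed N H r ∧
      elapsed N H r < elapsed N H (i + 1 - N) + ringTime H i (wins N H i r + 1) := by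
  obtain ⟨h1, h2⟩ := h.ring_chain hi
  refine ⟨h2, ?_⟩
  have h3 := h1 0
  rw [zero_add] at h3
  rw [← h3, ringTime_succ]
  have := (h r).1 (i, 0)
  simp only [ringTime, Finset.range_zero, Finset.sum_empty, zero_add]
  linarith

/-- Rings numbered up to `wins` are past, and the next ring of an active row is its current clock
away, so the earliest one is the winner's. This is the recursion of the branching times. -/
lemma Regular.isLeast_elapsed (r : ℕ) :
    IsLeast {s : ℝ | ∃ i k : ℕ, i < N + r ∧ 1 ≤ k ∧
      s = elapsed N H (i + 1 - N) + ringTime H i k ∧ elapsed N H r < s} (elapsed N H (r + 1)) := by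
  have hw := h.wins_target r
  have hone : ∀ i, ringTime (chain N r H) i (0 + 1) = chain N r H (i, 0) := fun i => by
    simp [ringTime]
  constructor
  · refine ⟨target N r H, wins N H (target N r H) r + 1, hw.1, by omega, ?_,
      h.elapsed_strictMono r.lt_succ_self⟩
    have h1 := (h.ring_chain hw.1).1 0
    rw [hone, zero_add] at h1
    rw [← h1, elapsed_succ]
    rfl
  · rintro s ⟨i, k, hi, -, rfl, hs⟩
    have h1 := (h.ring_chain hi).1 0
    have h2 := (h.ring_chain hi).2
    rw [hone, zero_add] at h1
    have hk : wins N H i r + 1 ≤ k := by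
      by_contra hk
      have := (h.ringTime_strictMono i).monotone (show k ≤ wins N H i r by omega)
      linarith
    have h3 := (h.ringTime_strictMono i).monotone hk
    have h4 : gap N r H ≤ chain N r H (i, 0) := by
      by_cases hij : i = target N r H
      · rw [hij]
        exact le_rfl
      · exact (hw.2 i hi hij).le
    rw [elapsed_succ]
    linarith

end

lemma branchTimeA_eq_elapsed {H : Clocks} (h : Regular 1 H) {τ : ℕ → ℕ → ℝ}
    (hτ : ∀ i k, τ (i + 1) k = ringTime H i k) (n : ℕ) :
    branchTimeA τ n = elapsed 1 H (n - 1) := by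
  induction n using Nat.strong_induction_on with
  | _ n ih =>
    match n with
    | 0 => simp [branchTimeA, elapsed]
    | 1 => simp [branchTimeA, elapsed]
    | n + 2 =>
      rw [branchTimeA]
      have hset : {s : ℝ | ∃ i k : ℕ, ∃ _ : 1 ≤ i ∧ i ≤ n + 1, 1 ≤ k ∧
          s = branchTimeA τ i + τ i k ∧ branchTimeA τ (n + 1) < s} =
          {s : ℝ | ∃ i k : ℕ, i < 1 + n ∧ 1 ≤ k ∧
            s = elapsed 1 H (i + 1 - 1) + ringTime H i k ∧ elapsed 1 H n < s} := by
        ext s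
        constructor
        · rintro ⟨i, k, hi, hk, hs, hlt⟩
          obtain ⟨i, rfl⟩ := Nat.exists_eq_add_of_le' hi.1
          rw [ih _ (by omega)] at hlt
          rw [ih _ (by omega), hτ] at hs
          exact ⟨i, k, by omega, hk, hs, hlt⟩
        · rintro ⟨i, k, hi, hk, hs, hlt⟩
          refine ⟨i + 1, k, by omega, hk, ?_, ?_⟩
          · rw [ih _ (by omega), hτ]
            exact hs
          · rw [ih _ (by omega)]
            exact hlt
      rw [hset, (h.isLeast_elapsed n).csInf_eq]
      rfl

/-- Process `i` is row `i - 1`, activated at `elapsed 2 H (i - 2)`; truncated subtraction makes both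
initial rows start at time `0`, in agreement with `T_0 = T_1 = 0`. -/
lemma branchTimeB_eq_elapsed {H : Clocks} (h : Regular 2 H) {τ : ℕ → ℕ → ℝ}
    (hτ : ∀ i k, τ (i + 1) k = ringTime H i k) (n : ℕ) :
    branchTimeB τ n = elapsed 2 H (n - 1) := by
  induction n using Nat.strong_induction_on with
  | _ n ih =>
    match n with
    | 0 => simp [branchTimeB, elapsed]
    | 1 => simp [branchTimeB, elapsed]
    | n + 2 =>
      rw [branchTimeB]
      have hset : {s : ℝ | ∃ i k : ℕ, ∃ _ : 1 ≤ i ∧ i ≤ n + 2, 1 ≤ k ∧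
          s = branchTimeB τ (i - 1) + τ i k ∧ branchTimeB τ (n + 1) < s} =
          {s : ℝ | ∃ i k : ℕ, i < 2 + n ∧ 1 ≤ k ∧
            s = elapsed 2 H (i + 1 - 2) + ringTime H i k ∧ elapsed 2 H n < s} := by
        ext s
        constructor
        · rintro ⟨i, k, hi, hk, hs, hlt⟩
          obtain ⟨i, rfl⟩ := Nat.exists_eq_add_of_le' hi.1
          rw [ih _ (by omega)] at hlt
          rw [ih _ (by omega), hτ] at hs
          exact ⟨i, k, by omega, hk, hs, hlt⟩
        · rintro ⟨i, k, hi, hk, hs, hlt⟩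
          refine ⟨i + 1, k, by omega, hk, ?_, ?_⟩
          · rw [ih _ (by omega), hτ]
            exact hs
          · rw [ih _ (by omega)]
            exact hlt
      rw [hset, (h.isLeast_elapsed n).csInf_eq]
      rfl

/-! ### Paths of birth processes -/

section Path

variable {x₀ : ℕ} {x : ℝ → ℕ}

lemma jumpTime_zero (h0 : x 0 = x₀) : jumpTime x₀ x 0 = 0 :=
  le_antisymm (csInf_le ⟨0, fun _ ht => ht.1⟩ ⟨le_rfl, by simp [h0]⟩)
    (Real.sInf_nonneg fun _ ht => ht.1)

lemma jumpTime_eq_sum (h0 : x 0 = x₀) (k : ℕ) :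
    jumpTime x₀ x k = ∑ l ∈ Finset.range k, holdingTime x₀ x l := by
  induction k with
  | zero => simp [jumpTime_zero h0]
  | succ k ih => rw [Finset.sum_range_succ, ← ih, holdingTime]; ring

lemma path_eq (hmono : MonotoneOn x (Set.Ici 0))
    (hright : ∀ t, 0 ≤ t → ContinuousWithinAt x (Set.Ici t) t)
    (hpos : ∀ k, 0 < holdingTime x₀ x k) {k : ℕ} {t : ℝ} (h1 : jumpTime x₀ x k ≤ t)
    (h2 : t < jumpTime x₀ x (k + 1)) : x t = x₀ + k := by
  have hbdd : ∀ k, BddBelow {t : ℝ | 0 ≤ t ∧ x₀ + k ≤ x t} := fun k => ⟨0, fun _ ht => ht.1⟩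
  -- If the level were never reached, this jump time and the next would both be `sInf ∅ = 0`, and
  -- the holding time would not be positive.
  have hne : {t : ℝ | 0 ≤ t ∧ x₀ + k ≤ x t}.Nonempty := by
    by_contra hne
    rw [Set.not_nonempty_iff_eq_empty] at hne
    have hne' : {t : ℝ | 0 ≤ t ∧ x₀ + (k + 1) ≤ x t} = ∅ := by
      refine Set.subset_empty_iff.mp (hne ▸ fun t ht => ⟨ht.1, le_trans (by omega) ht.2⟩)
    have := hpos k
    rw [holdingTime, jumpTime, jumpTime, hne, hne'] at this
    simp at this
  have hJ0 : 0 ≤ jumpTime x₀ x k := Real.sInf_nonneg fun _ ht => ht.1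
  -- The infimum is attained: by right-continuity an integer-valued path is constant just after the
  -- jump time.
  have hJ : x₀ + k ≤ x (jumpTime x₀ x k) := by
    have hev : ∀ᶠ s in 𝓝[Set.Ici (jumpTime x₀ x k)] (jumpTime x₀ x k),
        x s = x (jumpTime x₀ x k) :=
      (hright _ hJ0).eventually (p := fun y => y = x (jumpTime x₀ x k)) (by rw [nhds_discrete]; exact Filter.eventually_pure.mpr rfl)
    rw [eventually_nhdsWithin_iff, Metric.eventually_nhds_iff] at hev
    obtain ⟨ε, hε, hball⟩ := hev
    obtain ⟨s, hs, hlt⟩ := exists_lt_of_csInf_lt hne (show jumpTime x₀ x k < jumpTime x₀ x k + ε by linarith)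
    have hle : jumpTime x₀ x k ≤ s := csInf_le (hbdd k) hs
    rw [← hball (by rw [Real.dist_eq, abs_of_nonneg] <;> linarith) hle]
    exact hs.2
  have ht0 : 0 ≤ t := hJ0.trans h1
  refine le_antisymm ?_ (hJ.trans (hmono hJ0 ht0 h1))
  by_contra hlt
  exact absurd (csInf_le (hbdd (k + 1)) ⟨ht0, by omega⟩) (not_le.mpr h2)

end Path

/-! ### Almost sure behaviour of the clocks -/

lemma charFun_expMeasure {r : ℝ} (hr : 0 < r) (t : ℝ) :
    charFun (expMeasure r) t = r / (r + -(t * Complex.I)) := by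
  rw [charFun_apply_real, ← integral_cexp_expMeasure hr (by simpa using hr)]
  refine integral_congr_ae (Eventually.of_forall fun x => ?_)
  simp only [neg_neg]
  congr 1
  ring

lemma map_const_mul_expMeasure {r c : ℝ} (hr : 0 < r) (hc : 0 < c) :
    (expMeasure r).map (fun x => c * x) = expMeasure (r / c) := by
  have hrc : 0 < r / c := div_pos hr hc
  have h1 := isProbabilityMeasure_expMeasure hr
  have h2 := isProbabilityMeasure_expMeasure hrc
  have h3 : IsProbabilityMeasure ((expMeasure r).map (fun x => c * x)) :=
    Measure.isProbabilityMeasure_map (by fun_prop)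
  refine Measure.ext_of_charFun (funext fun t => ?_)
  rw [charFun_map_mul, charFun_expMeasure hr, charFun_expMeasure hrc]
  have hc' : (c : ℂ) ≠ 0 := by exact_mod_cast hc.ne'
  push_cast
  rw [show (r / c + -(t * Complex.I) : ℂ) = (r + -(c * t * Complex.I)) / c by
    field_simp]
  rw [div_div_div_cancel_right₀ hc']

section

variable {β : ℝ} [hβ : Fact (0 < β)] {d : ℕ → ℕ}

lemma hasLaw_clock (d : ℕ → ℕ) (p : ℕ × ℕ) : HasLaw (fun H : Clocks => H p)
    (expMeasure ((d p.1 : ℝ) + p.2 + β)) (clockMeasure β d) :=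
  ⟨(measurable_pi_apply p).aemeasurable, by rw [clockMeasure_eq, Measure.infinitePi_map_eval]⟩

lemma iIndepFun_clock (d : ℕ → ℕ) :
    iIndepFun (fun (p : ℕ × ℕ) (H : Clocks) => H p) (clockMeasure β d) := by
  rw [clockMeasure_eq]
  exact iIndepFun_infinitePi (X := fun _ x => x) (fun _ => measurable_id)

lemma ae_clock_pos (d : ℕ → ℕ) : ∀ᵐ H ∂clockMeasure β d, ∀ p, 0 < H p := by
  refine ae_all_iff.mpr fun p => ?_
  have h := (hasLaw_clock (β := β) d p).measure_eq (p := fun x => ¬ 0 < x)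
    (measurableSet_Ioi (a := (0 : ℝ))).compl
  rw [ae_iff, h]
  simp only [not_lt]
  exact expMeasure_Iic_zero _

lemma ae_regular {N : ℕ} (hN : 0 < N) (d : ℕ → ℕ) : ∀ᵐ H ∂clockMeasure β d, Regular N H := by
  refine ae_all_iff.mpr fun r => ?_
  refine ae_chain (p := fun K => (∀ p, 0 < K p) ∧ ∃ j, Wins (N + r) j K) ?_ ?_ hN r d
  · have h1 : {K : Clocks | (∀ p, 0 < K p) ∧ ∃ j, Wins (N + r) j K} =
        (⋂ p, {K | 0 < K p}) ∩ ⋃ j, {K | Wins (N + r) j K} := by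
      ext
      simp
    rw [h1]
    exact (MeasurableSet.iInter fun p => measurableSet_lt measurable_const
      (measurable_pi_apply p)).inter (MeasurableSet.iUnion fun j => measurableSet_wins _ _)
  · intro d
    filter_upwards [ae_clock_pos (β := β) d, ae_exists_wins (β := β) (show 0 < N + r by omega) d]
      with H h1 h2 using ⟨h1, h2⟩

/-- The limit of `n e^{-(1 + β) T_n}`. -/
noncomputable def speed (β : ℝ) (N : ℕ) (H : Clocks) : ℝ :=
  growthLimit fun m => (1 + β) * gap N m H

/-- The limit of `BI_i(t) e^{-t}`. -/
noncomputable def rowLimit (i : ℕ) (H : Clocks) : ℝ := growthLimit fun k => H (i, k)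

lemma measurable_rowLimit (i : ℕ) : Measurable (rowLimit i) :=
  measurable_growthLimit.comp (measurable_pi_lambda _ fun k => measurable_pi_apply (i, k))

/-- The gaps have rates in progression of step `1 + β`; scaling makes the step `1`, the form
required by `growthLimit`. -/
lemma scaled_gap {N : ℕ} (hN : 0 < N) (hd : ∀ i, N ≤ i → d i = 0) :
    (∀ m : ℕ, HasLaw (fun H => (1 + β) * gap N m H)
      (expMeasure (totalRate β N d / (1 + β) + m)) (clockMeasure β d)) ∧
      iIndepFun (fun m H => (1 + β) * gap N m H) (clockMeasure β d) := by
  obtain ⟨h1, h2⟩ := iIndepFun_gap (β := β) hN hd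
  have hβ0 := hβ.out
  have hc : 0 < 1 + β := by positivity
  refine ⟨fun m => ⟨((measurable_gap N m).const_mul (1 + β)).aemeasurable, ?_⟩,
    h2.comp (fun _ x => (1 + β) * x) fun _ => by fun_prop⟩
  have hr : 0 < totalRate β N d + m * (1 + β) := by
    have := totalRate_pos (β := β) hN d
    positivity
  have h3 := map_const_mul_expMeasure hr hc
  rw [← (h1 m).map_eq, Measure.map_map (by fun_prop) (measurable_gap N m)] at h3
  rw [add_div, mul_div_cancel_right₀ _ hc.ne'] at h3
  exact h3

lemma ae_tendsto_speed {N : ℕ} (hN : 0 < N) (hd : ∀ i, N ≤ i → d i = 0) :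
    ∀ᵐ H ∂clockMeasure β d, 0 < speed β N H ∧ Tendsto (fun n : ℕ => (n : ℝ) *
      Real.exp (-((1 + β) * elapsed N H n))) atTop (𝓝 (speed β N H)) := by
  obtain ⟨h1, h2⟩ := scaled_gap (β := β) hN hd
  have hc : 0 < 1 + β := by linarith [hβ.out]
  have h := ae_tendsto_growthLimit (div_pos (totalRate_pos (β := β) hN d) hc)
    (fun m => (measurable_gap N m).const_mul (1 + β)) h2 h1
  filter_upwards [h] with H hH
  simp only [← Finset.mul_sum] at hH
  exact hH

lemma hasLaw_speed {N : ℕ} (hN : 0 < N) (hd : ∀ i, N ≤ i → d i = 0) :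
    HasLaw (speed β N) (gammaMeasure (totalRate β N d / (1 + β)) 1) (clockMeasure β d) := by
  obtain ⟨h1, h2⟩ := scaled_gap (β := β) hN hd
  have hc : 0 < 1 + β := by linarith [hβ.out]
  exact hasLaw_growthLimit (div_pos (totalRate_pos (β := β) hN d) hc)
    (fun m => (measurable_gap N m).const_mul (1 + β)) h2 h1

lemma row_clock (d : ℕ → ℕ) (i : ℕ) :
    (∀ k : ℕ, HasLaw (fun H : Clocks => H (i, k)) (expMeasure ((d i : ℝ) + β + k))
      (clockMeasure β d)) ∧ iIndepFun (fun (k : ℕ) (H : Clocks) => H (i, k)) (clockMeasure β d) := by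
  refine ⟨fun k => ?_, (iIndepFun_clock d).precomp (g := fun k => (i, k)) fun _ _ h => by simpa using h⟩
  rw [add_right_comm]
  exact hasLaw_clock d (i, k)

lemma ae_tendsto_rowLimit (d : ℕ → ℕ) (i : ℕ) :
    ∀ᵐ H ∂clockMeasure β d, 0 < rowLimit i H ∧ Tendsto (fun k : ℕ => (k : ℝ) *
      Real.exp (-ringTime H i k)) atTop (𝓝 (rowLimit i H)) := by
  obtain ⟨h1, h2⟩ := row_clock (β := β) d i
  exact ae_tendsto_growthLimit (by have := hβ.out; positivity) (fun k => measurable_pi_apply (i, k))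
    h2 h1

lemma hasLaw_rowLimit (d : ℕ → ℕ) (i : ℕ) :
    HasLaw (rowLimit i) (gammaMeasure ((d i : ℝ) + β) 1) (clockMeasure β d) := by
  obtain ⟨h1, h2⟩ := row_clock (β := β) d i
  exact hasLaw_growthLimit (by have := hβ.out; positivity) (fun k => measurable_pi_apply (i, k))
    h2 h1

lemma iIndepFun_row (d : ℕ → ℕ) :
    iIndepFun (fun (i : ℕ) (H : Clocks) (k : ℕ) => H (i, k)) (clockMeasure β d) := by
  rw [clockMeasure_eq]
  have hi : ∀ i k : ℕ, IsProbabilityMeasure (expMeasure ((d i : ℝ) + k + β)) := fun i k =>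
    isProbabilityMeasure_expMeasure (rate_pos d (i, k))
  have hc : (Measure.infinitePi fun p : ℕ × ℕ => expMeasure ((d p.1 : ℝ) + p.2 + β)).map
      (fun H i k => H (i, k)) = Measure.infinitePi fun i : ℕ =>
        Measure.infinitePi fun k : ℕ => expMeasure ((d i : ℝ) + k + β) :=
    Measure.infinitePi_map_curry (fun i k : ℕ => expMeasure ((d i : ℝ) + k + β))
  have hm : Measurable fun (H : Clocks) (i k : ℕ) => H (i, k) := by fun_prop
  rw [iIndepFun_iff_map_fun_eq_infinitePi_map fun i => by fun_prop, hc]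
  congr 1
  ext1 i
  rw [← Measure.infinitePi_map_eval (fun i : ℕ =>
    Measure.infinitePi fun k : ℕ => expMeasure ((d i : ℝ) + k + β)) i, ← hc,
    Measure.map_map (measurable_pi_apply i) hm]
  rfl

/-- The growth of the rows is bounded uniformly. -/
lemma ae_eventually_row_le (hd : ∀ i, 1 ≤ i → d i = 0) {ε : ℝ} (hε : 0 < ε) :
    ∀ᵐ H ∂clockMeasure β d, ∀ᶠ i : ℕ in atTop, ∀ k : ℕ,
      (k : ℝ) * Real.exp (-ringTime H i (k + 1)) ≤ ((i : ℝ) + 1) ^ ε := by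
  have hβ0 := hβ.out
  -- With `s = 2 / ε` the level `(i + 2) ^ ε` has tail at most `C (i + 2) ^ (-2)`, which is
  -- summable. Row `0` is left out: the other rows have the same law and hence the same `C`.
  obtain ⟨C, hC, h⟩ := measure_exists_le_mul_exp (μ := clockMeasure β d) hβ0
    (s := 2 / ε) (by positivity)
  set s : ℕ → Set Clocks := fun i => {H | ∃ k : ℕ, ((i : ℝ) + 1 + 1) ^ ε ≤
    k * Real.exp (-∑ l ∈ Finset.range (k + 1), H (i + 1, l))} with hs
  have hle : ∀ i, clockMeasure β d (s i) ≤ ENNReal.ofReal (C * (1 / ((i : ℝ) + 1 + 1) ^ 2)) := by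
    intro i
    obtain ⟨h1, h2⟩ := row_clock (β := β) d (i + 1)
    rw [hd (i + 1) (by omega)] at h1
    simp only [Nat.cast_zero, zero_add] at h1
    have hx : (0 : ℝ) < (i : ℝ) + 1 + 1 := by positivity
    refine (h _ (fun k => measurable_pi_apply _) h2 h1 _ (Real.rpow_pos_of_pos hx ε)).trans_eq ?_
    congr 2
    rw [← Real.rpow_mul hx.le, mul_neg, mul_div_cancel₀ _ hε.ne', Real.rpow_neg hx.le,
      one_div]
    norm_cast
  have hsum : Summable fun i : ℕ => C * (1 / ((i : ℝ) + 1 + 1) ^ 2) := by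
    have := (summable_nat_add_iff 2).mpr (Real.summable_one_div_nat_pow.mpr one_lt_two)
    refine (this.mul_left C).congr fun i => ?_
    push_cast
    ring
  have hbc := ae_eventually_notMem (μ := clockMeasure β d) (s := s)
    ((ENNReal.tsum_le_tsum hle).trans_lt hsum.tsum_ofReal_lt_top).ne
  filter_upwards [hbc] with H hH
  obtain ⟨n, hn⟩ := eventually_atTop.mp hH
  refine eventually_atTop.mpr ⟨n + 1, fun i hi k => ?_⟩
  obtain ⟨i, rfl⟩ := Nat.exists_eq_add_of_le' (show 1 ≤ i by omega)
  by_contra hk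
  exact hn i (by omega) ⟨k, by push_cast at hk; exact (not_le.mp hk).le⟩

end

/-! ### Convergence of the maximum -/

lemma exists_isMax_of_tendsto_zero {y : ℕ → ℝ} (h0 : ∀ i, 0 ≤ y i) (hy : Tendsto y atTop (𝓝 0)) :
    ∃ m, ∀ j, y j ≤ y m := by
  by_cases hz : ∀ i, y i = 0
  · exact ⟨0, fun j => by rw [hz, hz]⟩
  · obtain ⟨i, hi⟩ := not_forall.mp hz
    have hi' : 0 < y i := lt_of_le_of_ne (h0 i) (Ne.symm hi)
    obtain ⟨K, hK⟩ := eventually_atTop.mp (hy.eventually (gt_mem_nhds hi'))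
    obtain ⟨m, -, hm⟩ := Finset.exists_max_image (Finset.range (K + i + 1)) y ⟨0, by simp⟩
    refine ⟨m, fun j => ?_⟩
    by_cases hj : j < K + i + 1
    · exact hm j (Finset.mem_range.mpr hj)
    · exact (hK j (by omega)).le.trans (hm i (Finset.mem_range.mpr (by omega)))

/-- Far rows stay below `b i` at all times, and `b` vanishes, so for every positive level only
finitely many rows matter, and for these the termwise limits suffice. The same bound makes `y` tend
to `0`, whence its maximum is attained. -/
lemma tendsto_sup_mul {D : ℕ → ℕ → ℕ} {c : ℕ → ℝ} {y b : ℕ → ℝ} (hc : ∀ r, 0 < c r)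
    (hlim : ∀ i, Tendsto (fun r => (D i r : ℝ) * c r) atTop (𝓝 (y i)))
    (hb : Tendsto b atTop (𝓝 0)) (hle : ∀ᶠ i in atTop, ∀ r, i ≤ r → (D i r : ℝ) * c r ≤ b i) :
    (∃ m, ∀ j, y j ≤ y m) ∧ Tendsto (fun r =>
      (((Finset.range (r + 1)).sup fun i => D i r : ℕ) : ℝ) * c r) atTop (𝓝 (⨆ i, y i)) := by
  have h0 : ∀ i, 0 ≤ y i := fun i =>
    ge_of_tendsto' (hlim i) fun r => mul_nonneg (Nat.cast_nonneg _) (hc r).le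
  have hyb : ∀ᶠ i in atTop, y i ≤ b i := by
    filter_upwards [hle] with i hi
    exact le_of_tendsto (hlim i) (eventually_atTop.mpr ⟨i, fun r hr => hi r hr⟩)
  have hy : Tendsto y atTop (𝓝 0) :=
    tendsto_of_tendsto_of_tendsto_of_le_of_le' tendsto_const_nhds hb
      (Eventually.of_forall h0) hyb
  obtain ⟨m, hm⟩ := exists_isMax_of_tendsto_zero h0 hy
  refine ⟨⟨m, hm⟩, ?_⟩
  have hsup : ⨆ i, y i = y m :=
    le_antisymm (ciSup_le hm) (le_ciSup ⟨y m, by rintro _ ⟨j, rfl⟩; exact hm j⟩ m)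
  rw [hsup]
  refine tendsto_order.mpr ⟨fun a ha => ?_, fun a ha => ?_⟩
  · filter_upwards [(hlim m).eventually (lt_mem_nhds ha), eventually_ge_atTop m] with r hr hmr
    refine hr.trans_le (mul_le_mul_of_nonneg_right ?_ (hc r).le)
    exact_mod_cast Finset.le_sup (f := fun i => D i r) (Finset.mem_range.mpr (by omega : m < r + 1))
  · have ha0 : 0 < a := (h0 m).trans_lt ha
    obtain ⟨K, hK⟩ := eventually_atTop.mp (hle.and (hb.eventually (gt_mem_nhds ha0)))
    have hev : ∀ᶠ r in atTop, ∀ i ∈ Finset.range K, (D i r : ℝ) * c r < a :=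
      (Finset.eventually_all _).mpr fun i _ =>
        (hlim i).eventually (gt_mem_nhds ((hm i).trans_lt ha))
    filter_upwards [hev] with r hr
    obtain ⟨i, hi, hieq⟩ := Finset.exists_mem_eq_sup (Finset.range (r + 1)) ⟨0, by simp⟩
      (fun i => D i r)
    rw [hieq]
    by_cases hiK : i < K
    · exact hr i (Finset.mem_range.mpr hiK)
    · obtain ⟨h1, h2⟩ := hK i (by omega)
      exact (h1 r (by have := Finset.mem_range.mp hi; omega)).trans_lt h2

/-! ### Typical clocks -/

/-- The almost sure properties of the clocks that determine the asymptotics of the degrees. -/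
structure Typical (β : ℝ) (N : ℕ) (H : Clocks) : Prop where
  regular : Regular N H
  speed_pos : 0 < speed β N H
  tendsto_speed : Tendsto (fun n : ℕ => (n : ℝ) * Real.exp (-((1 + β) * elapsed N H n))) atTop
    (𝓝 (speed β N H))
  tendsto_row : ∀ i, Tendsto (fun k : ℕ => (k : ℝ) * Real.exp (-ringTime H i k)) atTop
    (𝓝 (rowLimit i H))
  row_le : ∀ᶠ i : ℕ in atTop, ∀ k : ℕ,
    (k : ℝ) * Real.exp (-ringTime H i (k + 1)) ≤ ((i : ℝ) + 1) ^ (1 / (2 * (1 + β)))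

lemma ae_typical {β : ℝ} [hβ : Fact (0 < β)] {N : ℕ} (hN : 0 < N) {d : ℕ → ℕ}
    (hd : ∀ i, 1 ≤ i → d i = 0) : ∀ᵐ H ∂clockMeasure β d, Typical β N H := by
  have hβ0 := hβ.out
  filter_upwards [ae_regular (β := β) hN d, ae_tendsto_speed hN fun i hi => hd i (by omega),
    ae_all_iff.mpr (ae_tendsto_rowLimit (β := β) d),
    ae_eventually_row_le hd (ε := 1 / (2 * (1 + β))) (by positivity)] with H h1 h2 h3 h4
  exact ⟨h1, h2.1, h2.2, fun i => (h3 i).2, h4⟩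

section

variable {β : ℝ} [hβ : Fact (0 < β)] {N : ℕ} {H : Clocks} (h : Typical β N H)
include h

omit hβ in
lemma Typical.tendsto_succ_speed :
    Tendsto (fun n : ℕ => ((n + 1 : ℕ) : ℝ) * Real.exp (-((1 + β) * elapsed N H n))) atTop
      (𝓝 (speed β N H)) := by
  have h4 := (tendsto_natCast_div_add_atTop (1 : ℝ)).inv₀ one_ne_zero |>.mul h.tendsto_speed
  rw [inv_one, one_mul] at h4
  refine h4.congr' ?_
  filter_upwards [eventually_gt_atTop 0] with n hn
  have : (n : ℝ) ≠ 0 := by exact_mod_cast hn.ne'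
  rw [inv_div]
  push_cast
  field_simp

lemma Typical.tendsto_elapsed : Tendsto (elapsed N H) atTop atTop := by
  have hc : 0 < 1 + β := by linarith [hβ.out]
  have h1 : Tendsto (fun n : ℕ => Real.exp (-((1 + β) * elapsed N H n))) atTop (𝓝 0) := by
    have h2 := h.tendsto_speed.mul (tendsto_inv_atTop_nhds_zero_nat (𝕜 := ℝ))
    rw [mul_zero] at h2
    refine h2.congr' ?_
    filter_upwards [eventually_gt_atTop 0] with n hn
    have : (n : ℝ) ≠ 0 := by exact_mod_cast hn.ne'
    field_simp
  rw [Real.tendsto_exp_comp_nhds_zero, tendsto_neg_atBot_iff] at h1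
  exact (tendsto_const_mul_atTop_of_pos hc).mp h1

lemma Typical.tendsto_wins (i : ℕ) : Tendsto (wins N H i) atTop atTop := by
  refine tendsto_atTop.mpr fun K => ?_
  filter_upwards [h.tendsto_elapsed.eventually_ge_atTop
    (elapsed N H (i + 1 - N) + ringTime H i K), eventually_ge_atTop (i + 1)] with r hr hir
  by_contra hlt
  have h1 := (h.regular.elapsed_mem (show i < N + r by omega)).2
  have h2 := (h.regular.ringTime_strictMono i).monotone (show wins N H i r + 1 ≤ K by omega)
  linarith

/-- Growth of the number of wins of a single row. -/
lemma Typical.tendsto_wins_mul (i c : ℕ) :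
    Tendsto (fun r => ((c + wins N H i r : ℕ) : ℝ) * Real.exp (-elapsed N H r)) atTop
      (𝓝 (rowLimit i H * Real.exp (-elapsed N H (i + 1 - N)))) := by
  have hratio : ∀ e : ℕ → ℝ, Tendsto (fun k : ℕ => (k : ℝ) * e k) atTop (𝓝 (rowLimit i H)) →
      ∀ c : ℝ, Tendsto (fun k : ℕ => ((k : ℝ) + c) * e k) atTop (𝓝 (rowLimit i H)) := by
    intro e he c
    have h1 := (tendsto_natCast_div_add_atTop c).inv₀ one_ne_zero
    have h2 := h1.mul he
    rw [inv_one, one_mul] at h2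
    refine h2.congr' ?_
    filter_upwards [eventually_gt_atTop 0] with n hn
    have : (n : ℝ) ≠ 0 := by exact_mod_cast hn.ne'
    rw [inv_div]
    field_simp
  have hup := hratio _ (h.tendsto_row i) c
  have hlo : Tendsto (fun k : ℕ => ((k : ℝ) + c) * Real.exp (-ringTime H i (k + 1))) atTop
      (𝓝 (rowLimit i H)) := by
    have h1 := (h.tendsto_row i).comp (tendsto_add_atTop_nat 1)
    have h2 : Tendsto (fun k : ℕ => (k : ℝ) * Real.exp (-ringTime H i (k + 1))) atTop
        (𝓝 (rowLimit i H)) := by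
      have h3 := (tendsto_natCast_div_add_atTop (1 : ℝ)).mul h1
      rw [one_mul] at h3
      refine h3.congr fun n => ?_
      have : (n : ℝ) + 1 ≠ 0 := by positivity
      simp only [Function.comp_apply, Nat.cast_add, Nat.cast_one]
      field_simp
    exact hratio _ h2 c
  have hw := h.tendsto_wins i
  -- The time `elapsed N H r` lies between the last ring of the row and the next one, and both
  -- bounds have the same limit.
  refine tendsto_of_tendsto_of_tendsto_of_le_of_le' ((hlo.comp hw).mul_const _)
    ((hup.comp hw).mul_const _) ?_ ?_
  · filter_upwards [eventually_ge_atTop (i + 1)] with r hr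
    have h1 := (h.regular.elapsed_mem (show i < N + r by omega)).2
    simp only [Function.comp_apply]
    rw [mul_assoc, ← Real.exp_add, Nat.cast_add, add_comm (c : ℝ)]
    gcongr
    linarith
  · filter_upwards [eventually_ge_atTop (i + 1)] with r hr
    have h1 := (h.regular.elapsed_mem (show i < N + r by omega)).1
    simp only [Function.comp_apply]
    rw [mul_assoc, ← Real.exp_add, Nat.cast_add, add_comm (c : ℝ)]
    gcongr
    linarith

/-- The birth factor decays like `i^{-1/(1+β)}`, with twice the exponent granted to the rows in
`Typical.row_le`, so the product still vanishes. -/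
lemma Typical.tendsto_birth (hN : 0 < N) :
    Tendsto (fun i : ℕ => 4 * ((i : ℝ) + 1) ^ (1 / (2 * (1 + β))) *
      Real.exp (-elapsed N H (i + 1 - N))) atTop (𝓝 0) := by
  have hc : 0 < 1 + β := by linarith [hβ.out]
  have hε : 0 < 1 / (2 * (1 + β)) := by positivity
  -- The shift by `N - 1` removes the truncated subtraction from the birth time.
  rw [← tendsto_add_atTop_iff_nat (N - 1)]
  have h1 : Tendsto (fun n : ℕ => ((n : ℝ) + N) * Real.exp (-(2 * (1 + β) * elapsed N H n))) atTop
      (𝓝 0) := by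
    have h2 : Tendsto (fun n : ℕ => Real.exp (-((1 + β) * elapsed N H n))) atTop (𝓝 0) := by
      rw [Real.tendsto_exp_comp_nhds_zero, tendsto_neg_atBot_iff]
      exact h.tendsto_elapsed.const_mul_atTop hc
    have h3 := (h.tendsto_speed.mul h2).add ((h2.mul h2).const_mul (N : ℝ))
    simp only [mul_zero, add_zero] at h3
    refine h3.congr fun n => ?_
    rw [show -(2 * (1 + β) * elapsed N H n) =
      -((1 + β) * elapsed N H n) + -((1 + β) * elapsed N H n) by ring, Real.exp_add]
    ring
  have h2 := (h1.rpow_const (p := 1 / (2 * (1 + β))) (Or.inr hε.le)).const_mul 4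
  rw [Real.zero_rpow hε.ne', mul_zero] at h2
  refine h2.congr fun n => ?_
  rw [Real.mul_rpow (by positivity) (Real.exp_nonneg _), ← Real.exp_mul, ← mul_assoc]
  have h3 : n + (N - 1) + 1 - N = n := by omega
  have h4 : ((n + (N - 1) : ℕ) : ℝ) + 1 = n + N := by
    rw [← Nat.cast_add_one, ← Nat.cast_add]
    congr 1
    omega
  rw [h3, h4]
  congr 2
  field_simp

/-- Uniform bound on the number of wins. -/
lemma Typical.wins_mul_le {c : ℕ} (hc : c ≤ 2) (hN : 0 < N) :
    ∀ᶠ i in atTop, ∀ r, i ≤ r → ((c + wins N H i r : ℕ) : ℝ) * Real.exp (-elapsed N H r) ≤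
      4 * ((i : ℝ) + 1) ^ (1 / (2 * (1 + β))) * Real.exp (-elapsed N H (i + 1 - N)) := by
  have hβ0 := hβ.out
  filter_upwards [h.row_le] with i hi r hir
  have h1 := (h.regular.elapsed_mem (show i < N + r by omega)).1
  have hone : (1 : ℝ) ≤ ((i : ℝ) + 1) ^ (1 / (2 * (1 + β))) :=
    Real.one_le_rpow (by linarith [Nat.cast_nonneg (α := ℝ) i]) (by positivity)
  have hc' : (c : ℝ) ≤ 2 := by exact_mod_cast hc
  have h2 : ((c + wins N H i r : ℕ) : ℝ) * Real.exp (-ringTime H i (wins N H i r)) ≤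
      4 * ((i : ℝ) + 1) ^ (1 / (2 * (1 + β))) := by
    -- Origin of the constant `4`: without wins the left side is at most `2`, with one win at most
    -- `3`, and with `k + 1 ≥ 2` wins `c + k + 1 ≤ 4 k`, where `hi` bounds `k` times the
    -- exponential.
    rcases hw : wins N H i r with _ | k
    · simp only [ringTime, Finset.range_zero, Finset.sum_empty, neg_zero, Real.exp_zero, add_zero,
        mul_one]
      linarith
    · have h3 := hi k
      have h4 : Real.exp (-ringTime H i (k + 1)) ≤ 1 := by
        rw [Real.exp_le_one_iff, neg_nonpos]
        exact Finset.sum_nonneg fun l _ => (h.regular.pos (i, l)).le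
      push_cast
      rcases Nat.eq_zero_or_pos k with rfl | hk
      · have : ((c : ℝ) + (((0 : ℕ) : ℝ) + 1)) * Real.exp (-ringTime H i (0 + 1)) ≤ 3 * 1 := by
          gcongr
          push_cast
          linarith
        exact this.trans (by linarith)
      · have hk' : (1 : ℝ) ≤ k := by exact_mod_cast hk
        calc _ ≤ (4 * k) * Real.exp (-ringTime H i (k + 1)) := by
              gcongr
              linarith
          _ ≤ _ := by linarith
  calc ((c + wins N H i r : ℕ) : ℝ) * Real.exp (-elapsed N H r)
      ≤ ((c + wins N H i r : ℕ) : ℝ) * (Real.exp (-ringTime H i (wins N H i r)) *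
        Real.exp (-elapsed N H (i + 1 - N))) := by
        rw [← Real.exp_add]
        gcongr
        linarith
    _ ≤ _ := by
        rw [← mul_assoc]
        gcongr

/-- Convergence of the normalized maximum, `c i` being the initial degree of row `i`. -/
lemma Typical.tendsto_max (hN : 0 < N) {c : ℕ → ℕ} (hc : ∀ i, c i ≤ 2) :
    (∃ m, ∀ j, rowLimit j H * Real.exp (-elapsed N H (j + 1 - N)) ≤
      rowLimit m H * Real.exp (-elapsed N H (m + 1 - N))) ∧
    Tendsto (fun r => (((Finset.range (r + 1)).sup fun i => c i + wins N H i r : ℕ) : ℝ) /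
      ((r + 1 : ℕ) : ℝ) ^ (1 / (1 + β))) atTop
      (𝓝 (speed β N H ^ (-(1 / (1 + β))) *
        ⨆ i, rowLimit i H * Real.exp (-elapsed N H (i + 1 - N)))) := by
  have hα : 0 < 1 + β := by linarith [hβ.out]
  have hle : ∀ᶠ i in atTop, ∀ r, i ≤ r → ((c i + wins N H i r : ℕ) : ℝ) *
      Real.exp (-elapsed N H r) ≤
      4 * ((i : ℝ) + 1) ^ (1 / (2 * (1 + β))) * Real.exp (-elapsed N H (i + 1 - N)) := by
    filter_upwards [h.wins_mul_le le_rfl hN] with i hi r hir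
    refine le_trans ?_ (hi r hir)
    gcongr
    exact hc i
  obtain ⟨h1, h2⟩ := tendsto_sup_mul (fun r => Real.exp_pos _)
    (fun i => h.tendsto_wins_mul i (c i)) (h.tendsto_birth hN) hle
  refine ⟨h1, ?_⟩
  -- The power `-1/(1+β)` produces `(r + 1)^{-1/(1+β)} e^{T}`, which exchanges the normalization by
  -- `e^{T}` for one by a power of `r + 1`.
  have h4 := h.tendsto_succ_speed.rpow_const (p := -(1 / (1 + β))) (Or.inl h.speed_pos.ne')
  refine (h4.mul h2).congr fun r => ?_
  have hr : (0 : ℝ) < ((r + 1 : ℕ) : ℝ) := by positivity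
  rw [Real.mul_rpow hr.le (Real.exp_nonneg _), ← Real.exp_mul, Real.rpow_neg hr.le,
    show -((1 + β) * elapsed N H r) * -(1 / (1 + β)) = elapsed N H r by field_simp,
    Real.exp_neg]
  have := Real.exp_ne_zero (elapsed N H r)
  field_simp

end

/-! ### Degrees -/

lemma sum_Icc_one_succ {M : Type*} [AddCommMonoid M] (f : ℕ → M) (n : ℕ) :
    ∑ m ∈ Finset.Icc 1 n, f m = ∑ m ∈ Finset.range n, f (m + 1) := by
  induction n with
  | zero => simp
  | succ n ih => rw [Finset.sum_Icc_succ_top (by omega), ih, Finset.sum_range_succ]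

lemma degree_eq {a : ℕ → ℕ} (ha : a 1 = 1) {i r : ℕ} (hi : i ≤ r) :
    degree a (i + 1) (r + 1) =
      start (i + 1) + ((Finset.range r).filter fun l => a (l + 2) = i + 1).card := by
  rw [degree, Finset.sum_add_distrib, Finset.sum_ite_eq' _ (i + 1) (fun _ => 1),
    if_pos (Finset.mem_Icc.mpr ⟨by omega, by omega⟩), sum_Icc_one_succ, Finset.sum_range_succ',
    Finset.card_filter, zero_add, ha, start]
  by_cases h0 : i = 0
  · simp [h0]
    ring
  · simp [h0]

/-- The targets `a 1, ..., a n` are among the nodes that are present. -/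
def Admissible (N : ℕ) (a : ℕ → ℕ) (n : ℕ) : Prop :=
  a 1 = 1 ∧ ∀ m, 1 ≤ m → m < n → 1 ≤ a (m + 1) ∧ a (m + 1) < N + m

/-- Both endpoints of each edge are nodes already present (`N ≤ 2` gives `a m ≤ m`), so the degrees
add up to `2 n`. -/
lemma totalWeight_eq {N : ℕ} (hN : N ≤ 2) {a : ℕ → ℕ} {n : ℕ} (ha : Admissible N a n) (δ : ℝ) :
    totalWeight δ a n = (2 + δ) * n := by
  have h1 : ∑ i ∈ Finset.Icc 1 n, degree a i n = 2 * n := by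
    simp only [degree]
    rw [Finset.sum_comm]
    have : ∀ m ∈ Finset.Icc 1 n, ∑ i ∈ Finset.Icc 1 n,
        ((if m = i then 1 else 0) + if a m = i then 1 else 0) = 2 := by
      intro m hm
      have hm' := Finset.mem_Icc.mp hm
      have ham : a m ∈ Finset.Icc 1 n := by
        rw [Finset.mem_Icc]
        rcases Nat.eq_or_lt_of_le hm'.1 with h | h
        · rw [← h, ha.1]
          omega
        · obtain ⟨k, rfl⟩ := Nat.exists_eq_add_of_le' hm'.1
          have := ha.2 k (by omega) (by omega)
          omega
      rw [Finset.sum_add_distrib, Finset.sum_ite_eq, Finset.sum_ite_eq, if_pos hm, if_pos ham]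
    rw [Finset.sum_congr rfl this]
    simp [mul_comm]
  rw [totalWeight, Finset.sum_add_distrib, ← Nat.cast_sum, h1]
  simp
  ring

/-! ### A common form of the two models -/

/-- The weight of node `v_j` in the choice of a target, given `G(n)`. -/
noncomputable def stepWeight (δ : ℝ) (a : ℕ → ℕ) (n j : ℕ) : ℝ :=
  if j ≤ n then (degree a j n : ℝ) + δ else 1 + δ

/-- Model A for `N = 1`, Model B for `N = 2`. -/
structure IsModel (N : ℕ) {Ω : Type*} [MeasurableSpace Ω] (P : Measure Ω) (δ : ℝ)
    (J : ℕ → Ω → ℕ) : Prop where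
  measurable : ∀ n, 1 ≤ n → Measurable (J n)
  init : ∀ᵐ ω ∂P, J 1 ω = 1
  step : ∀ n, 1 ≤ n → ∀ a : ℕ → ℕ, P (history J a n) ≠ 0 → ∀ j, 1 ≤ j → j < N + n →
    (P[|history J a n]).real {ω | J (n + 1) ω = j} =
      stepWeight δ a n j / (totalWeight δ a n + (N - 1) * (1 + δ))

section

variable {Ω Ω' : Type*} [MeasurableSpace Ω] [MeasurableSpace Ω'] {P : Measure Ω} {P' : Measure Ω'}
  {δ : ℝ} {J : ℕ → Ω → ℕ} {J' : ℕ → Ω' → ℕ}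

lemma isModelA_iff : IsModelA P δ J ↔ IsModel 1 P δ J := by
  have key : ∀ n j : ℕ, ∀ a : ℕ → ℕ, j ≤ n → stepWeight δ a n j / (totalWeight δ a n +
      (((1 : ℕ) : ℝ) - 1) * (1 + δ)) = ((degree a j n : ℝ) + δ) / totalWeight δ a n := by
    intro n j a hj
    simp [stepWeight, hj]
  constructor
  · rintro ⟨h1, h2, h3⟩
    refine ⟨h1, h2, fun n hn a ha j hj hjn => ?_⟩
    rw [key n j a (by omega)]
    exact h3 n hn a ha j hj (by omega)
  · rintro ⟨h1, h2, h3⟩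
    refine ⟨h1, h2, fun n hn a ha j hj hjn => ?_⟩
    rw [← key n j a (by omega)]
    exact h3 n hn a ha j hj (by omega)

lemma isModelB_iff : IsModelB P δ J ↔ IsModel 2 P δ J := by
  have hden : ∀ (n : ℕ) (a : ℕ → ℕ), totalWeight δ a n + (((2 : ℕ) : ℝ) - 1) * (1 + δ) =
      totalWeight δ a n + 1 + δ := by
    intro n a
    push_cast
    ring
  constructor
  · rintro ⟨h1, h2, h3, h4⟩
    refine ⟨h1, h2, fun n hn a ha j hj hjn => ?_⟩
    rw [hden, stepWeight]
    split_ifs with h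
    · exact h3 n hn a ha j hj h
    · obtain rfl : j = n + 1 := by omega
      exact h4 n hn a ha
  · rintro ⟨h1, h2, h3⟩
    refine ⟨h1, h2, fun n hn a ha j hj hjn => ?_, fun n hn a ha => ?_⟩
    · rw [h3 n hn a ha j hj (by omega), hden, stepWeight, if_pos hjn]
    · rw [h3 n hn a ha (n + 1) (by omega) (by omega), hden, stepWeight, if_neg (by omega)]

omit [MeasurableSpace Ω] in
lemma history_succ (J : ℕ → Ω → ℕ) (a : ℕ → ℕ) (n : ℕ) :
    history J a (n + 1) = history J a n ∩ {ω | J (n + 1) ω = a (n + 1)} := by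
  ext ω
  simp only [history, Set.mem_ofPred_eq, Set.mem_inter_iff]
  constructor
  · exact fun h => ⟨fun m h1 h2 => h m h1 (by omega), h (n + 1) (by omega) le_rfl⟩
  · rintro ⟨h1, h2⟩ m hm hmn
    rcases Nat.lt_or_ge n m with h | h
    · obtain rfl : m = n + 1 := by omega
      exact h2
    · exact h1 m hm h

lemma measurableSet_history (hJ : ∀ n, 1 ≤ n → Measurable (J n)) (a : ℕ → ℕ) (n : ℕ) :
    MeasurableSet (history J a n) := by
  induction n with
  | zero =>
    have : history J a 0 = Set.univ := by
      ext ω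
      simp only [history, Set.mem_ofPred_eq, Set.mem_univ, iff_true]
      intro m h1 h2
      omega
    rw [this]
    exact MeasurableSet.univ
  | succ n ih =>
    rw [history_succ]
    exact ih.inter (hJ (n + 1) (by omega) (measurableSet_singleton _))

lemma stepWeight_sum {N : ℕ} (hN1 : 1 ≤ N) (δ : ℝ) (a : ℕ → ℕ) (n : ℕ) :
    ∑ j ∈ Finset.Ico 1 (N + n), stepWeight δ a n j = totalWeight δ a n + (N - 1) * (1 + δ) := by
  rw [← Finset.sum_Ico_consecutive _ (show 1 ≤ n + 1 by omega) (show n + 1 ≤ N + n by omega)]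
  congr 1
  · exact Finset.sum_congr rfl fun j hj => by
      rw [stepWeight, if_pos (by have := (Finset.mem_Ico.mp hj).2; omega)]
  · rw [Finset.sum_congr rfl (g := fun _ => 1 + δ) fun j hj => by
      rw [stepWeight, if_neg (by have := (Finset.mem_Ico.mp hj).1; omega)]]
    rw [Finset.sum_const, Nat.card_Ico, nsmul_eq_mul]
    congr 1
    rw [show N + n - (n + 1) = N - 1 by omega, Nat.cast_sub hN1, Nat.cast_one]

lemma measure_history_succ [IsProbabilityMeasure P] (hJ : ∀ n, 1 ≤ n → Measurable (J n))
    (a : ℕ → ℕ) (n : ℕ) : P (history J a (n + 1)) =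
      P (history J a n) * (P[|history J a n]) {ω | J (n + 1) ω = a (n + 1)} := by
  rw [history_succ, mul_comm, cond_mul_eq_inter (measurableSet_history hJ a n)]

lemma measure_history_one [IsProbabilityMeasure P] (hJ : ∀ᵐ ω ∂P, J 1 ω = 1) {a : ℕ → ℕ}
    (h1 : a 1 = 1) : P (history J a 1) = 1 := by
  have hae : ∀ᵐ ω ∂P, ω ∈ history J a 1 := by
    filter_upwards [hJ] with ω hω m h2 h3
    obtain rfl : m = 1 := by omega
    rw [hω, h1]
  exact (measure_congr (eventuallyEq_univ.mpr (show history J a 1 ∈ ae P from hae))).trans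
    measure_univ

/-- The step weights of the permitted targets add up to the normalizing constant (`stepWeight_sum`),
so all other targets have conditional probability zero without this being part of the model. -/
lemma IsModel.admissible [IsProbabilityMeasure P] {N : ℕ} (hN1 : 1 ≤ N) (hN2 : N ≤ 2)
    (hδ : -1 < δ) (h : IsModel N P δ J) (a : ℕ → ℕ) {n : ℕ} (hn : 1 ≤ n)
    (h0 : P (history J a n) ≠ 0) : Admissible N a n := by
  induction n, hn using Nat.le_induction with
  | base =>
    refine ⟨?_, fun m h1 h2 => by omega⟩
    by_contra hne
    refine h0 (measure_mono_null (t := {ω | ¬ J 1 ω = 1}) (fun ω hω => ?_) h.init)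
    have : J 1 ω = a 1 := hω 1 le_rfl le_rfl
    simpa [this] using hne
  | succ n hn ih =>
    rw [measure_history_succ h.measurable] at h0
    obtain ⟨hh, hc⟩ := mul_ne_zero_iff.mp h0
    have ha := ih hh
    refine ⟨ha.1, fun m h1 h2 => ?_⟩
    rcases Nat.lt_or_ge m n with hm | hm
    · exact ha.2 m h1 hm
    · obtain rfl : m = n := by omega
      by_contra hbad
      have hprob : IsProbabilityMeasure (P[|history J a m]) := cond_isProbabilityMeasure hh
      have hJm := h.measurable (m + 1) (by omega)
      have hden : 0 < totalWeight δ a m + (N - 1) * (1 + δ) := by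
        rw [totalWeight_eq hN2 ha]
        have h3 : (0 : ℝ) < m := by exact_mod_cast hn
        have h4 : (0 : ℝ) ≤ (N : ℝ) - 1 := by
          have : (1 : ℝ) ≤ N := by exact_mod_cast hN1
          linarith
        have h5 : 0 < (2 + δ) * m := mul_pos (by linarith) h3
        have h6 : 0 ≤ ((N : ℝ) - 1) * (1 + δ) := mul_nonneg h4 (by linarith)
        linarith
      have hU : (P[|history J a m]).real
          (⋃ j ∈ Finset.Ico 1 (N + m), {ω | J (m + 1) ω = j}) = 1 := by
        rw [measureReal_biUnion_finset]
        · rw [Finset.sum_congr rfl fun j hj => h.step m hn a hh j (Finset.mem_Ico.mp hj).1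
            (Finset.mem_Ico.mp hj).2, ← Finset.sum_div, stepWeight_sum hN1, div_self hden.ne']
        · exact fun i _ j _ hij => Set.disjoint_left.mpr fun ω hi hj =>
            hij (show i = j from (show J (m + 1) ω = i from hi).symm.trans hj)
        · exact fun j _ => hJm (measurableSet_singleton j)
      have hU' : (P[|history J a m])
          (⋃ j ∈ Finset.Ico 1 (N + m), {ω | J (m + 1) ω = j}) = 1 := by
        rw [← ofReal_measureReal (measure_ne_top _ _), hU, ENNReal.ofReal_one]
      have hnull := (prob_compl_eq_zero_iff (Finset.measurableSet_biUnion _ fun j _ =>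
        hJm (measurableSet_singleton j))).mpr hU'
      refine hc (measure_mono_null (fun ω hω => ?_) hnull)
      have hω' : J (m + 1) ω = a (m + 1) := hω
      simp only [Set.mem_compl_iff, Set.mem_iUnion, Finset.mem_Ico, not_exists]
      intro j hj hj'
      have : J (m + 1) ω = j := hj'
      exact hbad ⟨by omega, by omega⟩

/-- The model determines the probabilities of the graphs. -/
lemma IsModel.measure_history_eq [IsProbabilityMeasure P] [IsProbabilityMeasure P'] {N : ℕ}
    (hN1 : 1 ≤ N) (hN2 : N ≤ 2) (hδ : -1 < δ) (h : IsModel N P δ J) (h' : IsModel N P' δ J')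
    (a : ℕ → ℕ) {n : ℕ} (hn : 1 ≤ n) : P (history J a n) = P' (history J' a n) := by
  induction n, hn using Nat.le_induction with
  | base =>
    by_cases h1 : a 1 = 1
    · rw [measure_history_one h.init h1, measure_history_one h'.init h1]
    · have h2 : P (history J a 1) = 0 := by
        by_contra h0
        exact h1 (h.admissible hN1 hN2 hδ a le_rfl h0).1
      have h3 : P' (history J' a 1) = 0 := by
        by_contra h0
        exact h1 (h'.admissible hN1 hN2 hδ a le_rfl h0).1
      rw [h2, h3]
  | succ n hn ih =>
    by_cases h0 : P (history J a n) = 0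
    · rw [measure_history_succ h.measurable, measure_history_succ h'.measurable, ← ih, h0, zero_mul,
        zero_mul]
    · by_cases hj : 1 ≤ a (n + 1) ∧ a (n + 1) < N + n
      · have h1 := h.step n hn a h0 (a (n + 1)) hj.1 hj.2
        have h2 := h'.step n hn a (ih ▸ h0) (a (n + 1)) hj.1 hj.2
        have hp : IsProbabilityMeasure (P[|history J a n]) := cond_isProbabilityMeasure h0
        have hp' : IsProbabilityMeasure (P'[|history J' a n]) :=
          cond_isProbabilityMeasure (ih ▸ h0)
        rw [measure_history_succ h.measurable, measure_history_succ h'.measurable, ← ih,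
          ← ofReal_measureReal (μ := P[|history J a n]),
          ← ofReal_measureReal (μ := P'[|history J' a n]), h1, h2]
      · have h2 : P (history J a (n + 1)) = 0 := by
          by_contra h0
          exact hj ((h.admissible hN1 hN2 hδ a (by omega) h0).2 n hn (by omega))
        have h3 : P' (history J' a (n + 1)) = 0 := by
          by_contra h0
          exact hj ((h'.admissible hN1 hN2 hδ a (by omega) h0).2 n hn (by omega))
        rw [h2, h3]

end

/-! ### The law of a graph process -/

section

variable {Ω Ω' : Type*} [MeasurableSpace Ω] [MeasurableSpace Ω'] {P : Measure Ω} {P' : Measure Ω'}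
  {δ : ℝ} {J : ℕ → Ω → ℕ} {J' : ℕ → Ω' → ℕ}

lemma measurableSet_segment (a : ℕ → ℕ) (n : ℕ) :
    MeasurableSet {x : ℕ → ℕ | ∀ m < n, x m = a m} := by
  have : {x : ℕ → ℕ | ∀ m < n, x m = a m} =
      ⋂ m ∈ Finset.range n, (fun x : ℕ → ℕ => x m) ⁻¹' {a m} := by
    ext
    simp
  rw [this]
  exact Finset.measurableSet_biInter _ fun m _ =>
    measurable_pi_apply m (measurableSet_singleton _)

/-- Two laws on sequences agree if they agree on all nonempty initial segments. -/
lemma measure_ext_of_segments {μ ν : Measure (ℕ → ℕ)} [IsProbabilityMeasure μ]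
    [IsProbabilityMeasure ν] (h : ∀ (a : ℕ → ℕ) (n : ℕ), 1 ≤ n →
      μ {x | ∀ m < n, x m = a m} = ν {x | ∀ m < n, x m = a m}) : μ = ν := by
  set C : Set (Set (ℕ → ℕ)) :=
    {s | ∃ (a : ℕ → ℕ) (n : ℕ), 1 ≤ n ∧ s = {x | ∀ m < n, x m = a m}} with hC
  refine ext_of_generate_finite C ?_ ?_ ?_ (by simp)
  · refine le_antisymm ?_ (MeasurableSpace.generateFrom_le ?_)
    · refine iSup_le fun n => ?_
      rintro s ⟨t, -, rfl⟩
      have hset : (fun x : ℕ → ℕ => x n) ⁻¹' t = ⋃ b : {b : Fin (n + 1) → ℕ // b (Fin.last n) ∈ t},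
          {x | ∀ m < n + 1, x m = if hm : m < n + 1 then b.1 ⟨m, hm⟩ else 0} := by
        ext x
        simp only [Set.mem_preimage, Set.mem_iUnion, Set.mem_ofPred_eq]
        constructor
        · intro hx
          refine ⟨⟨fun m => x m, hx⟩, fun m hm => by simp [hm]⟩
        · rintro ⟨⟨b, hb⟩, hx⟩
          have := hx n n.lt_succ_self
          rw [dif_pos n.lt_succ_self] at this
          rw [this]
          exact hb
      rw [hset]
      exact MeasurableSet.iUnion fun b => MeasurableSpace.measurableSet_generateFrom ⟨_, _, by omega, rfl⟩
    · rintro s ⟨a, n, -, rfl⟩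
      exact measurableSet_segment a n
  · rintro s ⟨a, n, hn, rfl⟩ t ⟨b, k, -, rfl⟩ ⟨z, hz1, hz2⟩
    refine ⟨z, max n k, le_max_of_le_left hn, ?_⟩
    ext x
    simp only [Set.mem_inter_iff, Set.mem_ofPred_eq, lt_max_iff] at hz1 hz2 ⊢
    constructor
    · rintro ⟨h1, h2⟩ m (hm | hm)
      · rw [h1 m hm, hz1 m hm]
      · rw [h2 m hm, hz2 m hm]
    · exact fun h' => ⟨fun m hm => (h' m (Or.inl hm)).trans (hz1 m hm),
        fun m hm => (h' m (Or.inr hm)).trans (hz2 m hm)⟩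
  · rintro s ⟨a, n, hn, rfl⟩
    exact h a n hn

/-- The sequence of targets, from the first edge on. -/
def targetSeq (J : ℕ → Ω → ℕ) (ω : Ω) (n : ℕ) : ℕ := J (n + 1) ω

lemma measurable_targetSeq (hJ : ∀ n, 1 ≤ n → Measurable (J n)) : Measurable (targetSeq J) :=
  measurable_pi_lambda _ fun n => hJ (n + 1) (by omega)

omit [MeasurableSpace Ω] in
lemma preimage_targetSeq (J : ℕ → Ω → ℕ) (a : ℕ → ℕ) (n : ℕ) :
    targetSeq J ⁻¹' {x | ∀ m < n, x m = a m} = history J (fun m => a (m - 1)) n := by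
  ext ω
  simp only [Set.mem_preimage, Set.mem_ofPred_eq, targetSeq, history]
  constructor
  · intro h m h1 h2
    obtain ⟨m, rfl⟩ := Nat.exists_eq_add_of_le' h1
    exact h m (by omega)
  · intro h m hm
    exact h (m + 1) (by omega) (by omega)

/-- All graph processes of a model have the same law. -/
lemma IsModel.map_targetSeq_eq [IsProbabilityMeasure P] [IsProbabilityMeasure P'] {N : ℕ}
    (hN1 : 1 ≤ N) (hN2 : N ≤ 2) (hδ : -1 < δ) (h : IsModel N P δ J) (h' : IsModel N P' δ J') :
    P.map (targetSeq J) = P'.map (targetSeq J') := by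
  have hm := measurable_targetSeq h.measurable
  have hm' := measurable_targetSeq h'.measurable
  have := Measure.isProbabilityMeasure_map (μ := P) hm.aemeasurable
  have := Measure.isProbabilityMeasure_map (μ := P') hm'.aemeasurable
  refine measure_ext_of_segments fun a n hn => ?_
  have hseg := measurableSet_segment a n
  rw [Measure.map_apply hm hseg, Measure.map_apply hm' hseg, preimage_targetSeq, preimage_targetSeq]
  exact h.measure_history_eq hN1 hN2 hδ h' _ hn

/-- The normalized maximal degree as a function of the sequence of targets. -/
noncomputable def normMaxDegreeSeq (δ : ℝ) (n : ℕ) (x : ℕ → ℕ) : ℝ :=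
  normMaxDegree δ (fun m x => x (m - 1)) n x

lemma degree_congr {a b : ℕ → ℕ} {n : ℕ} (h : ∀ m, 1 ≤ m → m ≤ n → a m = b m) (i : ℕ) :
    degree a i n = degree b i n :=
  Finset.sum_congr rfl fun m hm => by
    rw [h m (Finset.mem_Icc.mp hm).1 (Finset.mem_Icc.mp hm).2]

omit [MeasurableSpace Ω] in
lemma normMaxDegreeSeq_targetSeq (δ : ℝ) (J : ℕ → Ω → ℕ) (n : ℕ) (ω : Ω) :
    normMaxDegreeSeq δ n (targetSeq J ω) = normMaxDegree δ J n ω := by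
  have h : ∀ i, degree (fun m => targetSeq J ω (m - 1)) i n = degree (fun m => J m ω) i n := by
    refine degree_congr fun m hm _ => ?_
    rw [targetSeq, Nat.sub_add_cancel hm]
  simp only [normMaxDegreeSeq, normMaxDegree, maxDegree, h]

lemma measurable_normMaxDegreeSeq (δ : ℝ) (n : ℕ) : Measurable (normMaxDegreeSeq δ n) := by
  have h1 : ∀ i, Measurable fun x : ℕ → ℕ => degree (fun m => x (m - 1)) i n := fun i => by
    refine Finset.measurable_sum _ fun m _ => measurable_const.add ?_
    exact (measurable_of_countable fun k : ℕ => if k = i then 1 else 0).comp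
      (measurable_pi_apply (m - 1))
  have h2 : Measurable fun x : ℕ → ℕ => maxDegree (fun m => x (m - 1)) n := by
    have h3 : ∀ s : Finset ℕ, Measurable fun x : ℕ → ℕ =>
        s.sup fun i => degree (fun m => x (m - 1)) i n := fun s => by
      induction s using Finset.induction_on with
      | empty => simp
      | insert i s _ ih =>
        simp only [Finset.sup_insert]
        exact (h1 i).sup ih
    exact h3 _
  exact ((measurable_of_countable fun k : ℕ => (k : ℝ)).comp h2).div_const _

lemma IsModel.measurable_normMaxDegree {N : ℕ} (h : IsModel N P δ J) (n : ℕ) :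
    Measurable (normMaxDegree δ J n) := by
  rw [← show normMaxDegreeSeq δ n ∘ targetSeq J = normMaxDegree δ J n from
    funext fun ω => normMaxDegreeSeq_targetSeq δ J n ω]
  exact (measurable_normMaxDegreeSeq δ n).comp (measurable_targetSeq h.measurable)

/-- Almost sure convergence for one graph process entails convergence for all of them, with limits
of the same law. -/
lemma IsModel.exists_limit [IsProbabilityMeasure P] [IsProbabilityMeasure P'] {N : ℕ}
    (hN1 : 1 ≤ N) (hN2 : N ≤ 2) (hδ : -1 < δ) (h : IsModel N P δ J) (h' : IsModel N P' δ J')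
    {X : Ω → ℝ} (hX : ∀ᵐ ω ∂P, Tendsto (fun n => normMaxDegree δ J n ω) atTop (𝓝 (X ω))) :
    ∃ L : Ω' → ℝ, IdentDistrib L X P' P ∧ TendstoInMeasure P' (normMaxDegree δ J') atTop L := by
  have hm := measurable_targetSeq h.measurable
  have hm' := measurable_targetSeq h'.measurable
  have hlaw := h.map_targetSeq_eq hN1 hN2 hδ h'
  -- The limit becomes a measurable function of the target sequence alone, so it makes sense on any
  -- probability space and equality of laws carries it over.
  set Φ : (ℕ → ℕ) → ℝ := fun x => limsup (fun n => normMaxDegreeSeq δ n x) atTop with hΦ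
  have hΦm : Measurable Φ := Measurable.limsup fun n => measurable_normMaxDegreeSeq δ n
  have hXΦ : ∀ᵐ ω ∂P, Φ (targetSeq J ω) = X ω := by
    filter_upwards [hX] with ω hω
    simp only [hΦ, normMaxDegreeSeq_targetSeq]
    exact hω.limsup_eq
  have hS : MeasurableSet {x | Tendsto (fun n => normMaxDegreeSeq δ n x) atTop (𝓝 (Φ x))} :=
    measurableSet_tendsto_fun (fun n => measurable_normMaxDegreeSeq δ n) hΦm
  have hae : ∀ᵐ x ∂P.map (targetSeq J),
      Tendsto (fun n => normMaxDegreeSeq δ n x) atTop (𝓝 (Φ x)) := by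
    rw [ae_map_iff hm.aemeasurable hS]
    filter_upwards [hX, hXΦ] with ω h1 h2
    rw [h2]
    simpa only [normMaxDegreeSeq_targetSeq] using h1
  rw [hlaw, ae_map_iff hm'.aemeasurable hS] at hae
  simp only [normMaxDegreeSeq_targetSeq] at hae
  refine ⟨Φ ∘ targetSeq J', ⟨(hΦm.comp hm').aemeasurable,
    ⟨Φ ∘ targetSeq J, hΦm.comp hm, hXΦ.mono fun ω h => h.symm⟩, ?_⟩, ?_⟩
  · rw [← Measure.map_map hΦm hm', ← hlaw, Measure.map_map hΦm hm]
    exact Measure.map_congr hXΦ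
  · exact tendstoInMeasure_of_tendsto_ae
      (fun n => (h'.measurable_normMaxDegree n).aestronglyMeasurable) hae

end

/-! ### The embedded graph process -/

/-- The targets of the graph process embedded in the clocks; the winner of competition `r` is the
target of node `v_(r+2)`. -/
noncomputable def embedTarget (N : ℕ) (n : ℕ) (H : Clocks) : ℕ :=
  if n ≤ 1 then 1 else target N (n - 2) H + 1

lemma embedTarget_one (N : ℕ) (H : Clocks) : embedTarget N 1 H = 1 := rfl

lemma embedTarget_add_two (N r : ℕ) (H : Clocks) : embedTarget N (r + 2) H = target N r H + 1 := by
  rw [embedTarget, if_neg (by omega)]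
  rfl

lemma measurable_embedTarget (N n : ℕ) : Measurable (embedTarget N n) := by
  unfold embedTarget
  split_ifs
  · exact measurable_const
  · exact (measurable_target N (n - 2)).add_const 1

lemma degree_embedTarget (N : ℕ) (H : Clocks) {i r : ℕ} (hi : i ≤ r) :
    degree (fun m => embedTarget N m H) (i + 1) (r + 1) = start (i + 1) + wins N H i r := by
  rw [degree_eq (embedTarget_one N H) hi, wins]
  congr 2
  ext l
  simp [embedTarget_add_two]

lemma maxDegree_embedTarget (N : ℕ) (H : Clocks) (r : ℕ) :
    maxDegree (fun m => embedTarget N m H) (r + 1) =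
      (Finset.range (r + 1)).sup fun i => start (i + 1) + wins N H i r := by
  rw [maxDegree]
  have himg : Finset.Icc 1 (r + 1) = (Finset.range (r + 1)).image (· + 1) := by
    ext m
    simp only [Finset.mem_Icc, Finset.mem_image, Finset.mem_range]
    constructor
    · rintro ⟨h1, h2⟩
      exact ⟨m - 1, by omega, by omega⟩
    · rintro ⟨k, h1, rfl⟩
      omega
  rw [himg, Finset.sup_image]
  exact Finset.sup_congr rfl fun i hi => degree_embedTarget N H (by
    have := Finset.mem_range.mp hi
    omega)

/-- The initial states of the rows. -/
def initialState (i : ℕ) : ℕ := if i = 0 then 1 else 0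

lemma start_succ (i : ℕ) : start (i + 1) = initialState i + 1 := by
  by_cases h : i = 0 <;> simp [start, initialState, h]

lemma initialState_eq_zero {i : ℕ} (hi : 1 ≤ i) : initialState i = 0 := if_neg (by omega)

variable {β : ℝ} [hβ : Fact (0 < β)]

omit hβ in
lemma totalRate_initialState {N : ℕ} (hN : 1 ≤ N) : totalRate β N initialState = 1 + N * β := by
  rw [totalRate, Finset.sum_add_distrib, ← Nat.cast_sum]
  have : ∑ i ∈ Finset.range N, initialState i = 1 := by
    simp only [initialState]
    rw [Finset.sum_ite_eq' _ 0 (fun _ => 1), if_pos (Finset.mem_range.mpr (by omega))]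
  rw [this]
  simp

section

variable {Ω : Type*} [MeasurableSpace Ω] {P : Measure Ω} [IsProbabilityMeasure P]
  {𝓗 : Ω → Clocks} (h𝓗 : Measurable 𝓗) (hlaw : P.map 𝓗 = clockMeasure β initialState)
include h𝓗 hlaw

omit [IsProbabilityMeasure P] in
lemma measure_history_embedTarget {N r : ℕ} {a : ℕ → ℕ} (ha : Admissible N a (r + 1)) (hN : 1 ≤ N) :
    P (history (fun n ω => embedTarget N n (𝓗 ω)) a (r + 1)) =
      ∏ m ∈ Finset.range r, ENNReal.ofReal (((initialState (a (m + 2) - 1) : ℝ) +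
        ((Finset.range m).filter fun l => a (l + 2) - 1 = a (m + 2) - 1).card + β) /
          (totalRate β N initialState + m * (1 + β))) := by
  have hset : history (fun n ω => embedTarget N n (𝓗 ω)) a (r + 1) =
      𝓗 ⁻¹' {H | ∀ m < r, target N m H = a (m + 2) - 1} := by
    ext ω
    simp only [history, Set.mem_ofPred_eq, Set.mem_preimage]
    constructor
    · intro h m hm
      have := h (m + 2) (by omega) (by omega)
      rw [embedTarget_add_two] at this
      omega
    · intro h m h1 h2
      rcases Nat.eq_or_lt_of_le h1 with rfl | h3
      · rw [embedTarget_one, ha.1]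
      · obtain ⟨m, rfl⟩ := Nat.exists_eq_add_of_le' (show 2 ≤ m by omega)
        have h4 := h m (by omega)
        have h5 : 1 ≤ a (m + 2) := (ha.2 (m + 1) (by omega) (by omega)).1
        rw [embedTarget_add_two, h4]
        omega
  have hS : MeasurableSet {H | ∀ m < r, target N m H = a (m + 2) - 1} := by
    have : {H | ∀ m < r, target N m H = a (m + 2) - 1} =
        ⋂ m ∈ Finset.range r, target N m ⁻¹' {a (m + 2) - 1} := by
      ext
      simp
    rw [this]
    exact Finset.measurableSet_biInter _ fun m _ => measurable_target _ _ (measurableSet_singleton _)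
  rw [hset, ← Measure.map_apply h𝓗 hS, hlaw]
  exact measure_target (by omega) (fun i hi => initialState_eq_zero (by omega)) r fun m hm => by
    have : 1 ≤ a (m + 2) ∧ a (m + 2) < N + (m + 1) := ha.2 (m + 1) (by omega) (by omega)
    omega

/-- The graph process embedded in independent clocks is a preferential attachment graph. -/
theorem isModel_embedTarget {N : ℕ} (hN1 : 1 ≤ N) (hN2 : N ≤ 2) {δ : ℝ} (hβδ : β = 1 + δ) :
    IsModel N P δ fun n ω => embedTarget N n (𝓗 ω) := by
  have hβ0 := hβ.out
  have hmeas : ∀ n, Measurable fun ω => embedTarget N n (𝓗 ω) := fun n =>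
    (measurable_embedTarget N n).comp h𝓗
  refine ⟨fun n _ => hmeas n, Eventually.of_forall fun ω => rfl, fun n hn a h0 j hj hjn => ?_⟩
  obtain ⟨r, rfl⟩ := Nat.exists_eq_add_of_le' hn
  -- A history of positive probability contains a regular array, and there each winner is an active
  -- row.
  have hadm : Admissible N a (r + 1) := by
    have hreg : ∀ᵐ ω ∂P, Regular N (𝓗 ω) := by
      have := ae_regular (β := β) (N := N) (by omega) initialState
      rw [← hlaw] at this
      exact ae_of_ae_map h𝓗.aemeasurable this
    obtain ⟨ω, hω, hω'⟩ : ∃ ω, ω ∈ history (fun n ω => embedTarget N n (𝓗 ω)) a (r + 1) ∧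
        Regular N (𝓗 ω) := by
      by_contra hne
      refine h0 (measure_mono_null (fun ω hω => ?_) hreg)
      exact fun hR => hne ⟨ω, hω, hR⟩
    refine ⟨(hω 1 le_rfl hn).symm, fun m h1 h2 => ?_⟩
    obtain ⟨m, rfl⟩ := Nat.exists_eq_add_of_le' h1
    have h3 : embedTarget N (m + 2) (𝓗 ω) = a (m + 2) := hω (m + 2) (by omega) (by omega)
    rw [embedTarget_add_two] at h3
    have h4 := (hω'.wins_target m).1
    change 1 ≤ a (m + 2) ∧ a (m + 2) < N + (m + 1)
    omega
  -- The conditional probability is the quotient of the probabilities of two histories, that of `a`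
  -- and that of its prolongation by the target `j`.
  set b : ℕ → ℕ := Function.update a (r + 2) j with hb
  have hba : ∀ m, m ≤ r + 1 → b m = a m := fun m hm => Function.update_of_ne (by omega) _ _
  have hbj : b (r + 2) = j := Function.update_self _ _ _
  have hbadm : Admissible N b (r + 2) := by
    refine ⟨by rw [hba 1 (by omega), hadm.1], fun m h1 h2 => ?_⟩
    rcases Nat.lt_or_ge m (r + 1) with hm | hm
    · rw [hba (m + 1) (by omega)]
      exact hadm.2 m h1 hm
    · obtain rfl : m = r + 1 := by omega
      rw [hbj]
      exact ⟨hj, hjn⟩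
  have hinter : history (fun n ω => embedTarget N n (𝓗 ω)) a (r + 1) ∩
      {ω | embedTarget N (r + 1 + 1) (𝓗 ω) = j} =
      history (fun n ω => embedTarget N n (𝓗 ω)) b (r + 2) := by
    rw [history_succ _ b, hbj]
    congr 1
    ext ω
    simp only [history, Set.mem_ofPred_eq]
    exact forall_congr' fun m => imp_congr_right fun _ => imp_congr_right fun hm => by rw [hba m hm]
  have h1 := measure_history_embedTarget h𝓗 hlaw hadm hN1
  have h2 := measure_history_embedTarget h𝓗 hlaw hbadm hN1
  rw [Finset.prod_range_succ] at h2
  have hprod : ∀ m ∈ Finset.range r, ENNReal.ofReal (((initialState (b (m + 2) - 1) : ℝ) +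
        ((Finset.range m).filter fun l => b (l + 2) - 1 = b (m + 2) - 1).card + β) /
          (totalRate β N initialState + m * (1 + β))) =
      ENNReal.ofReal (((initialState (a (m + 2) - 1) : ℝ) +
        ((Finset.range m).filter fun l => a (l + 2) - 1 = a (m + 2) - 1).card + β) /
          (totalRate β N initialState + m * (1 + β))) := by
    intro m hm
    have hm' := Finset.mem_range.mp hm
    rw [hba (m + 2) (by omega)]
    congr 6
    refine Finset.filter_congr fun l hl => ?_
    rw [hba (l + 2) (by have := Finset.mem_range.mp hl; omega)]
  rw [Finset.prod_congr rfl hprod, ← h1, hbj] at h2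
  have hfilter : ((Finset.range r).filter fun l => b (l + 2) - 1 = j - 1) =
      (Finset.range r).filter fun l => a (l + 2) = j := by
    refine Finset.filter_congr fun l hl => ?_
    have hl' := Finset.mem_range.mp hl
    rw [hba (l + 2) (by omega)]
    have : 1 ≤ a (l + 2) := (hadm.2 (l + 1) (by omega) (by omega)).1
    omega
  rw [hfilter] at h2
  have hnum : (initialState (j - 1) : ℝ) + ((Finset.range r).filter fun l => a (l + 2) = j).card + β =
      stepWeight δ a (r + 1) j := by
    obtain ⟨i, rfl⟩ := Nat.exists_eq_add_of_le' hj
    rw [stepWeight, Nat.add_sub_cancel]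
    split_ifs with hi
    · rw [degree_eq hadm.1 (by omega), start_succ, hβδ]
      push_cast
      ring
    -- The self loop of Model B: the target is the new node, which no earlier edge can have reached.
    · have hcard : ((Finset.range r).filter fun l => a (l + 2) = i + 1).card = 0 := by
        rw [Finset.card_eq_zero, Finset.filter_eq_empty_iff]
        intro l hl
        have hl' := Finset.mem_range.mp hl
        have : a (l + 2) < N + (l + 1) := (hadm.2 (l + 1) (by omega) (by omega)).2
        omega
      rw [hcard, initialState_eq_zero (by omega), hβδ]
      simp
  have hden : totalRate β N initialState + r * (1 + β) =
      totalWeight δ a (r + 1) + (N - 1) * (1 + δ) := by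
    rw [totalRate_initialState hN1, totalWeight_eq hN2 hadm, hβδ]
    push_cast
    ring
  have hnum0 : 0 ≤ (initialState (j - 1) : ℝ) +
      ((Finset.range r).filter fun l => a (l + 2) = j).card + β := by positivity
  have hden0 : 0 ≤ totalRate β N initialState + r * (1 + β) := by
    have := totalRate_pos (β := β) (N := N) (by omega) initialState
    positivity
  have hpos : (P (history (fun n ω => embedTarget N n (𝓗 ω)) a (r + 1))).toReal ≠ 0 :=
    ENNReal.toReal_ne_zero.mpr ⟨h0, measure_ne_top _ _⟩
  rw [measureReal_def, cond_apply (measurableSet_history (fun n _ => hmeas n) a (r + 1)), hinter, h2,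
    ENNReal.toReal_mul, ENNReal.toReal_inv, ENNReal.toReal_mul,
    ENNReal.toReal_ofReal (div_nonneg hnum0 hden0), inv_mul_cancel_left₀ hpos, hnum, hden]

end

/-! ### Locality of the chain -/

/-- The arrays agree in the rows `0, ..., M - 1`. -/
def AgreeBelow (M : ℕ) (H H' : Clocks) : Prop := ∀ p : ℕ × ℕ, p.1 < M → H p = H' p

lemma AgreeBelow.winner_eq {M N : ℕ} {H H' : Clocks} (h : AgreeBelow M H H') (hN : N ≤ M) :
    winner N H = winner N H' := by
  have hw : ∀ j, Wins N j H ↔ Wins N j H' := by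
    intro j
    refine and_congr_right fun hj => forall_congr' fun i => imp_congr_right fun hi => ?_
    rw [h (j, 0) (hj.trans_le hN), h (i, 0) (hi.trans_le hN)]
  by_cases hex : ∃ j, Wins N j H
  · obtain ⟨j, hj⟩ := hex
    rw [hj.winner_eq, ((hw j).mp hj).winner_eq]
  · have hex' : ¬ ∃ j, Wins N j H' := fun ⟨j, hj⟩ => hex ⟨j, (hw j).mpr hj⟩
    rw [winner, winner, dif_neg hex, dif_neg hex']

lemma winner_lt {N : ℕ} (hN : 0 < N) (H : Clocks) : winner N H < N := by
  by_cases h : ∃ j, Wins N j H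
  · exact (wins_winner h).1
  · rw [winner, dif_neg h]
    exact hN

lemma AgreeBelow.nextClocks {M N : ℕ} {H H' : Clocks} (h : AgreeBelow M H H') (hN0 : 0 < N)
    (hN : N ≤ M) : AgreeBelow M (nextClocks N H) (nextClocks N H') := by
  intro p hp
  have hw : winner N H' < M := (winner_lt hN0 H').trans_le hN
  simp only [PrefAttach.nextClocks, advance]
  rw [h.winner_eq hN, h _ hp, h (winner N H', _) hw, h (winner N H', _) hw]

lemma AgreeBelow.chain {M N r : ℕ} {H H' : Clocks} (h : AgreeBelow M H H') (hN0 : 0 < N)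
    (hr : N + r ≤ M + 1) : AgreeBelow M (chain N r H) (chain N r H') := by
  induction r with
  | zero => exact h
  | succ r ih =>
    rw [chain_succ, chain_succ]
    exact (ih (by omega)).nextClocks (by omega) (by omega)

/-- The competitions before `r` involve at most `N + r - 1 ≤ M` rows, so later rows cannot influence
the time. -/
lemma AgreeBelow.elapsed_eq {M N r : ℕ} {H H' : Clocks} (h : AgreeBelow M H H') (hN0 : 0 < N)
    (hr : N + r ≤ M + 1) : elapsed N H r = elapsed N H' r := by
  refine Finset.sum_congr rfl fun m hm => ?_
  have hm' := Finset.mem_range.mp hm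
  have hc := h.chain (r := m) hN0 (by omega)
  rw [gap, gap, firstGap, firstGap, hc.winner_eq (by omega)]
  exact hc _ ((winner_lt (by omega) _).trans_le (by omega))

lemma measurable_elapsed (N r : ℕ) : Measurable fun H => elapsed N H r :=
  Finset.measurable_sum _ fun m _ => measurable_gap N m

section

variable {β : ℝ} [hβ : Fact (0 < β)]

/-- The limit of a row is independent of its time of birth. -/
lemma indepFun_rowLimit_elapsed (d : ℕ → ℕ) {N : ℕ} (hN : 0 < N) (i : ℕ) :
    IndepFun (rowLimit i) (fun H => elapsed N H (i + 1 - N)) (clockMeasure β d) := by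
  have hrow := iIndepFun_row (β := β) d
  have h := hrow.indepFun_finset {i} (Finset.range i) (by simp)
    (fun j => measurable_pi_lambda _ fun k => measurable_pi_apply _)
  set φ : ((({i} : Finset ℕ)) → ℕ → ℝ) → ℝ := fun R =>
    growthLimit (R ⟨i, Finset.mem_singleton_self i⟩) with hφ
  -- Rows from `i` on are filled with zeros; by locality this does not affect the birth time of row
  -- `i`, which thereby becomes a function of the earlier rows.
  set extendZero : ((Finset.range i) → ℕ → ℝ) → Clocks := fun R p =>
    if hp : p.1 ∈ Finset.range i then R ⟨p.1, hp⟩ p.2 else 0 with hext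
  have hmeas_ext : Measurable extendZero := measurable_pi_lambda _ fun p => by
    simp only [hext]
    split_ifs
    · exact (measurable_pi_apply p.2).comp (measurable_pi_apply _)
    · exact measurable_const
  have h2 := h.comp (φ := φ) (ψ := fun R => elapsed N (extendZero R) (i + 1 - N))
    (measurable_growthLimit.comp (measurable_pi_apply _)) ((measurable_elapsed N _).comp hmeas_ext)
  have heq : (fun H : Clocks => elapsed N H (i + 1 - N)) =
      (fun R => elapsed N (extendZero R) (i + 1 - N)) ∘
        fun (H : Clocks) (j : Finset.range i) (k : ℕ) => H (j, k) := by
    funext H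
    by_cases hi : N ≤ i
    · refine AgreeBelow.elapsed_eq (M := i) (fun p hp => ?_) hN (by omega)
      simp [hext, hp]
    · have : i + 1 - N = 0 := by omega
      simp [this, elapsed]
  rw [heq]
  exact h2

end

section Transfer

variable {Ω X ι : Type*} [MeasurableSpace Ω] [MeasurableSpace X] {P : Measure Ω}
  {F : Ω → X} {μ : Measure X}

lemma indepFun_comp_of_map {Y Z : Type*} [MeasurableSpace Y] [MeasurableSpace Z] {f : X → Y}
    {g : X → Z} (hF : Measurable F) (hlaw : P.map F = μ) (hf : Measurable f) (hg : Measurable g)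
    (h : IndepFun f g μ) : IndepFun (f ∘ F) (g ∘ F) P := by
  rw [indepFun_iff_measure_inter_preimage_eq_mul] at h ⊢
  intro s t hs ht
  rw [Set.preimage_comp, Set.preimage_comp, ← Set.preimage_inter, ← Measure.map_apply hF (hf hs),
    ← Measure.map_apply hF (hg ht), ← Measure.map_apply hF ((hf hs).inter (hg ht)), hlaw]
  exact h s t hs ht

lemma iIndepFun_comp_of_map {f : ι → X → ℝ} (hF : Measurable F) (hlaw : P.map F = μ)
    (hf : ∀ i, Measurable (f i)) (h : iIndepFun f μ) : iIndepFun (fun i => f i ∘ F) P := by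
  rw [iIndepFun_iff_measure_inter_preimage_eq_mul] at h ⊢
  intro S sets hS
  have h1 := h S hS
  rw [← hlaw, Measure.map_apply hF (Finset.measurableSet_biInter _ fun i hi => hf i (hS i hi))] at h1
  simp only [Set.preimage_iInter] at h1
  simp only [Set.preimage_comp]
  rw [h1]
  exact Finset.prod_congr rfl fun i hi => by rw [Measure.map_apply hF (hf i (hS i hi))]

end Transfer

/-! ### Coupling of the processes with the clocks -/

/-- The array `𝓗` of independent clocks holds the holding times of the processes `BI`. -/
structure Coupled {Ω : Type*} [MeasurableSpace Ω] (P : Measure Ω) (β : ℝ) [Fact (0 < β)]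
    (BI : ℕ → ℝ → Ω → ℕ) (𝓗 : Ω → Clocks) : Prop where
  measurable : Measurable 𝓗
  law : P.map 𝓗 = clockMeasure β initialState
  jump : ∀ᵐ ω ∂P, ∀ i k : ℕ, jumpTime (start (i + 1)) (fun t => BI (i + 1) t ω) k =
    ringTime (𝓗 ω) i k
  path : ∀ᵐ ω ∂P, ∀ (i k : ℕ) (t : ℝ), ringTime (𝓗 ω) i k ≤ t → t < ringTime (𝓗 ω) i (k + 1) →
    BI (i + 1) t ω = start (i + 1) + k

section

variable {Ω : Type*} [MeasurableSpace Ω] {P : Measure Ω} {β δ : ℝ}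
  [hβ : Fact (0 < β)] {BI : ℕ → ℝ → Ω → ℕ} {𝓗 : Ω → Clocks}

/-- The holding times are only almost everywhere measurable, so the array is a measurable version of
them and the path identities hold off a null set. -/
lemma exists_coupled (hβδ : β = 1 + δ) (hBI : IsBIFamily P δ BI) : ∃ 𝓗, Coupled P β BI 𝓗 := by
  set e : ℕ × ℕ → ℕ+ × ℕ := fun p => (p.1.succPNat, p.2) with he
  have hinj : Function.Injective e := fun p q h => by
    simp only [he, Prod.mk.injEq] at h
    exact Prod.ext (Nat.succPNat_injective h.1) h.2
  set h : ℕ × ℕ → Ω → ℝ := fun p ω => holdingTime (start (p.1 + 1)) (fun t => BI (p.1 + 1) t ω) p.2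
    with hh
  have hind : iIndepFun h P := hBI.indep.precomp (g := e) hinj
  have hlaw : ∀ p : ℕ × ℕ, HasLaw (h p) (expMeasure ((initialState p.1 : ℝ) + p.2 + β)) P := by
    intro p
    have h1 := (hBI.process (p.1 + 1) (by omega)).holding_law p.2
    have h2 : ((start (p.1 + 1) + p.2 : ℕ) : ℝ) + δ = (initialState p.1 : ℝ) + p.2 + β := by
      rw [start_succ, hβδ]
      push_cast
      ring
    rw [h2] at h1
    exact h1
  have hall : AEMeasurable (fun ω p => h p ω) P := aemeasurable_pi_lambda _ fun p => (hlaw p).aemeasurable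
  have hmap : P.map (fun ω p => h p ω) = clockMeasure β initialState := by
    rw [clockMeasure_eq]
    exact (hind.hasLaw_infinitePi hlaw hall).map_eq
  have heq : ∀ᵐ ω ∂P, ∀ p, hall.mk _ ω p = h p ω := hall.ae_eq_mk.mono fun ω hω p => by rw [← hω]
  have hsum : ∀ᵐ ω ∂P, ∀ i k : ℕ, jumpTime (start (i + 1)) (fun t => BI (i + 1) t ω) k =
      ringTime (hall.mk _ ω) i k := by
    filter_upwards [heq, ae_all_iff.mpr fun i : ℕ => (hBI.process (i + 1) (by omega)).init]
      with ω h1 h2 i k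
    rw [jumpTime_eq_sum (h2 i), ringTime]
    exact Finset.sum_congr rfl fun l _ => (h1 (i, l)).symm
  have hmkmap : P.map (hall.mk _) = clockMeasure β initialState := by
    rw [← hmap]
    exact Measure.map_congr hall.ae_eq_mk.symm
  have hpos : ∀ᵐ ω ∂P, ∀ p, 0 < hall.mk _ ω p := by
    have := ae_clock_pos (β := β) initialState
    rw [← hmkmap] at this
    exact ae_of_ae_map hall.measurable_mk.aemeasurable this
  refine ⟨hall.mk _, hall.measurable_mk, hmkmap, hsum, ?_⟩
  filter_upwards [heq, hsum, hpos, ae_all_iff.mpr fun i : ℕ => (hBI.process (i + 1) (by omega)).mono,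
    ae_all_iff.mpr fun i : ℕ => (hBI.process (i + 1) (by omega)).rightCont]
    with ω h1 h2 h3 h4 h5 i k t ht1 ht2
  rw [← h2] at ht1 ht2
  exact path_eq (h4 i) (h5 i) (fun l => (h3 (i, l)).trans_eq (h1 (i, l))) ht1 ht2

variable (hC : Coupled P β BI 𝓗)
include hC

lemma Coupled.ae_typical {N : ℕ} (hN : 0 < N) : ∀ᵐ ω ∂P, Typical β N (𝓗 ω) := by
  have h := PrefAttach.ae_typical (β := β) hN fun i hi => initialState_eq_zero hi
  rw [← hC.law] at h
  exact ae_of_ae_map hC.measurable.aemeasurable h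

lemma Coupled.ae_TA : ∀ᵐ ω ∂P, ∀ n, TA BI n ω = elapsed 1 (𝓗 ω) (n - 1) := by
  filter_upwards [hC.ae_typical one_pos, hC.jump] with ω h1 h2 n
  exact branchTimeA_eq_elapsed h1.regular h2 n

lemma Coupled.ae_TB : ∀ᵐ ω ∂P, ∀ n, TB BI n ω = elapsed 2 (𝓗 ω) (n - 1) := by
  filter_upwards [hC.ae_typical two_pos, hC.jump] with ω h1 h2 n
  exact branchTimeB_eq_elapsed h1.regular h2 n

/-- The limit variables of the processes. -/
noncomputable def sigma (𝓗 : Ω → Clocks) (i : ℕ) (ω : Ω) : ℝ := rowLimit (i - 1) (𝓗 ω)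

lemma Coupled.hasLaw_sigma (i : ℕ) :
    HasLaw (sigma 𝓗 (i + 1)) (gammaMeasure ((initialState i : ℝ) + β) 1) P :=
  (hasLaw_rowLimit (β := β) initialState i).comp ⟨hC.measurable.aemeasurable, hC.law⟩

lemma Coupled.iIndepFun_sigma : iIndepFun (fun i : ℕ+ => sigma 𝓗 i) P := by
  have h1 := (iIndepFun_row (β := β) initialState).comp (fun _ => growthLimit)
    fun _ => measurable_growthLimit
  have h2 := iIndepFun_comp_of_map hC.measurable hC.law (fun i => measurable_rowLimit i) h1
  exact h2.precomp (g := PNat.natPred) PNat.natPred_injective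

lemma Coupled.hasLaw_speed {N : ℕ} (hN : 1 ≤ N) :
    HasLaw (fun ω => speed β N (𝓗 ω)) (gammaMeasure ((1 + N * β) / (1 + β)) 1) P := by
  have h := PrefAttach.hasLaw_speed (β := β) (N := N) (d := initialState) (by omega)
    fun i hi => initialState_eq_zero (by omega)
  rw [totalRate_initialState hN] at h
  exact h.comp ⟨hC.measurable.aemeasurable, hC.law⟩

variable {N : ℕ} (hN1 : 1 ≤ N) {T : ℕ → Ω → ℝ}
  (hT : ∀ᵐ ω ∂P, ∀ n, T n ω = elapsed N (𝓗 ω) (n - 1))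
include hN1 hT

lemma Coupled.tendsto_speed (hβδ : β = 1 + δ) : ∀ᵐ ω ∂P, Tendsto (fun n : ℕ => (n : ℝ) /
    Real.exp ((2 + δ) * T n ω)) atTop (𝓝 (speed β N (𝓗 ω))) := by
  filter_upwards [hC.ae_typical hN1, hT] with ω h1 h2
  rw [← tendsto_add_atTop_iff_nat 1]
  refine h1.tendsto_succ_speed.congr fun n => ?_
  rw [h2, Real.exp_neg, div_eq_mul_inv, hβδ, Nat.add_sub_cancel, ← add_assoc, one_add_one_eq_two]

/-- As `T n` is `elapsed (n - 1)`, the birth time of row `i` reads `T (i + 1 + 1 - N)`: `T^A_{i+1}`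
for `N = 1` and `T^B_i` for `N = 2`. -/
lemma Coupled.path_elapsed : ∀ᵐ ω ∂P, ∀ i r : ℕ, i ≤ r →
    BI (i + 1) (T (r + 1) ω - T (i + 1 + 1 - N) ω) ω = start (i + 1) + wins N (𝓗 ω) i r := by
  filter_upwards [hC.ae_typical hN1, hT, hC.path] with ω h1 h2 h3 i r hir
  have h4 := h1.regular.elapsed_mem (show i < N + r by omega)
  have h5 : i + 1 + 1 - N - 1 = i + 1 - N := by omega
  rw [h2, h2, Nat.add_sub_cancel, h5]
  exact h3 i _ _ (by linarith) (by linarith)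

lemma Coupled.tendsto_sigma (i : ℕ) : ∀ᵐ ω ∂P, Tendsto
    (fun n : ℕ => (BI (i + 1) (T n ω - T (i + 1 + 1 - N) ω) ω : ℝ) / Real.exp (T n ω)) atTop
    (𝓝 (sigma 𝓗 (i + 1) ω * Real.exp (-T (i + 1 + 1 - N) ω))) := by
  filter_upwards [hC.ae_typical hN1, hT, hC.path_elapsed hN1 hT] with ω h1 h2 h3
  rw [← tendsto_add_atTop_iff_nat 1]
  have h5 : i + 1 + 1 - N - 1 = i + 1 - N := by omega
  have h4 := h1.tendsto_wins_mul i (start (i + 1))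
  rw [sigma, h2 (i + 1 + 1 - N), Nat.add_sub_cancel, h5]
  refine h4.congr' ?_
  filter_upwards [eventually_ge_atTop i] with r hr
  rw [← h3 i r hr, h2 (r + 1), h2 (i + 1 + 1 - N), Nat.add_sub_cancel, h5, Real.exp_neg,
    div_eq_mul_inv]

lemma Coupled.indepFun_sigma (i : ℕ) :
    IndepFun (sigma 𝓗 (i + 1)) (fun ω => Real.exp (-T (i + 1 + 1 - N) ω)) P := by
  have h5 : i + 1 + 1 - N - 1 = i + 1 - N := by omega
  have h1 := (indepFun_rowLimit_elapsed (β := β) initialState (N := N) (by omega) i).comp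
    measurable_id (Real.measurable_exp.comp measurable_neg)
  have h2 := indepFun_comp_of_map hC.measurable hC.law (measurable_rowLimit i)
    ((Real.measurable_exp.comp measurable_neg).comp (measurable_elapsed N (i + 1 - N))) h1
  refine h2.congr (Eventually.of_forall fun ω => rfl) ?_
  filter_upwards [hT] with ω hω
  rw [hω, h5]
  rfl

/-- The limit of the normalized maximal degree. -/
noncomputable def maxLimit (δ : ℝ) (W : Ω → ℝ) (σ : ℕ → Ω → ℝ) (s : ℕ → Ω → ℝ) (ω : Ω) : ℝ :=
  W ω ^ (-(1 / (2 + δ))) * ⨆ i : ℕ+, σ i ω * Real.exp (-s i ω)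

lemma Coupled.tendsto_normMaxDegree (hβδ : β = 1 + δ) :
    ∀ᵐ ω ∂P, (∃ i : ℕ, 1 ≤ i ∧ ∀ j : ℕ, 1 ≤ j →
      sigma 𝓗 j ω * Real.exp (-T (j + 1 - N) ω) ≤ sigma 𝓗 i ω * Real.exp (-T (i + 1 - N) ω)) ∧
    Tendsto (fun n => normMaxDegree δ (fun n ω => embedTarget N n (𝓗 ω)) n ω) atTop
      (𝓝 (maxLimit δ (fun ω => speed β N (𝓗 ω)) (sigma 𝓗) (fun i => T (i + 1 - N)) ω)) := by
  filter_upwards [hC.ae_typical hN1, hT] with ω h1 h2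
  have h5 : ∀ i, i + 1 + 1 - N - 1 = i + 1 - N := by omega
  obtain ⟨⟨m, hm⟩, h3⟩ := h1.tendsto_max hN1 (c := fun i => start (i + 1)) fun i => by
    rw [start]
    split_ifs <;> omega
  constructor
  · refine ⟨m + 1, by omega, fun j hj => ?_⟩
    obtain ⟨j, rfl⟩ := Nat.exists_eq_add_of_le' hj
    simp only [h2, h5, sigma, Nat.add_sub_cancel]
    exact hm j
  · rw [← tendsto_add_atTop_iff_nat 1]
    have hsup : ⨆ i : ℕ+, sigma 𝓗 i ω * Real.exp (-T (i + 1 - N) ω) =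
        ⨆ i : ℕ, rowLimit i (𝓗 ω) * Real.exp (-elapsed N (𝓗 ω) (i + 1 - N)) := by
      rw [← Equiv.pnatEquivNat.symm.surjective.iSup_comp]
      refine iSup_congr fun i => ?_
      simp only [h2, sigma, Equiv.pnatEquivNat_symm_apply, Nat.succPNat_coe, Nat.succ_eq_add_one, h5,
        Nat.add_sub_cancel]
    have hexp : 1 + β = 2 + δ := by rw [hβδ]; ring
    rw [maxLimit, hsup, ← hexp]
    refine h3.congr fun r => ?_
    rw [normMaxDegree, maxDegree_embedTarget, hexp]

end

end PrefAttach

/-! ### Assembly of the theorem: Model A as `N = 1`, Model B as `N = 2` -/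

theorem mainTheorem5 {Ω : Type*} [MeasurableSpace Ω] (P : Measure Ω) [IsProbabilityMeasure P]
    (δ : ℝ) (hδ : -1 < δ) (BI : ℕ → ℝ → Ω → ℕ) (hBI : IsBIFamily P δ BI) :
    ∃ (σ : ℕ → Ω → ℝ) (WA WB : Ω → ℝ),
      -- the random variables `W_A`, `W_B`
      ((∀ᵐ ω ∂P, Tendsto (fun n : ℕ => (n : ℝ) / Real.exp ((2 + δ) * TA BI n ω)) atTop
          (𝓝 (WA ω))) ∧
        HasLaw WA (expMeasure 1) P) ∧
      ((∀ᵐ ω ∂P, Tendsto (fun n : ℕ => (n : ℝ) / Real.exp ((2 + δ) * TB BI n ω)) atTop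
          (𝓝 (WB ω))) ∧
        HasLaw WB (gammaMeasure ((3 + 2 * δ) / (2 + δ)) 1) P) ∧
      -- (i) growth of the individual processes
      (∀ i : ℕ, 1 ≤ i → ∀ᵐ ω ∂P, Tendsto
        (fun n : ℕ => (BI i (TA BI n ω - TA BI i ω) ω : ℝ) / Real.exp (TA BI n ω)) atTop
        (𝓝 (σ i ω * Real.exp (-TA BI i ω)))) ∧
      (∀ i : ℕ, 1 ≤ i → ∀ᵐ ω ∂P, Tendsto
        (fun n : ℕ => (BI i (TB BI n ω - TB BI (i - 1) ω) ω : ℝ) / Real.exp (TB BI n ω)) atTop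
        (𝓝 (σ i ω * Real.exp (-TB BI (i - 1) ω)))) ∧
      iIndepFun (fun i : ℕ+ => σ i) P ∧
      HasLaw (σ 1) (gammaMeasure (2 + δ) 1) P ∧
      (∀ i : ℕ, 2 ≤ i → HasLaw (σ i) (gammaMeasure (1 + δ) 1) P) ∧
      (∀ i : ℕ, 1 ≤ i → IndepFun (σ i) (fun ω => Real.exp (-TA BI i ω)) P) ∧
      (∀ i : ℕ, 1 ≤ i → IndepFun (σ i) (fun ω => Real.exp (-TB BI (i - 1) ω)) P) ∧
      -- (ii) the maximal degree, Model A: the maximum in the limit exists; convergence in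
      -- probability holds for the graph process realized by the embedding and, for every
      -- graph process of Model A, to a limit with the same law
      (∀ᵐ ω ∂P, ∃ i : ℕ, 1 ≤ i ∧ ∀ j : ℕ, 1 ≤ j →
        σ j ω * Real.exp (-TA BI j ω) ≤ σ i ω * Real.exp (-TA BI i ω)) ∧
      (∃ J : ℕ → Ω → ℕ, IsModelA P δ J ∧
        (∀ᵐ ω ∂P, ∀ n i : ℕ, 1 ≤ i → i ≤ n →
          degree (fun m => J m ω) i n = BI i (TA BI n ω - TA BI i ω) ω) ∧
        TendstoInMeasure P (normMaxDegree δ J) atTop (limitA δ BI σ WA)) ∧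
      (∀ (Ω' : Type*) [MeasurableSpace Ω'] (P' : Measure Ω') [IsProbabilityMeasure P']
        (J : ℕ → Ω' → ℕ), IsModelA P' δ J →
        ∃ L : Ω' → ℝ, IdentDistrib L (limitA δ BI σ WA) P' P ∧
          TendstoInMeasure P' (normMaxDegree δ J) atTop L) ∧
      -- (ii) the maximal degree, Model B
      (∀ᵐ ω ∂P, ∃ i : ℕ, 1 ≤ i ∧ ∀ j : ℕ, 1 ≤ j →
        σ j ω * Real.exp (-TB BI (j - 1) ω) ≤ σ i ω * Real.exp (-TB BI (i - 1) ω)) ∧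
      (∃ J : ℕ → Ω → ℕ, IsModelB P δ J ∧
        (∀ᵐ ω ∂P, ∀ n i : ℕ, 1 ≤ i → i ≤ n →
          degree (fun m => J m ω) i n = BI i (TB BI n ω - TB BI (i - 1) ω) ω) ∧
        TendstoInMeasure P (normMaxDegree δ J) atTop (limitB δ BI σ WB)) ∧
      (∀ (Ω' : Type*) [MeasurableSpace Ω'] (P' : Measure Ω') [IsProbabilityMeasure P']
        (J : ℕ → Ω' → ℕ), IsModelB P' δ J →
        ∃ L : Ω' → ℝ, IdentDistrib L (limitB δ BI σ WB) P' P ∧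
          TendstoInMeasure P' (normMaxDegree δ J) atTop L) := by
  set β : ℝ := 1 + δ with hβδ
  have hβ : Fact (0 < β) := ⟨by linarith⟩
  have hexp : 1 + β = 2 + δ := by rw [hβδ]; ring
  have hne : 2 + δ ≠ 0 := by linarith
  obtain ⟨𝓗, hC⟩ := exists_coupled hβδ hBI
  have hA := hC.ae_TA
  have hB := hC.ae_TB
  have hmA := isModel_embedTarget (P := P) hC.measurable hC.law le_rfl one_le_two hβδ
  have hmB := isModel_embedTarget (P := P) hC.measurable hC.law one_le_two le_rfl hβδ
  have hlA := hC.tendsto_normMaxDegree le_rfl hA hβδ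
  have hlB := hC.tendsto_normMaxDegree one_le_two hB hβδ
  have hnorm : ∀ {N : ℕ}, IsModel N P δ (fun n ω => embedTarget N n (𝓗 ω)) → ∀ n,
      AEStronglyMeasurable (normMaxDegree δ (fun n ω => embedTarget N n (𝓗 ω)) n) P :=
    fun h n => (h.measurable_normMaxDegree n).aestronglyMeasurable
  have hdeg : ∀ {N : ℕ} {T : ℕ → Ω → ℝ}, (∀ᵐ ω ∂P, ∀ i r : ℕ, i ≤ r →
      BI (i + 1) (T (r + 1) ω - T (i + 1 + 1 - N) ω) ω = start (i + 1) + wins N (𝓗 ω) i r) →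
      ∀ᵐ ω ∂P, ∀ n i : ℕ, 1 ≤ i → i ≤ n → degree (fun m => embedTarget N m (𝓗 ω)) i n =
        BI i (T n ω - T (i + 1 - N) ω) ω := by
    intro N T h
    filter_upwards [h] with ω hω n i hi hin
    obtain ⟨i, rfl⟩ := Nat.exists_eq_add_of_le' hi
    obtain ⟨n, rfl⟩ := Nat.exists_eq_add_of_le' (hi.trans hin)
    rw [degree_embedTarget N (𝓗 ω) (by omega), hω i n (by omega)]
  refine ⟨sigma 𝓗, fun ω => speed β 1 (𝓗 ω), fun ω => speed β 2 (𝓗 ω),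
    ⟨hC.tendsto_speed le_rfl hA hβδ, ?_⟩, ⟨hC.tendsto_speed one_le_two hB hβδ, ?_⟩,
    fun i hi => ?_, fun i hi => ?_, hC.iIndepFun_sigma, ?_, fun i hi => ?_, fun i hi => ?_,
    fun i hi => ?_, hlA.mono fun ω h => h.1, ⟨_, isModelA_iff.mpr hmA,
      hdeg (hC.path_elapsed le_rfl hA), ?_⟩, ?_, hlB.mono fun ω h => h.1, ⟨_, isModelB_iff.mpr hmB,
      hdeg (hC.path_elapsed one_le_two hB), ?_⟩, ?_⟩
  -- For `N = 1` the shape `(1 + β) / (1 + β)` is `1`, and `gammaMeasure 1 1` is `expMeasure 1` by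
  -- definition.
  · have h := hC.hasLaw_speed (N := 1) le_rfl
    rw [Nat.cast_one, one_mul, div_self (by rw [hexp]; exact hne)] at h
    exact h
  · have h := hC.hasLaw_speed (N := 2) one_le_two
    rw [hexp, show 1 + ((2 : ℕ) : ℝ) * β = 3 + 2 * δ by rw [hβδ]; push_cast; ring] at h
    exact h
  · obtain ⟨i, rfl⟩ := Nat.exists_eq_add_of_le' hi
    exact hC.tendsto_sigma le_rfl hA i
  · obtain ⟨i, rfl⟩ := Nat.exists_eq_add_of_le' hi
    exact hC.tendsto_sigma one_le_two hB i
  · have h := hC.hasLaw_sigma 0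
    rw [show ((initialState 0 : ℕ) : ℝ) + β = 2 + δ by rw [← hexp]; simp [initialState]] at h
    exact h
  · obtain ⟨i, rfl⟩ := Nat.exists_eq_add_of_le' (show 1 ≤ i by omega)
    have h := hC.hasLaw_sigma i
    rw [initialState_eq_zero (by omega), Nat.cast_zero, zero_add] at h
    exact h
  · obtain ⟨i, rfl⟩ := Nat.exists_eq_add_of_le' hi
    exact hC.indepFun_sigma le_rfl hA i
  · obtain ⟨i, rfl⟩ := Nat.exists_eq_add_of_le' hi
    exact hC.indepFun_sigma one_le_two hB i
  · exact tendstoInMeasure_of_tendsto_ae (hnorm hmA) (hlA.mono fun ω h => h.2)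
  · intro Ω' _ P' _ J hJ
    exact hmA.exists_limit le_rfl one_le_two hδ (isModelA_iff.mp hJ) (hlA.mono fun ω h => h.2)
  · exact tendstoInMeasure_of_tendsto_ae (hnorm hmB) (hlB.mono fun ω h => h.2)
  · intro Ω' _ P' _ J hJ
    exact hmB.exists_limit one_le_two le_rfl hδ (isModelB_iff.mp hJ) (hlB.mono fun ω h => h.2)
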